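/- **Brauer's first main theorem for profinite groups.** Let $p$ be a prime, $k$ a (discrete) field of characteristic $p$, $G$ a profinite group, $P$ a $p$-Sylow subgroup of $G$ (a closed pro-$p$ subgroup such that $p$ does not divide $|G:PN|$ for any open normal subgroup $N$ of $G$) and $D$ an open subgroup of $P$. *Definitions.* For a profinite group $\Gamma$, let $k[[\Gamma]]=\varprojlim_N k[\Gamma/N]$ ($N$ running through the open normal subgroups of $\Gamma$) be the completed group algebra with the inverse limit topology, on which $\Gamma$ acts by conjugation; for $H\leq \Gamma$ let $k[[\Gamma]]^H$ be the subalgebra of $H$-fixed points. A block of $\Gamma$ is an algebra $k[[\Gamma]]e$ where the block idempotent $e$ is a primitive idempotent of the center of $k[[\Gamma]]$. For $H\leq L$ closed subgroups of $\Gamma$ with $H$ open in $L$, put $\mathrm{Tr}_H^L(a)=\sum_{g\in L/H} gag^{-1}$ for $a\in k[[\Gamma]]^H$. For a closed subgroup $H$ of $\Gamma$ put $\mathrm{oTr}_H^\Gamma=\bigcap_{N}\mathrm{Tr}_{HN}^\Gamma(k[[\Gamma]]^{HN})$, the intersection over the open normal subgroups $N$ of $\Gamma$. A defect group of a block with block idempotent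 $e$ is a closed subgroup $H$ of $\Gamma$ that is minimal among the closed subgroups with $e\in\mathrm{oTr}_H^\Gamma$. The Brauer homomorphism is the natural projection $$\mathrm{Br}_D:k[[G]]^D\to k[[G]]^D\Big/\,\overline{\sum_{Q}\mathrm{Tr}_Q^D(k[[G]]^Q)},$$ where $Q$ runs through the proper open subgroups of $D$; its target is identified with $k[[C_G(D)]]\subseteq k[[N_G(D)]]$ through the isomorphism that is induced by the inclusion $C_G(D)\to G$. If $b$ is a block of $N_G(D)$ with block idempotent $f$ and defect group $D$, its Brauer correspondent $b^G$ is the unique block of $G$ whose block idempotent $e$ satisfies $f=f\cdot\mathrm{Br}_D(e)$. *Statement.* Every block $b$ of $N_G(D)$ with defect group $D$ has a Brauer correspondent $b^G$ (there is exactly one block of $G$ whose block idempotent $e$ satisfies $f=f\cdot\mathrm{Br}_D(e)$), the block $b^G$ has defect group $D$, and $b\mapsto b^G$ is a bijection from the set of blocks of $N_G(D)$ with defect group $D$ onto the set of blocks of $G$ with defect group $D$. -/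

import Mathlib

/-!
Blocks, defect groups and the Brauer homomorphism for the completed group algebra `k[[G]]` of a
profinite group `G` over a discrete field `k`.
-/

noncomputable section

namespace ProfiniteBlocks

/-! ### Pro-`p` groups and Sylow subgroups -/

/-- A profinite group is pro-`p` if all its finite continuous quotients are `p`-groups. -/
def IsProP (p : ℕ) (P : Type*) [Group P] [TopologicalSpace P] : Prop :=
  ∀ N : OpenNormalSubgroup P, IsPGroup p (P ⧸ N.toSubgroup)

/-- `P` is a `p`-Sylow subgroup of the profinite group `G`: a closed pro-`p` subgroup whose index
(the supernatural number `lcm |G : PN|`, over the open normal subgroups `N`) is prime to `p`. -/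
structure IsSylowSubgroup (p : ℕ) {G : Type*} [Group G] [TopologicalSpace G]
    (P : Subgroup G) : Prop where
  isClosed : IsClosed (P : Set G)
  isProP : IsProP p P
  not_dvd_index : ∀ N : OpenNormalSubgroup G, ¬ p ∣ (P ⊔ N.toSubgroup).index

/-! ### The completed group algebra -/

section Algebra

variable (k : Type*) [Field k] (G : Type*) [Group G] [TopologicalSpace G]

variable {G} in
/-- The canonical projection `k[G/N] → k[G/M]`, for `N ≤ M`. -/
def transition {N M : OpenNormalSubgroup G} (h : N.toSubgroup ≤ M.toSubgroup) :
    MonoidAlgebra k (G ⧸ N.toSubgroup) →ₐ[k] MonoidAlgebra k (G ⧸ M.toSubgroup) :=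
  MonoidAlgebra.mapDomainAlgHom k k
    (QuotientGroup.map N.toSubgroup M.toSubgroup (MonoidHom.id G)
      (h.trans_eq (Subgroup.comap_id M.toSubgroup).symm))

variable {k G} in
theorem transition_single {N M : OpenNormalSubgroup G} (h : N.toSubgroup ≤ M.toSubgroup) (g : G) :
    transition k h (MonoidAlgebra.single (g : G ⧸ N.toSubgroup) 1) =
      MonoidAlgebra.single (g : G ⧸ M.toSubgroup) 1 := by
  simp [transition]

/-- The compatible families in `∏ k[G/N]`, over the open normal subgroups `N` of `G`. -/
def compatibleFamilies :
    Subalgebra k (∀ N : OpenNormalSubgroup G, MonoidAlgebra k (G ⧸ N.toSubgroup)) where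
  carrier := {x | ∀ (N M : OpenNormalSubgroup G) (h : N.toSubgroup ≤ M.toSubgroup),
    transition k h (x N) = x M}
  mul_mem' {x y} hx hy N M h := by
    simp only [Pi.mul_apply, map_mul]
    rw [hx N M h, hy N M h]
  add_mem' {x y} hx hy N M h := by
    simp only [Pi.add_apply, map_add]
    rw [hx N M h, hy N M h]
  algebraMap_mem' r N M h := by
    rw [Pi.algebraMap_apply, Pi.algebraMap_apply]
    exact AlgHom.commutes _ r

/-- The completed group algebra `k[[G]]`, the inverse limit of the algebras `k[G/N]` over the open
normal subgroups `N` of `G`. -/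
def CompletedGroupAlgebra : Type _ := compatibleFamilies k G

namespace CompletedGroupAlgebra

instance : Ring (CompletedGroupAlgebra k G) :=
  inferInstanceAs (Ring (compatibleFamilies k G))

instance : Algebra k (CompletedGroupAlgebra k G) :=
  inferInstanceAs (Algebra k (compatibleFamilies k G))

variable {G}

/-- The canonical projection `k[[G]] → k[G/N]`. -/
def proj (N : OpenNormalSubgroup G) :
    CompletedGroupAlgebra k G →ₐ[k] MonoidAlgebra k (G ⧸ N.toSubgroup) :=
  (Pi.evalAlgHom k (fun N : OpenNormalSubgroup G => MonoidAlgebra k (G ⧸ N.toSubgroup)) N).comp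
    (compatibleFamilies k G).val

/-- The inverse limit topology, where every `k[G/N]` is discrete. -/
instance : TopologicalSpace (CompletedGroupAlgebra k G) :=
  ⨅ N : OpenNormalSubgroup G, TopologicalSpace.induced (proj k N) ⊥

variable {k}

theorem ext_proj {x y : CompletedGroupAlgebra k G} (h : ∀ N, proj k N x = proj k N y) : x = y :=
  Subtype.ext (funext h)

theorem isLocallyConstant_proj (N : OpenNormalSubgroup G) : IsLocallyConstant (proj k N) := by
  have h : @Continuous _ _ _ ⊥ (proj k N) :=
    continuous_iInf_dom (i := N) continuous_induced_dom
  intro s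
  exact @Continuous.isOpen_preimage _ _ _ ⊥ _ h s
    (@isOpen_discrete _ ⊥ (@DiscreteTopology.mk _ ⊥ rfl) s)

theorem continuous_of_proj {X : Type*} [TopologicalSpace X] {f : X → CompletedGroupAlgebra k G}
    (h : ∀ N, IsLocallyConstant fun x => proj k N (f x)) : Continuous f :=
  continuous_iInf_rng.2 fun N => continuous_induced_rng.2
    (@IsLocallyConstant.continuous _ _ _ ⊥ _ (h N))

instance : IsTopologicalRing (CompletedGroupAlgebra k G) where
  continuous_add := continuous_of_proj fun N => by
    simp only [map_add]
    exact
      ((isLocallyConstant_proj N).comp_continuous continuous_fst).add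
        ((isLocallyConstant_proj N).comp_continuous continuous_snd)
  continuous_mul := continuous_of_proj fun N => by
    simp only [map_mul]
    exact
      ((isLocallyConstant_proj N).comp_continuous continuous_fst).mul
        ((isLocallyConstant_proj N).comp_continuous continuous_snd)
  continuous_neg := continuous_of_proj fun N => by
    simp only [map_neg]
    exact (isLocallyConstant_proj N).neg

instance : ContinuousConstSMul k (CompletedGroupAlgebra k G) where
  continuous_const_smul c := continuous_of_proj fun N => by
    simp only [map_smul]
    exact (isLocallyConstant_proj N).comp (fun x => c • x)

variable (k)

/-- The canonical homomorphism from `G` to the group of units of `k[[G]]`. -/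
def of : G →* CompletedGroupAlgebra k G where
  toFun g := ⟨fun N => MonoidAlgebra.of k (G ⧸ N.toSubgroup) (g : G ⧸ N.toSubgroup),
    fun N M h => by simp [transition]⟩
  map_one' := Subtype.ext (funext fun N => map_one _)
  map_mul' g h := ext_proj fun N =>
    map_mul (MonoidAlgebra.of k (G ⧸ N.toSubgroup)) (g : G ⧸ N.toSubgroup) h

variable {k}

theorem proj_of (N : OpenNormalSubgroup G) (g : G) :
    proj k N (of k g) = MonoidAlgebra.single (g : G ⧸ N.toSubgroup) 1 := rfl

/-- The pullback of an open normal subgroup under a continuous homomorphism. -/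
def comapOpenNormal {H : Type*} [Group H] [TopologicalSpace H] (φ : H →ₜ* G)
    (N : OpenNormalSubgroup G) : OpenNormalSubgroup H where
  toOpenSubgroup := N.toOpenSubgroup.comap φ.toMonoidHom φ.continuous_toFun
  isNormal' := Subgroup.Normal.comap N.isNormal' φ.toMonoidHom

variable (k)

/-- The homomorphism `k[H/φ⁻¹(N)] → k[G/N]` induced by `φ : H → G`. -/
def mapAt {H : Type*} [Group H] [TopologicalSpace H] (φ : H →ₜ* G) (N : OpenNormalSubgroup G) :
    MonoidAlgebra k (H ⧸ (comapOpenNormal φ N).toSubgroup) →ₐ[k]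
      MonoidAlgebra k (G ⧸ N.toSubgroup) :=
  MonoidAlgebra.mapDomainAlgHom k k
    (QuotientGroup.map (comapOpenNormal φ N).toSubgroup N.toSubgroup φ.toMonoidHom fun _ h => h)

variable {k} in
theorem mapAt_single {H : Type*} [Group H] [TopologicalSpace H] (φ : H →ₜ* G)
    (N : OpenNormalSubgroup G) (a : H) :
    mapAt k φ N (MonoidAlgebra.single (a : H ⧸ (comapOpenNormal φ N).toSubgroup) 1) =
      MonoidAlgebra.single ((φ a : G) : G ⧸ N.toSubgroup) 1 := by
  simp [mapAt]

/-- The algebra homomorphism `k[[H]] → k[[G]]` induced by a continuous homomorphism `φ : H → G`: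
its component at `N` is `k[[H]] → k[H/φ⁻¹(N)] → k[G/N]`. -/
def map {H : Type*} [Group H] [TopologicalSpace H] (φ : H →ₜ* G) :
    CompletedGroupAlgebra k H →ₐ[k] CompletedGroupAlgebra k G :=
  AlgHom.codRestrict
    (AlgHom.pi fun N : OpenNormalSubgroup G => (mapAt k φ N).comp (proj k (comapOpenNormal φ N)))
    (compatibleFamilies k G) fun x N M h => by
      have h' : (comapOpenNormal φ N).toSubgroup ≤ (comapOpenNormal φ M).toSubgroup :=
        fun a ha => h ha
      have hx : transition k h' (proj k (comapOpenNormal φ N) x) =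
        proj k (comapOpenNormal φ M) x :=
        x.2 (comapOpenNormal φ N) (comapOpenNormal φ M) h'
      have hc : (transition k h).comp (mapAt k φ N) = (mapAt k φ M).comp
          (transition k h') := by
        refine MonoidAlgebra.algHom_ext (fun q => ?_) (Subsingleton.elim _ _)
        obtain ⟨a, rfl⟩ := QuotientGroup.mk_surjective q
        change transition k h (mapAt k φ N (MonoidAlgebra.single _ 1)) =
          mapAt k φ M (transition k h' (MonoidAlgebra.single _ 1))
        rw [mapAt_single, transition_single,
          transition_single, mapAt_single]
      have := DFunLike.congr_fun hc (proj k (comapOpenNormal φ N) x)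
      rw [AlgHom.comp_apply, AlgHom.comp_apply, hx] at this
      exact this

variable {k} in
theorem proj_map {H : Type*} [Group H] [TopologicalSpace H] (φ : H →ₜ* G)
    (N : OpenNormalSubgroup G) (x : CompletedGroupAlgebra k H) :
    proj k N (map k φ x) = mapAt k φ N (proj k (comapOpenNormal φ N) x) := rfl

end CompletedGroupAlgebra

end Algebra

open CompletedGroupAlgebra

/-! ### Fixed points and traces for the conjugation action -/

section Action

variable (k : Type*) [Field k] {G : Type*} [Group G] [TopologicalSpace G]

/-- The conjugation action `x ↦ g x g⁻¹` of `g ∈ G` on `k[[G]]`. -/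
def conj (g : G) : CompletedGroupAlgebra k G →ₗ[k] CompletedGroupAlgebra k G :=
  LinearMap.mulLeft k (of k g) ∘ₗ LinearMap.mulRight k (of k g⁻¹)

variable {k} in
theorem conj_apply (g : G) (x : CompletedGroupAlgebra k G) :
    conj k g x = of k g * (x * of k g⁻¹) := rfl

variable {k} in
theorem conj_mul (g : G) (x y : CompletedGroupAlgebra k G) :
    conj k g (x * y) = conj k g x * conj k g y := by
  have h : of k g⁻¹ * of k g = (1 : CompletedGroupAlgebra k G) := by
    rw [← map_mul, inv_mul_cancel, map_one]
  simp only [conj_apply, mul_assoc]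
  rw [← mul_assoc (of k g⁻¹) (of k g), h, one_mul]

/-- The subalgebra `k[[G]]^H` of `H`-fixed points of `k[[G]]` under conjugation. -/
def fixedPoints (H : Subgroup G) : Subalgebra k (CompletedGroupAlgebra k G) where
  carrier := {x | ∀ h ∈ H, conj k h x = x}
  mul_mem' {x y} hx hy h hh := by rw [conj_mul, hx h hh, hy h hh]
  add_mem' {x y} hx hy h hh := by rw [map_add, hx h hh, hy h hh]
  algebraMap_mem' r h _ := by
    rw [conj_apply, Algebra.commutes r (of k h⁻¹), ← mul_assoc, ← map_mul, mul_inv_cancel, map_one,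
      one_mul]

/-- The trace map `x ↦ ∑_{g ∈ L/H} g x g⁻¹`, for `H` an open subgroup of the closed subgroup `L`
of the profinite group `G` (so that `L/H` is finite). It is meant to be applied to elements of
`k[[G]]^H`, where it does not depend on the chosen coset representatives. -/
def trace (H L : Subgroup G) : CompletedGroupAlgebra k G →ₗ[k] CompletedGroupAlgebra k G :=
  ∑ᶠ q : L ⧸ H.subgroupOf L, conj k (q.out : G)

/-- The image `Tr_H^L(k[[G]]^H)` of the trace map. -/
def traceImage (H L : Subgroup G) : Submodule k (CompletedGroupAlgebra k G) :=
  (Subalgebra.toSubmodule (fixedPoints k H)).map (trace k H L)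

/-- The set `oTr_H^G(k[[G]]^H)`, the intersection of the images `Tr_{HN}^G(k[[G]]^{HN})` over the
open normal subgroups `N` of `G`. -/
def oTr (H : Subgroup G) : Submodule k (CompletedGroupAlgebra k G) :=
  ⨅ N : OpenNormalSubgroup G, traceImage k (H ⊔ N.toSubgroup) ⊤

/-! ### The Brauer homomorphism -/

variable {k} in
theorem mul_trace_apply {L : Subgroup G} (H : Subgroup G) {b : CompletedGroupAlgebra k G}
    (hb : b ∈ fixedPoints k L) (a : CompletedGroupAlgebra k G) :
    b * trace k H L a = trace k H L (b * a) := by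
  by_cases hf : (Function.support fun q : L ⧸ H.subgroupOf L => conj k (q.out : G)).Finite
  · simp only [trace, finsum_eq_sum _ hf, LinearMap.sum_apply, Finset.mul_sum]
    exact Finset.sum_congr rfl fun q _ => by rw [conj_mul, hb _ (q.out).2]
  · simp only [trace, finsum_of_infinite_support hf, LinearMap.zero_apply, mul_zero]

variable {k} in
theorem trace_apply_mul {L : Subgroup G} (H : Subgroup G) {b : CompletedGroupAlgebra k G}
    (hb : b ∈ fixedPoints k L) (a : CompletedGroupAlgebra k G) :
    trace k H L a * b = trace k H L (a * b) := by
  by_cases hf : (Function.support fun q : L ⧸ H.subgroupOf L => conj k (q.out : G)).Finite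
  · simp only [trace, finsum_eq_sum _ hf, LinearMap.sum_apply, Finset.sum_mul]
    exact Finset.sum_congr rfl fun q _ => by rw [conj_mul, hb _ (q.out).2]
  · simp only [trace, finsum_of_infinite_support hf, LinearMap.zero_apply, zero_mul]

theorem fixedPoints_anti {H L : Subgroup G} (h : H ≤ L) : fixedPoints k L ≤ fixedPoints k H :=
  fun _ hx g hg => hx g (h hg)

/-- The sum of the images `Tr_Q^D(k[[G]]^Q)` over the proper open subgroups `Q` of `D`. -/
def properTraces (D : Subgroup G) : Submodule k (CompletedGroupAlgebra k G) :=
  ⨆ Q : {Q : Subgroup G // Q < D ∧ IsOpen (Q.subgroupOf D : Set D)}, traceImage k Q.1 D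

variable {k} in
theorem mul_mem_properTraces {D : Subgroup G} {b x : CompletedGroupAlgebra k G}
    (hb : b ∈ fixedPoints k D) (hx : x ∈ properTraces k D) :
    b * x ∈ properTraces k D ∧ x * b ∈ properTraces k D := by
  have h : properTraces k D ≤ (properTraces k D).comap (LinearMap.mulLeft k b) ⊓
      (properTraces k D).comap (LinearMap.mulRight k b) := by
    refine iSup_le fun Q => ?_
    rintro _ ⟨a, ha, rfl⟩
    have hbQ := fixedPoints_anti k Q.2.1.le hb
    have hQ := le_iSup (fun Q : {Q : Subgroup G // Q < D ∧ IsOpen (Q.subgroupOf D : Set D)} =>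
      traceImage k Q.1 D) Q
    refine ⟨?_, ?_⟩
    · change b * trace k Q.1 D a ∈ properTraces k D
      rw [mul_trace_apply Q.1 hb]
      exact hQ ⟨b * a, (fixedPoints k Q.1).mul_mem hbQ ha, rfl⟩
    · change trace k Q.1 D a * b ∈ properTraces k D
      rw [trace_apply_mul Q.1 hb]
      exact hQ ⟨a * b, (fixedPoints k Q.1).mul_mem ha hbQ, rfl⟩
  exact h hx

/-- The closure of the sum of the images `Tr_Q^D(k[[G]]^Q)` over the proper open subgroups `Q` of
`D`, as an ideal of `k[[G]]^D`. -/
def brauerIdeal (D : Subgroup G) : Ideal (fixedPoints k D) where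
  carrier := {x | (x : CompletedGroupAlgebra k G) ∈ (properTraces k D).topologicalClosure}
  add_mem' hx hy := (properTraces k D).topologicalClosure.add_mem hx hy
  zero_mem' := (properTraces k D).topologicalClosure.zero_mem
  smul_mem' b _ hx := map_mem_closure (f := fun y => (b : CompletedGroupAlgebra k G) * y)
    (continuous_const_mul (b : CompletedGroupAlgebra k G)) hx
    fun _ hy => (mul_mem_properTraces b.2 hy).1

instance (D : Subgroup G) : (brauerIdeal k D).IsTwoSided where
  mul_mem_of_left {_} b hx := map_mem_closure
    (f := fun y => y * (b : CompletedGroupAlgebra k G))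
    (continuous_mul_const (b : CompletedGroupAlgebra k G)) hx
    fun _ hy => (mul_mem_properTraces b.2 hy).2

/-- The Brauer quotient `k[[G]]^[D]`. -/
abbrev BrauerQuotient (D : Subgroup G) : Type _ := fixedPoints k D ⧸ brauerIdeal k D

/-- The Brauer homomorphism `Br_D : k[[G]]^D → k[[G]]^[D]`. -/
def brauerHom (D : Subgroup G) : fixedPoints k D →ₐ[k] BrauerQuotient k D :=
  Ideal.Quotient.mkₐ k (brauerIdeal k D)

/-- The inclusion of a subgroup, as a continuous homomorphism. -/
def subtypeHom (H : Subgroup G) : H →ₜ* G where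
  toMonoidHom := H.subtype
  continuous_toFun := continuous_subtype_val

/-- The inclusion of `C_G(D)` in `N_G(D)`, as a continuous homomorphism. -/
def centralizerToNormalizer (D : Subgroup G) :
    Subgroup.centralizer (D : Set G) →ₜ* Subgroup.normalizer (D : Set G) where
  toMonoidHom := Subgroup.inclusion (Subgroup.centralizer_le_normalizer (D : Set G))
  continuous_toFun := continuous_inclusion (Subgroup.centralizer_le_normalizer (D : Set G))

theorem map_centralizer_mem_fixedPoints (D : Subgroup G)
    (c : CompletedGroupAlgebra k (Subgroup.centralizer (D : Set G))) :
    CompletedGroupAlgebra.map k (subtypeHom (Subgroup.centralizer (D : Set G))) c ∈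
      fixedPoints k D := by
  intro d hd
  refine ext_proj fun N => ?_
  rw [conj_apply, map_mul, map_mul]
  rw [proj_map, proj_of, proj_of]
  generalize proj k _ c = y
  induction y using MonoidAlgebra.induction_on with
  | of q =>
    obtain ⟨z, rfl⟩ := QuotientGroup.mk_surjective q
    have hz : d * ((z : G) * d⁻¹) = z := by
      rw [← mul_assoc, Subgroup.mem_centralizer_iff.1 z.2 d hd, mul_inv_cancel_right]
    rw [MonoidAlgebra.of_apply, mapAt_single, MonoidAlgebra.single_mul_single,
      MonoidAlgebra.single_mul_single, ← QuotientGroup.mk_mul, ← QuotientGroup.mk_mul]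
    simp only [mul_one]
    exact congrArg (fun g : G => MonoidAlgebra.single (g : G ⧸ N.toSubgroup) (1 : k)) hz
  | add x y hx hy => rw [map_add, add_mul, mul_add, hx, hy]
  | smul r x hx => rw [map_smul, smul_mul_assoc, mul_smul_comm, hx]

/-- The composition `k[[C_G(D)]] → k[[G]]^D → k[[G]]^[D]` of the map induced by inclusion with the
Brauer homomorphism. For a closed pro-`p` subgroup `D` it is an isomorphism, by which
`k[[G]]^[D]` is identified with `k[[C_G(D)]]`. -/
def centralizerToBrauerQuotient (D : Subgroup G) :
    CompletedGroupAlgebra k (Subgroup.centralizer (D : Set G)) →ₐ[k] BrauerQuotient k D :=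
  (brauerHom k D).comp
    ((CompletedGroupAlgebra.map k (subtypeHom (Subgroup.centralizer (D : Set G)))).codRestrict
      (fixedPoints k D) (map_centralizer_mem_fixedPoints k D))

end Action

/-! ### Blocks and defect groups -/

section Blocks

variable (k : Type*) [Field k] (G : Type*) [Group G] [TopologicalSpace G]

/-- A block of `G`, that is, of the algebra `k[[G]]`. The block is the algebra `k[[G]]e`, where `e`
is a primitive idempotent of the center of `k[[G]]`; it is determined by its identity `e`, the block
idempotent. -/
@[ext]
structure Block where
  /-- The block idempotent. -/
  e : CompletedGroupAlgebra k G
  mem_center : e ∈ Subalgebra.center k (CompletedGroupAlgebra k G)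
  isIdempotentElem : IsIdempotentElem e
  ne_zero : e ≠ 0
  primitive : ∀ e₁ ∈ Subalgebra.center k (CompletedGroupAlgebra k G),
    ∀ e₂ ∈ Subalgebra.center k (CompletedGroupAlgebra k G),
      IsIdempotentElem e₁ → IsIdempotentElem e₂ → e₁ * e₂ = 0 → e = e₁ + e₂ → e₁ = 0 ∨ e₂ = 0

variable {k G}

theorem Block.e_mem_fixedPoints (B : Block k G) (H : Subgroup G) : B.e ∈ fixedPoints k H := by
  intro h _
  rw [conj_apply, ← Subalgebra.mem_center_iff.1 B.mem_center, ← mul_assoc, ← map_mul,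
    mul_inv_cancel, map_one, one_mul]

/-- A defect group of the block `B` with block idempotent `e`: a closed subgroup `D` of `G` which is
minimal such that `e ∈ oTr_D^G(k[[G]]^D)`. -/
def IsDefectGroup (B : Block k G) (D : Subgroup G) : Prop :=
  Minimal (fun H : Subgroup G => IsClosed (H : Set G) ∧ B.e ∈ oTr k H) D

variable (k) in
/-- The blocks of `G` with defect group `D`. -/
abbrev BlocksWithDefectGroup (D : Subgroup G) : Type _ := {B : Block k G // IsDefectGroup B D}

/-- The relation `f = f · Br_D(e)` between the block idempotents `f` of a block `b` of `N_G(D)` and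
`e` of a block `B` of `G`. Here `Br_D(e)` is regarded as an element `c` of `k[[C_G(D)]]`, and thus
of `k[[N_G(D)]]`, through the isomorphism `k[[C_G(D)]] → k[[G]]^[D]`. -/
def IsBrauerCorrespondent (D : Subgroup G) (b : Block k (Subgroup.normalizer (D : Set G)))
    (B : Block k G) : Prop :=
  ∃ c : CompletedGroupAlgebra k (Subgroup.centralizer (D : Set G)),
    centralizerToBrauerQuotient k D c = brauerHom k D ⟨B.e, B.e_mem_fixedPoints D⟩ ∧
      b.e = b.e * CompletedGroupAlgebra.map k (centralizerToNormalizer D) c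

end Blocks

end ProfiniteBlocks

end

noncomputable section

set_option linter.unusedSectionVars false

namespace ProfiniteBlocks

open CompletedGroupAlgebra

/-! ### Actions of `p`-groups on finite sets -/

section FixedPoints

variable {p : ℕ} [Fact p.Prime] {k : Type*} [Field k] [CharP k p] {Γ : Type*} [Group Γ]
  {X : Type*} [Fintype X]

/-! Write H = N_G(D) and C = C_G(D). The engine is one counting fact: when a p-group acts on a
finite set, an invariant function with values in characteristic p has the same sum over the set as
over the fixed points (`sum_eq_sum_fixed`).

Applied to D acting by conjugation on G/M, it shows that restricting coefficients to C is compatible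
with the projections and multiplicative on k[[G]]^D, and that its kernel is approximated by
nontrivial orbit sums. This is the Brauer homomorphism (`exists_brauerMap`,
`centralizerToBrauerQuotient_eq_iff`). Followed by k[[C]] → k[[H]] it gives a map σ for which the
correspondence reads f = fσ(e) (`exists_normalizerMap`).

Applied to D acting by translation on G/DN, it leaves only the cosets of elements of H, by a
Frattini argument (`exists_mul_mem_normalizer`). Hence σ turns traces from DN to G into traces from
D(H ∩ N) to H (`trace_level_eq`), and traces in H supported on C lift modulo N to traces in G
(`exists_mem_traceImage_proj_eq`). Openness of D in P enters here: for small M ≤ N the index |DN :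
DM| is prime to p (`not_dvd_relIndex_sup`), so averaging is possible.

Given f, the central idempotents s with f = fσ(s) have an infimum, which is the block idempotent e
of b^G. If f lies in oTr_D, lift f modulo N to a trace x. Since f absorbs σ(ex) modulo N, ex is not
nilpotent there, so it is invertible in the block (`Block.isNilpotent_or_isUnit`); hence e is a
trace, and a second f' below e cannot be orthogonal to f, which is injectivity. A nonzero
coefficient on C forces D to be minimal (`isDefectGroup_of_coef_ne_zero`). For surjectivity, let e
have defect group D. If e vanished on C, it would modulo M be a sum of traces from proper subgroups
Q of D, each nilpotent in the block by minimality of D (`exists_coef_ne_zero_of_isDefectGroup`). So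
σ(e) ≠ 0, and a block idempotent f of H below σ(e) has defect group D, because central idempotents
of H are supported on elements commuting with D modulo each open normal subgroup
(`mem_centralizer_of_coeff_ne_zero`).

As k may be infinite, k[[G]] need not be compact. Limits of group elements come from compactness of
G; limits of algebra elements come from choices made canonical at each level. -/

open Classical in
-- Each fibre of φ is a stable subset, and its cardinality is congruent modulo p to the number of
-- its fixed points. Only the image of Γ in the permutation group has to be a p-group.
theorem sum_eq_sum_fixed (ρ : Γ →* Equiv.Perm X) (hρ : ∀ g, ∃ n : ℕ, ρ (g ^ p ^ n) = 1)
    (φ : X → k) (hφ : ∀ g x, φ (ρ g x) = φ x) :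
    ∑ x, φ x = ∑ x, if ∀ g, ρ g x = x then φ x else 0 := by
  have hR : IsPGroup p ρ.range := by
    rw [isPGroup_iff_pow_pow_eq_one]
    rintro ⟨_, g, rfl⟩
    obtain ⟨n, hn⟩ := hρ g
    exact ⟨n, Subtype.ext (by simpa using hn)⟩
  have him : ∀ x ∈ Finset.univ, φ x ∈ Finset.univ.image φ :=
    fun x hx => Finset.mem_image_of_mem φ hx
  rw [← Finset.sum_fiberwise_of_maps_to him, ← Finset.sum_fiberwise_of_maps_to him]
  refine Finset.sum_congr rfl fun v _ => ?_
  let Y : SubMulAction ρ.range X :=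
    { carrier := {x | φ x = v}
      smul_mem' := by
        rintro ⟨_, g, rfl⟩ x hx
        exact (hφ g x).trans hx }
  have hY := (CharP.natCast_eq_natCast k p).2 (hR.card_modEq_card_fixedPoints Y)
  have h1 : ∑ x with φ x = v, φ x = (Nat.card Y : k) * v := by
    rw [Finset.sum_congr rfl (g := fun _ => v) (fun x hx => (Finset.mem_filter.1 hx).2),
      Finset.sum_const, nsmul_eq_mul, ← Fintype.card_subtype, ← Nat.card_eq_fintype_card]
    rfl
  have h2 : (∑ x with φ x = v, if ∀ g, ρ g x = x then φ x else 0) =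
      (Nat.card (MulAction.fixedPoints ρ.range Y) : k) * v := by
    rw [← Finset.sum_filter, Finset.sum_congr rfl (g := fun _ => v) (fun x hx =>
      (Finset.mem_filter.1 (Finset.mem_filter.1 hx).1).2),
      Finset.sum_const, nsmul_eq_mul, Finset.filter_filter, ← Fintype.card_subtype,
      ← Nat.card_eq_fintype_card]
    congr 2
    refine Nat.card_congr ⟨fun x => ⟨⟨x.1, x.2.1⟩, ?_⟩, fun y => ⟨y.1.1, y.1.2, fun g => ?_⟩,
      fun _ => rfl, fun _ => rfl⟩
    · rintro ⟨_, g, rfl⟩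
      exact Subtype.ext (x.2.2 g)
    · exact congrArg Subtype.val (y.2 ⟨_, g, rfl⟩)
  rw [h1, h2, hY]

theorem exists_fixed_of_sum_ne_zero (ρ : Γ →* Equiv.Perm X)
    (hρ : ∀ g, ∃ n : ℕ, ρ (g ^ p ^ n) = 1) (φ : X → k) (hφ : ∀ g x, φ (ρ g x) = φ x)
    (h : ∑ x, φ x ≠ 0) : ∃ x, (∀ g, ρ g x = x) ∧ φ x ≠ 0 := by
  classical
  rw [sum_eq_sum_fixed ρ hρ φ hφ] at h
  obtain ⟨x, -, hx⟩ := Finset.exists_ne_zero_of_sum_ne_zero h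
  by_cases hf : ∀ g, ρ g x = x
  · exact ⟨x, hf, by simpa [hf] using hx⟩
  · simp [hf] at hx

end FixedPoints

/-! ### Transversals -/

section Transversals

variable {G : Type*} [Group G]

/-- The family `t` is a system of representatives of the left cosets of `H` in `L`. -/
structure IsTransversal {ι : Type*} (t : ι → G) (H L : Subgroup G) : Prop where
  mem : ∀ i, t i ∈ L
  existsUnique : ∀ l ∈ L, ∃! i, (t i)⁻¹ * l ∈ H

theorem isTransversal_out (H L : Subgroup G) :
    IsTransversal (fun q : L ⧸ H.subgroupOf L => (q.out : G)) H L where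
  mem q := q.out.2
  existsUnique l hl := by
    refine ⟨((⟨l, hl⟩ : L) : L ⧸ H.subgroupOf L), ?_, fun q hq => ?_⟩
    · have := QuotientGroup.eq.1
        (Quotient.out_eq' (((⟨l, hl⟩ : L) : L ⧸ H.subgroupOf L)))
      simpa [Subgroup.mem_subgroupOf] using this
    · rw [← Quotient.out_eq' q]
      exact QuotientGroup.eq.2 (by simpa [Subgroup.mem_subgroupOf] using hq)

theorem isTransversal_out_top (H : Subgroup G) :
    IsTransversal (fun q : G ⧸ H => q.out) H ⊤ where
  mem _ := Subgroup.mem_top _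
  existsUnique l _ := by
    refine ⟨(l : G ⧸ H), QuotientGroup.eq.1 (Quotient.out_eq' (l : G ⧸ H)), fun q hq => ?_⟩
    rw [← Quotient.out_eq' q]
    exact QuotientGroup.eq.2 hq

namespace IsTransversal

variable {ι κ : Type*} {t : ι → G} {s : κ → G} {H K L : Subgroup G}

theorem eq_of_mem (h : IsTransversal t H L) {i j : ι} (hij : (t i)⁻¹ * t j ∈ H) : i = j :=
  (h.existsUnique (t j) (h.mem j)).unique hij (by simp)

theorem mul (ht : IsTransversal t K L) (hs : IsTransversal s H K) (hHK : H ≤ K) (hKL : K ≤ L) :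
    IsTransversal (fun i : ι × κ => t i.1 * s i.2) H L where
  mem i := mul_mem (ht.mem _) (hKL (hs.mem _))
  existsUnique l hl := by
    obtain ⟨i, hi, hi'⟩ := ht.existsUnique l hl
    obtain ⟨j, hj, hj'⟩ := hs.existsUnique _ hi
    refine ⟨(i, j), by simpa [mul_assoc] using hj, ?_⟩
    rintro ⟨i₁, j₁⟩ h
    have h' : (s j₁)⁻¹ * ((t i₁)⁻¹ * l) ∈ H := by simpa [mul_assoc] using h
    have h₁ : i₁ = i := hi' _ (by
      have := mul_mem (hs.mem j₁) (hHK h')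
      simpa using this)
    subst h₁
    rw [hj' _ h']

/-- Sending i to the coset of H that contains `t i` matches the two index sets. This frees traces
from the representatives `Quotient.out` in their definition. -/
theorem sum_eq {V : Type*} [AddCommMonoid V] [Fintype ι] [Fintype κ] (ht : IsTransversal t H L)
    (hs : IsTransversal s H L) {φ : G → V} (hφ : ∀ g ∈ L, ∀ h ∈ H, φ (g * h) = φ g) :
    ∑ i, φ (t i) = ∑ j, φ (s j) := by
  choose f hf using fun i => (hs.existsUnique (t i) (ht.mem i)).exists
  refine Fintype.sum_bijective f ⟨fun i j hij => ?_, fun j => ?_⟩ _ _ fun i => ?_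
  · have h := mul_mem (inv_mem (hf i)) (hij ▸ hf j)
    exact ht.eq_of_mem (by simpa [mul_assoc] using h)
  · obtain ⟨i, hi, -⟩ := ht.existsUnique (s j) (hs.mem j)
    refine ⟨i, hs.eq_of_mem ?_⟩
    simpa [mul_assoc] using mul_mem (hf i) hi
  · simpa using hφ _ (hs.mem (f i)) _ (hf i)

theorem sum_tower {V : Type*} [AddCommMonoid V] [Fintype ι] [Fintype κ] {ι' : Type*} [Fintype ι']
    {u : ι' → G} (hu : IsTransversal u H L) (ht : IsTransversal t K L) (hs : IsTransversal s H K)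
    (hHK : H ≤ K) (hKL : K ≤ L) {φ : G → V} (hφ : ∀ g ∈ L, ∀ h ∈ H, φ (g * h) = φ g) :
    ∑ i, φ (u i) = ∑ i, ∑ j, φ (t i * s j) := by
  rw [hu.sum_eq (ht.mul hs hHK hKL) hφ, Fintype.sum_prod_type]

theorem card_eq [Fintype ι] (ht : IsTransversal t H L) : Fintype.card ι = H.relIndex L := by
  rw [Subgroup.relIndex, Subgroup.index, ← Nat.card_eq_fintype_card]
  refine Nat.card_congr (Equiv.ofBijective
    (fun i => ((⟨t i, ht.mem i⟩ : L) : L ⧸ H.subgroupOf L)) ⟨fun i j hij => ?_, fun q => ?_⟩)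
  · exact ht.eq_of_mem (by simpa [Subgroup.mem_subgroupOf] using QuotientGroup.eq.1 hij)
  · obtain ⟨l, rfl⟩ := QuotientGroup.mk_surjective q
    obtain ⟨i, hi, -⟩ := ht.existsUnique l l.2
    exact ⟨i, QuotientGroup.eq.2 (by simpa [Subgroup.mem_subgroupOf] using hi)⟩

/-- The sum of a function that is constant on the left cosets of the larger subgroup `K`. -/
theorem sum_eq_relIndex_smul {V : Type*} [AddCommMonoid V] [Fintype ι] [Fintype κ]
    (hs : IsTransversal s H L) (ht : IsTransversal t K L) (hHK : H ≤ K) (hKL : K ≤ L)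
    [Finite (K ⧸ H.subgroupOf K)] {φ : G → V} (hφ : ∀ g ∈ L, ∀ h ∈ K, φ (g * h) = φ g) :
    ∑ j, φ (s j) = H.relIndex K • ∑ i, φ (t i) := by
  have := Fintype.ofFinite (K ⧸ H.subgroupOf K)
  have hu := isTransversal_out H K
  rw [hs.sum_tower ht hu hHK hKL fun g hg h hh => hφ g hg h (hHK hh), Finset.smul_sum]
  refine Finset.sum_congr rfl fun i _ => ?_
  rw [Finset.sum_congr rfl fun j _ => hφ _ (ht.mem i) _ (hu.mem j), Finset.sum_const,
    Finset.card_univ, hu.card_eq]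

theorem mul_left (ht : IsTransversal t H L) {g : G} (hg : g ∈ L) :
    IsTransversal (fun i => g * t i) H L where
  mem i := mul_mem hg (ht.mem i)
  existsUnique l hl := by
    simpa [mul_assoc] using ht.existsUnique (g⁻¹ * l) (mul_mem (inv_mem hg) hl)

end IsTransversal

end Transversals

/-! ### Coefficients of elements of the completed group algebra -/

section Coefficients

variable {k : Type*} [Field k] {G : Type*} [Group G] [TopologicalSpace G]

variable (k) in
/-- The coefficient at `gM` of the image in `k[G/M]` of an element of `k[[G]]`. -/
def coef (M : OpenNormalSubgroup G) (g : G) : CompletedGroupAlgebra k G →ₗ[k] k where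
  toFun x := (proj k M x).coeff (g : G ⧸ M.toSubgroup)
  map_add' x y := by simp
  map_smul' c x := by simp

theorem coef_apply (M : OpenNormalSubgroup G) (g : G) (x : CompletedGroupAlgebra k G) :
    coef k M g x = (proj k M x).coeff (g : G ⧸ M.toSubgroup) := rfl

theorem proj_eq_iff_coef {M : OpenNormalSubgroup G} {x y : CompletedGroupAlgebra k G} :
    proj k M x = proj k M y ↔ ∀ g, coef k M g x = coef k M g y := by
  refine ⟨fun h g => by rw [coef_apply, h, coef_apply], fun h => ?_⟩
  ext q
  obtain ⟨g, rfl⟩ := QuotientGroup.mk_surjective q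
  exact h g

theorem ext_coef {x y : CompletedGroupAlgebra k G} (h : ∀ M g, coef k M g x = coef k M g y) :
    x = y :=
  ext_proj fun M => proj_eq_iff_coef.2 (h M)

theorem coef_congr {M : OpenNormalSubgroup G} {g h : G} (hgh : g⁻¹ * h ∈ M.toSubgroup)
    (x : CompletedGroupAlgebra k G) : coef k M g x = coef k M h x := by
  rw [coef_apply, coef_apply, QuotientGroup.eq.2 hgh]

theorem proj_conj (M : OpenNormalSubgroup G) (g : G) (x : CompletedGroupAlgebra k G) :
    proj k M (conj k g x) = MonoidAlgebra.single (g : G ⧸ M.toSubgroup) 1 *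
      (proj k M x * MonoidAlgebra.single ((g⁻¹ : G) : G ⧸ M.toSubgroup) 1) := by
  rw [conj_apply, map_mul, map_mul, proj_of, proj_of]

theorem coef_conj (M : OpenNormalSubgroup G) (g h : G) (x : CompletedGroupAlgebra k G) :
    coef k M g (conj k h x) = coef k M (h⁻¹ * g * h) x := by
  rw [coef_apply, proj_conj, MonoidAlgebra.coeff_single_mul_apply,
    MonoidAlgebra.coeff_mul_single_apply, coef_apply]
  simp

theorem conj_conj (g h : G) (x : CompletedGroupAlgebra k G) :
    conj k g (conj k h x) = conj k (g * h) x := by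
  refine ext_coef fun M c => ?_
  rw [coef_conj, coef_conj, coef_conj]
  congr 2
  group

theorem conj_one (x : CompletedGroupAlgebra k G) : conj k 1 x = x := by
  refine ext_coef fun M c => ?_
  rw [coef_conj]
  simp

theorem conj_of (g h : G) : conj k g (of k h) = of k (g * h * g⁻¹) := by
  rw [conj_apply, ← map_mul, ← map_mul, mul_assoc]

theorem coef_conj_of_mem {M : OpenNormalSubgroup G} {m : G} (hm : m ∈ M.toSubgroup) (g : G)
    (x : CompletedGroupAlgebra k G) : coef k M g (conj k m x) = coef k M g x := by
  rw [coef_conj]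
  refine coef_congr ?_ x
  have := M.isNormal'.conj_mem m hm g⁻¹
  simpa [mul_assoc] using mul_mem (inv_mem hm) this

theorem proj_conj_of_mem {M : OpenNormalSubgroup G} {m : G} (hm : m ∈ M.toSubgroup)
    (x : CompletedGroupAlgebra k G) : proj k M (conj k m x) = proj k M x :=
  proj_eq_iff_coef.2 fun g => coef_conj_of_mem hm g x

theorem proj_conj_congr {M : OpenNormalSubgroup G} {x y : CompletedGroupAlgebra k G}
    (h : proj k M x = proj k M y) (g : G) : proj k M (conj k g x) = proj k M (conj k g y) := by
  rw [proj_conj, proj_conj, h]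

theorem coef_conj_eq {H : Subgroup G} {x : CompletedGroupAlgebra k G} (hx : x ∈ fixedPoints k H)
    (M : OpenNormalSubgroup G) {h : G} (hh : h ∈ H) (g : G) :
    coef k M (h⁻¹ * g * h) x = coef k M g x := by
  rw [← coef_conj, hx h hh]

open Classical in
theorem coef_of (M : OpenNormalSubgroup G) (g h : G) :
    coef k M g (of k h) = if h⁻¹ * g ∈ M.toSubgroup then 1 else 0 := by
  rw [coef_apply, proj_of, MonoidAlgebra.coeff_single, Finsupp.single_apply]
  simp only [QuotientGroup.eq]

theorem proj_mono {M N : OpenNormalSubgroup G} (h : M.toSubgroup ≤ N.toSubgroup)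
    {x y : CompletedGroupAlgebra k G} (hxy : proj k M x = proj k M y) :
    proj k N x = proj k N y := by
  have hx : transition k h (proj k M x) = proj k N x := x.2 M N h
  have hy : transition k h (proj k M y) = proj k N y := y.2 M N h
  rw [← hx, ← hy, hxy]

theorem transition_proj {M N : OpenNormalSubgroup G} (h : M.toSubgroup ≤ N.toSubgroup)
    (x : CompletedGroupAlgebra k G) : transition k h (proj k M x) = proj k N x := x.2 M N h

theorem inf_le_left' (M N : OpenNormalSubgroup G) : (M ⊓ N).toSubgroup ≤ M.toSubgroup :=
  fun _ h => h.1

theorem inf_le_right' (M N : OpenNormalSubgroup G) : (M ⊓ N).toSubgroup ≤ N.toSubgroup :=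
  fun _ h => h.2

/-- Each k[G/M] is spanned by the images of elements of G, so commuting with G suffices. -/
theorem mem_center_iff {x : CompletedGroupAlgebra k G} :
    x ∈ Subalgebra.center k (CompletedGroupAlgebra k G) ↔ x ∈ fixedPoints k (⊤ : Subgroup G) := by
  have hgg : ∀ g : G, of k g * of k g⁻¹ = (1 : CompletedGroupAlgebra k G) := fun g => by
    rw [← map_mul, mul_inv_cancel, map_one]
  refine ⟨fun h g _ => ?_, fun h => Subalgebra.mem_center_iff.2 fun y => ext_proj fun M => ?_⟩
  · rw [conj_apply, ← Subalgebra.mem_center_iff.1 h, ← mul_assoc, hgg, one_mul]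
  · rw [map_mul, map_mul]
    generalize proj k M y = z
    induction z using MonoidAlgebra.induction_on with
    | of q =>
      obtain ⟨g, rfl⟩ := QuotientGroup.mk_surjective q
      have h1 := congrArg (· * of k g) (h g (Subgroup.mem_top _))
      have h2 : of k g⁻¹ * of k g = (1 : CompletedGroupAlgebra k G) := by
        rw [← map_mul, inv_mul_cancel, map_one]
      simp only [conj_apply, mul_assoc, h2, mul_one] at h1
      have := congrArg (proj k M) h1
      rwa [map_mul, map_mul, proj_of] at this
    | add u v hu hv => rw [add_mul, mul_add, hu, hv]
    | smul r u hu => rw [smul_mul_assoc, mul_smul_comm, hu]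

section Finite

variable [IsTopologicalGroup G] [CompactSpace G]

instance (M : OpenNormalSubgroup G) : Finite (G ⧸ M.toSubgroup) :=
  Subgroup.quotient_finite_of_isOpen _ M.isOpen'

instance (M : OpenNormalSubgroup G) : Fintype (G ⧸ M.toSubgroup) := Fintype.ofFinite _

instance (M : OpenNormalSubgroup G) : FiniteDimensional k (MonoidAlgebra k (G ⧸ M.toSubgroup)) :=
  Module.Finite.equiv (MonoidAlgebra.coeffLinearEquiv (S := k) (M := G ⧸ M.toSubgroup) k).symm

theorem coef_mul (M : OpenNormalSubgroup G) (g : G) (x y : CompletedGroupAlgebra k G) :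
    coef k M g (x * y) = ∑ q : G ⧸ M.toSubgroup,
      (proj k M x).coeff q * (proj k M y).coeff (q⁻¹ * g) := by
  classical
  rw [coef_apply, map_mul, MonoidAlgebra.coeff_mul, Finsupp.sum_fintype _ _ (by simp)]
  refine Finset.sum_congr rfl fun q _ => ?_
  rw [Finsupp.sum_fintype _ _ (by simp), Finset.sum_eq_single (q⁻¹ * (g : G ⧸ M.toSubgroup))]
  · simp
  · intro b _ hb
    rw [if_neg]
    rintro h
    exact hb (by rw [← h]; group)
  · simp

open Classical in
theorem coeff_transition {M N : OpenNormalSubgroup G} (h : M.toSubgroup ≤ N.toSubgroup)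
    (x : MonoidAlgebra k (G ⧸ M.toSubgroup)) (g : G) :
    (transition k h x).coeff (g : G ⧸ N.toSubgroup) = ∑ q : G ⧸ M.toSubgroup,
      if QuotientGroup.map M.toSubgroup N.toSubgroup (MonoidHom.id G)
        (h.trans_eq (Subgroup.comap_id N.toSubgroup).symm) q = (g : G ⧸ N.toSubgroup)
      then x.coeff q else 0 := by
  induction x using MonoidAlgebra.induction_on with
  | of q =>
    obtain ⟨a, rfl⟩ := QuotientGroup.mk_surjective q
    rw [MonoidAlgebra.of_apply, transition_single, Finset.sum_eq_single (a : G ⧸ M.toSubgroup)]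
    · simp [Finsupp.single_apply]
    · intro b _ hb
      simp [hb.symm]
    · simp
  | add u v hu hv =>
    rw [map_add, MonoidAlgebra.coeff_add, Finsupp.add_apply, hu, hv, ← Finset.sum_add_distrib]
    exact Finset.sum_congr rfl fun q _ => by split_ifs <;> simp
  | smul r u hu =>
    rw [map_smul, MonoidAlgebra.coeff_smul_apply, hu, Finset.smul_sum]
    exact Finset.sum_congr rfl fun q _ => by split_ifs <;> simp

open Classical in
theorem coef_eq_sum {M N : OpenNormalSubgroup G} (h : M.toSubgroup ≤ N.toSubgroup) (g : G)
    (x : CompletedGroupAlgebra k G) :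
    coef k N g x = ∑ q : G ⧸ M.toSubgroup,
      if QuotientGroup.map M.toSubgroup N.toSubgroup (MonoidHom.id G)
        (h.trans_eq (Subgroup.comap_id N.toSubgroup).symm) q = (g : G ⧸ N.toSubgroup)
      then (proj k M x).coeff q else 0 := by
  rw [coef_apply, ← transition_proj h, coeff_transition]

end Finite

end Coefficients

/-! ### Relative traces -/

section Traces

variable {k : Type*} [Field k] {G : Type*} [Group G] [TopologicalSpace G]

theorem trace_apply (H L : Subgroup G) [Fintype (L ⧸ H.subgroupOf L)]
    (a : CompletedGroupAlgebra k G) :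
    trace k H L a = ∑ q : L ⧸ H.subgroupOf L, conj k (q.out : G) a := by
  rw [trace, finsum_eq_sum_of_fintype, LinearMap.sum_apply]

/-- Invariance is required only modulo M. This matters because an element of k[[G]]^Q is in general
fixed by QM only modulo M, and its trace from QM is used at that level. -/
theorem proj_trace_eq {ι : Type*} [Fintype ι] {t : ι → G} {H L : Subgroup G}
    [Finite (L ⧸ H.subgroupOf L)] (ht : IsTransversal t H L) {M : OpenNormalSubgroup G}
    {a : CompletedGroupAlgebra k G} (ha : ∀ h ∈ H, proj k M (conj k h a) = proj k M a) :
    proj k M (trace k H L a) = ∑ i, proj k M (conj k (t i) a) := by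
  have := Fintype.ofFinite (L ⧸ H.subgroupOf L)
  rw [trace_apply, map_sum]
  refine (isTransversal_out H L).sum_eq (φ := fun g => proj k M (conj k g a)) ht ?_
  intro g _ h hh
  rw [← conj_conj]
  exact proj_conj_congr (ha h hh) g

theorem trace_eq {ι : Type*} [Fintype ι] {t : ι → G} {H L : Subgroup G}
    [Finite (L ⧸ H.subgroupOf L)] (ht : IsTransversal t H L)
    {a : CompletedGroupAlgebra k G} (ha : a ∈ fixedPoints k H) :
    trace k H L a = ∑ i, conj k (t i) a :=
  ext_proj fun M => by rw [proj_trace_eq ht fun h hh => by rw [ha h hh], map_sum]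

theorem proj_trace_congr {H L : Subgroup G} [Finite (L ⧸ H.subgroupOf L)]
    {M : OpenNormalSubgroup G} {a b : CompletedGroupAlgebra k G}
    (h : proj k M a = proj k M b) : proj k M (trace k H L a) = proj k M (trace k H L b) := by
  have := Fintype.ofFinite (L ⧸ H.subgroupOf L)
  rw [trace_apply, trace_apply, map_sum, map_sum]
  exact Finset.sum_congr rfl fun q _ => proj_conj_congr h _

theorem proj_conj_trace {H L : Subgroup G} [Finite (L ⧸ H.subgroupOf L)]
    {M : OpenNormalSubgroup G} {a : CompletedGroupAlgebra k G}
    (ha : ∀ h ∈ H, proj k M (conj k h a) = proj k M a) {l : G} (hl : l ∈ L) :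
    proj k M (conj k l (trace k H L a)) = proj k M (trace k H L a) := by
  have := Fintype.ofFinite (L ⧸ H.subgroupOf L)
  rw [proj_trace_eq ((isTransversal_out H L).mul_left hl) ha, trace_apply, map_sum, map_sum]
  simp only [conj_conj]

theorem trace_mem_fixedPoints {H L : Subgroup G} [Finite (L ⧸ H.subgroupOf L)]
    {a : CompletedGroupAlgebra k G} (ha : a ∈ fixedPoints k H) :
    trace k H L a ∈ fixedPoints k L := fun _ hl =>
  ext_proj fun M => proj_conj_trace (fun h hh => by rw [ha h hh]) hl

/-- Transitivity of the trace, at the level of `k[G/M]`. -/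
theorem proj_trace_trace {H K L : Subgroup G} (hHK : H ≤ K) (hKL : K ≤ L)
    [Finite (K ⧸ H.subgroupOf K)] [Finite (L ⧸ K.subgroupOf L)] [Finite (L ⧸ H.subgroupOf L)]
    {M : OpenNormalSubgroup G} {a : CompletedGroupAlgebra k G}
    (ha : ∀ h ∈ H, proj k M (conj k h a) = proj k M a) :
    proj k M (trace k K L (trace k H K a)) = proj k M (trace k H L a) := by
  have := Fintype.ofFinite (K ⧸ H.subgroupOf K)
  have := Fintype.ofFinite (L ⧸ K.subgroupOf L)
  rw [proj_trace_eq ((isTransversal_out K L).mul (isTransversal_out H K) hHK hKL) ha,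
    trace_apply K L, map_sum, Fintype.sum_prod_type]
  refine Finset.sum_congr rfl fun q _ => ?_
  rw [trace_apply H K, map_sum, map_sum]
  simp only [conj_conj]

theorem trace_trace {H K L : Subgroup G} (hHK : H ≤ K) (hKL : K ≤ L)
    [Finite (K ⧸ H.subgroupOf K)] [Finite (L ⧸ K.subgroupOf L)] [Finite (L ⧸ H.subgroupOf L)]
    {a : CompletedGroupAlgebra k G} (ha : a ∈ fixedPoints k H) :
    trace k K L (trace k H K a) = trace k H L a :=
  ext_proj fun _ => proj_trace_trace hHK hKL fun h hh => by rw [ha h hh]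

/-- The trace of an element that is fixed by a larger subgroup `K`, at the level of `k[G/M]`. -/
theorem proj_trace_eq_relIndex_smul {H K L : Subgroup G} (hHK : H ≤ K) (hKL : K ≤ L)
    [Finite (K ⧸ H.subgroupOf K)] [Finite (L ⧸ K.subgroupOf L)] [Finite (L ⧸ H.subgroupOf L)]
    {M : OpenNormalSubgroup G} {a : CompletedGroupAlgebra k G}
    (ha : ∀ h ∈ K, proj k M (conj k h a) = proj k M a) :
    proj k M (trace k H L a) = H.relIndex K • proj k M (trace k K L a) := by
  have := Fintype.ofFinite (L ⧸ K.subgroupOf L)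
  have := Fintype.ofFinite (L ⧸ H.subgroupOf L)
  rw [trace_apply, trace_apply, map_sum, map_sum]
  refine (isTransversal_out H L).sum_eq_relIndex_smul (isTransversal_out K L) hHK hKL
    (φ := fun g => proj k M (conj k g a)) ?_
  intro g _ h hh
  rw [← conj_conj]
  exact proj_conj_congr (ha h hh) g

theorem coef_trace {ι : Type*} [Fintype ι] {t : ι → G} {H L : Subgroup G}
    [Finite (L ⧸ H.subgroupOf L)] (ht : IsTransversal t H L)
    {a : CompletedGroupAlgebra k G} (ha : a ∈ fixedPoints k H) (M : OpenNormalSubgroup G) (c : G) :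
    coef k M c (trace k H L a) = ∑ i, coef k M ((t i)⁻¹ * c * t i) a := by
  rw [trace_eq ht ha, map_sum]
  exact Finset.sum_congr rfl fun i _ => coef_conj M c (t i) a

theorem mul_mem_traceImage {H : Subgroup G} {a b : CompletedGroupAlgebra k G}
    (hb : b ∈ fixedPoints k (⊤ : Subgroup G)) (ha : a ∈ traceImage k H ⊤) :
    b * a ∈ traceImage k H ⊤ := by
  obtain ⟨x, hx, rfl⟩ := ha
  exact ⟨b * x, (fixedPoints k H).mul_mem (fixedPoints_anti k le_top hb) hx,
    (mul_trace_apply H hb x).symm⟩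

theorem traceImage_mono {H K L : Subgroup G} (hHK : H ≤ K) (hKL : K ≤ L)
    [Finite (K ⧸ H.subgroupOf K)] [Finite (L ⧸ K.subgroupOf L)] [Finite (L ⧸ H.subgroupOf L)] :
    traceImage k H L ≤ traceImage k K L := by
  rintro _ ⟨a, ha, rfl⟩
  exact ⟨trace k H K a, trace_mem_fixedPoints ha, trace_trace hHK hKL ha⟩

theorem isOpen_sup [IsTopologicalGroup G] (H : Subgroup G) (N : OpenNormalSubgroup G) :
    IsOpen ((H ⊔ N.toSubgroup : Subgroup G) : Set G) :=
  Subgroup.isOpen_mono le_sup_right N.isOpen'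

section Finite

variable [IsTopologicalGroup G] [CompactSpace G]

theorem finite_quotient_subgroupOf {H : Subgroup G} (hH : IsOpen (H : Set G)) (L : Subgroup G) :
    Finite (L ⧸ H.subgroupOf L) := by
  have := Subgroup.quotient_finite_of_isOpen H hH
  have : H.FiniteIndex := Subgroup.finiteIndex_of_finite_quotient
  infer_instance

instance (H L : Subgroup G) (N : OpenNormalSubgroup G) :
    Finite (L ⧸ (H ⊔ N.toSubgroup).subgroupOf L) :=
  finite_quotient_subgroupOf (isOpen_sup H N) L

instance (H : Subgroup G) (N : OpenNormalSubgroup G) : Finite (G ⧸ (H ⊔ N.toSubgroup)) :=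
  Subgroup.quotient_finite_of_isOpen _ (isOpen_sup H N)

theorem traceImage_sup_mono (H : Subgroup G) {M N : OpenNormalSubgroup G}
    (h : M.toSubgroup ≤ N.toSubgroup) :
    traceImage k (H ⊔ M.toSubgroup) ⊤ ≤ traceImage k (H ⊔ N.toSubgroup) ⊤ :=
  traceImage_mono (sup_le_sup_left h H) le_top

theorem mem_oTr_of_forall_le {H : Subgroup G} {e : CompletedGroupAlgebra k G}
    (M₀ : OpenNormalSubgroup G)
    (h : ∀ M : OpenNormalSubgroup G, M.toSubgroup ≤ M₀.toSubgroup →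
      e ∈ traceImage k (H ⊔ M.toSubgroup) ⊤) : e ∈ oTr k H :=
  (Submodule.mem_iInf _).2 fun N =>
    traceImage_sup_mono H (inf_le_left' N M₀) (h (N ⊓ M₀) (inf_le_right' N M₀))

end Finite

end Traces

/-! ### Compactness -/

section Compactness

variable {G : Type*} [Group G] [TopologicalSpace G] [IsTopologicalGroup G]
  [CompactSpace G]

/-- The source of limits of group elements: a condition solvable modulo every M, with closed
solution sets shrinking with M, is solvable in G. -/
theorem exists_mem_forall_of_antitone (S : OpenNormalSubgroup G → Set G)
    (hcl : ∀ M, IsClosed (S M)) (hne : ∀ M, (S M).Nonempty)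
    (hmono : ∀ M N : OpenNormalSubgroup G, M.toSubgroup ≤ N.toSubgroup → S M ⊆ S N) :
    ∃ g, ∀ M, g ∈ S M := by
  have : Nonempty (OpenNormalSubgroup G) :=
    ⟨{ toOpenSubgroup := ⊤, isNormal' := by
        rw [OpenSubgroup.toSubgroup_top]; infer_instance }⟩
  obtain ⟨g, hg⟩ := IsCompact.nonempty_iInter_of_directed_nonempty_isCompact_isClosed S
    (fun M N => ⟨M ⊓ N, hmono _ _ (inf_le_left' M N), hmono _ _ (inf_le_right' M N)⟩) hne
    (fun M => (hcl M).isCompact) hcl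
  exact ⟨g, Set.mem_iInter.1 hg⟩

theorem isClosed_setOf_mem {f : G → G} (hf : Continuous f) (M : OpenNormalSubgroup G) :
    IsClosed {g | f g ∈ M.toSubgroup} :=
  M.toOpenSubgroup.isClosed.preimage hf

variable [TotallyDisconnectedSpace G]

theorem eq_one_of_forall_mem {g : G} (h : ∀ M : OpenNormalSubgroup G, g ∈ M.toSubgroup) :
    g = 1 := by
  by_contra hg
  obtain ⟨M, hM⟩ := ProfiniteGrp.exist_openNormalSubgroup_sub_open_nhds_of_one
    (U := {g}ᶜ) isOpen_compl_singleton (Ne.symm hg)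
  exact hM (h M) rfl

/-- Compactness picks one x in Q with x⁻¹g in every M; then x = g, since the open normal subgroups
intersect trivially. -/
theorem mem_of_forall_mem_sup {Q : Subgroup G} (hQ : IsClosed (Q : Set G)) {g : G}
    (h : ∀ M : OpenNormalSubgroup G, g ∈ Q ⊔ M.toSubgroup) : g ∈ Q := by
  obtain ⟨x, hx⟩ := exists_mem_forall_of_antitone
    (fun M : OpenNormalSubgroup G => {x | x ∈ Q ∧ x⁻¹ * g ∈ M.toSubgroup})
    (fun M => hQ.inter (isClosed_setOf_mem (by fun_prop) M))
    (fun M => by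
      obtain ⟨x, hx, m, hm, rfl⟩ := Subgroup.mem_sup_of_normal_right.1 (h M)
      exact ⟨x, hx, by simpa using hm⟩)
    (fun M N hMN x hx => ⟨hx.1, hMN hx.2⟩)
  have M₀ : OpenNormalSubgroup G :=
    { toOpenSubgroup := ⊤, isNormal' := by rw [OpenSubgroup.toSubgroup_top]; infer_instance }
  have h1 := eq_one_of_forall_mem fun M => (hx M).2
  rw [← inv_mul_eq_one.1 h1]
  exact (hx M₀).1

/-- A closed subgroup that is mapped into itself by a conjugation is normalized by it. -/
theorem mem_normalizer_of_conj_mem {D : Subgroup G} (hD : IsClosed (D : Set G)) {y : G}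
    (hy : ∀ d ∈ D, y⁻¹ * d * y ∈ D) : y ∈ Subgroup.normalizer (D : Set G) := by
  have hpow : ∀ n : ℕ, ∀ d ∈ D, (y ^ n)⁻¹ * d * y ^ n ∈ D := by
    intro n
    induction n with
    | zero => simp
    | succ n ih =>
      intro d hd
      have := hy _ (ih d hd)
      rw [pow_succ]
      simpa [mul_assoc] using this
  refine Subgroup.mem_normalizer_iff''.2 fun h => ⟨hy h, fun hh => ?_⟩
  refine mem_of_forall_mem_sup hD fun M => ?_
  -- Modulo M, the inverse of y is a nonnegative power of y. So conjugation in the other direction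
  -- also maps D into D modulo M.
  have hm : y ^ Nat.card (G ⧸ M.toSubgroup) ∈ M.toSubgroup := by
    rw [← QuotientGroup.eq_one_iff, QuotientGroup.mk_pow, pow_card_eq_one']
  obtain ⟨n, hn⟩ := Nat.exists_eq_succ_of_ne_zero (Nat.card_pos (α := G ⧸ M.toSubgroup)).ne'
  rw [hn] at hm
  have h1 : h = ((y ^ n)⁻¹ * (y⁻¹ * h * y) * y ^ n) * ((y ^ (n + 1))⁻¹ * (h⁻¹ * y ^ (n + 1) * h))
      := by
    rw [pow_succ']
    group
  have h2 : (y ^ n)⁻¹ * (y⁻¹ * h * y) * y ^ n = (y ^ (n + 1))⁻¹ * h * y ^ (n + 1) := by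
    rw [pow_succ']
    group
  have h3 : h = ((y ^ n)⁻¹ * (y⁻¹ * h * y) * y ^ n) *
      (((y ^ n)⁻¹ * (y⁻¹ * h * y) * y ^ n)⁻¹ * (y ^ (n + 1) *
        ((y ^ n)⁻¹ * (y⁻¹ * h * y) * y ^ n) * (y ^ (n + 1))⁻¹)) := by
    rw [h2]
    group
  rw [h3]
  have hx := hpow n _ hh
  generalize (y ^ n)⁻¹ * (y⁻¹ * h * y) * y ^ n = x at hx ⊢
  refine mul_mem (Subgroup.mem_sup_left hx) (Subgroup.mem_sup_right ?_)
  have := M.isNormal'.conj_mem _ hm x⁻¹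
  rw [← mul_assoc, ← mul_assoc]
  exact mul_mem (by simpa using this) (inv_mem hm)

end Compactness

/-! ### Pro-`p` subgroups -/

section ProP

variable {p : ℕ} {G : Type*} [Group G] [TopologicalSpace G]

/-- The elements of `Q` have `p`-power order in all finite continuous quotients of `G`. -/
def HasPPowerOrders (p : ℕ) (Q : Subgroup G) : Prop :=
  ∀ M : OpenNormalSubgroup G, ∀ q ∈ Q, ∃ n : ℕ, q ^ p ^ n ∈ M.toSubgroup

theorem HasPPowerOrders.mono {Q R : Subgroup G} (hR : HasPPowerOrders p R) (h : Q ≤ R) :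
    HasPPowerOrders p Q := fun M q hq => hR M q (h hq)

theorem IsProP.hasPPowerOrders {P : Subgroup G} (hP : IsProP p P) : HasPPowerOrders p P := by
  intro M q hq
  obtain ⟨n, hn⟩ := isPGroup_iff_pow_pow_eq_one.1 (hP (comapOpenNormal (subtypeHom P) M))
    ((⟨q, hq⟩ : P) : P ⧸ _)
  rw [← QuotientGroup.mk_pow, QuotientGroup.eq_one_iff] at hn
  exact ⟨n, hn⟩

variable [Fact p.Prime] {k : Type*} [Field k] [CharP k p] [IsTopologicalGroup G] [CompactSpace G]

open Classical in
theorem sum_conj_eq_sum_fixed {Q : Subgroup G} (hQ : HasPPowerOrders p Q)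
    {M : OpenNormalSubgroup G} (φ : G ⧸ M.toSubgroup → k)
    (hφ : ∀ d ∈ Q, ∀ q, φ ((d : G ⧸ M.toSubgroup) * q * (d : G ⧸ M.toSubgroup)⁻¹) = φ q) :
    ∑ q, φ q = ∑ q, if ∀ d ∈ Q, (d : G ⧸ M.toSubgroup) * q * (d : G ⧸ M.toSubgroup)⁻¹ = q
      then φ q else 0 := by
  rw [sum_eq_sum_fixed ((MulAut.toPerm _).comp (MulAut.conj.comp
    ((QuotientGroup.mk' M.toSubgroup).comp Q.subtype))) ?_ φ ?_]
  · refine Finset.sum_congr rfl fun q _ => ?_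
    simp only [Subtype.forall]
    rfl
  · rintro ⟨d, hd⟩
    obtain ⟨n, hn⟩ := hQ M d hd
    refine ⟨n, ?_⟩
    rw [← QuotientGroup.eq_one_iff] at hn
    ext q
    simp only [MonoidHom.comp_apply]
    have : (QuotientGroup.mk' M.toSubgroup) (Q.subtype (⟨d, hd⟩ ^ p ^ n)) = 1 := hn
    rw [this, map_one, map_one]
  · rintro ⟨d, hd⟩ q
    exact hφ d hd q

-- The group N acts trivially on G/L, because it is normal and contained in L. So Q acts through a
-- group in which every element has p-power order.
open Classical in
theorem sum_quotient_eq_sum_fixed {Q : Subgroup G} (hQ : HasPPowerOrders p Q)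
    {N : OpenNormalSubgroup G} {L : Subgroup G} (hNL : N.toSubgroup ≤ L) [Fintype (G ⧸ L)]
    (φ : G ⧸ L → k) (hφ : ∀ d ∈ Q, ∀ q : G ⧸ L, φ (d • q) = φ q) :
    ∑ q, φ q = ∑ q, if ∀ d ∈ Q, d • q = q then φ q else 0 := by
  rw [sum_eq_sum_fixed ((MulAction.toPermHom G (G ⧸ L)).comp Q.subtype) ?_ φ ?_]
  · refine Finset.sum_congr rfl fun q _ => ?_
    simp
  · rintro ⟨d, hd⟩
    obtain ⟨n, hn⟩ := hQ N d hd
    refine ⟨n, ?_⟩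
    ext q
    obtain ⟨g, rfl⟩ := QuotientGroup.mk_surjective q
    change ((d ^ p ^ n * g : G) : G ⧸ L) = (g : G ⧸ L)
    refine QuotientGroup.eq.2 (hNL ?_)
    have := N.isNormal'.conj_mem _ (inv_mem hn) g⁻¹
    simpa [mul_assoc] using this
  · rintro ⟨d, hd⟩ q
    exact hφ d hd q

theorem conj_mk_eq_iff {M : OpenNormalSubgroup G} {d g : G} :
    (d : G ⧸ M.toSubgroup) * (g : G ⧸ M.toSubgroup) * (d : G ⧸ M.toSubgroup)⁻¹ = g ↔
      g⁻¹ * (d * g * d⁻¹) ∈ M.toSubgroup := by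
  rw [← QuotientGroup.mk_inv, ← QuotientGroup.mk_mul, ← QuotientGroup.mk_mul, eq_comm,
    QuotientGroup.eq]

variable [TotallyDisconnectedSpace G]

/-- If a coset `gM` fixed by a pro-`p` group `Q` has a nonzero coefficient in an element of
`k[[G]]^Q`, then it contains an element that is centralized by `Q`. -/
theorem exists_mem_centralizer_of_coef_ne_zero {Q : Subgroup G} (hQ : HasPPowerOrders p Q)
    {u : CompletedGroupAlgebra k G} (hu : u ∈ fixedPoints k Q) {M : OpenNormalSubgroup G} {g : G}
    (hg : ∀ d ∈ Q, g⁻¹ * (d * g * d⁻¹) ∈ M.toSubgroup) (hne : coef k M g u ≠ 0) :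
    ∃ z ∈ Subgroup.centralizer (Q : Set G), g⁻¹ * z ∈ M.toSubgroup := by
  classical
  -- The coefficient at gM is the sum of the coefficients at the cosets of M' inside gM. Conjugation
  -- by Q permutes these cosets, so some fixed one has a nonzero coefficient.
  have key : ∀ M' : OpenNormalSubgroup G, M'.toSubgroup ≤ M.toSubgroup →
      ∃ z : G, g⁻¹ * z ∈ M.toSubgroup ∧ ∀ d ∈ Q, z⁻¹ * (d * z * d⁻¹) ∈ M'.toSubgroup := by
    intro M' hM'
    rw [coef_eq_sum hM', sum_conj_eq_sum_fixed hQ] at hne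
    · obtain ⟨q, -, hq⟩ := Finset.exists_ne_zero_of_sum_ne_zero hne
      obtain ⟨z, rfl⟩ := QuotientGroup.mk_surjective q
      split_ifs at hq with h1 h2
      · refine ⟨z, ?_, fun d hd => conj_mk_eq_iff.1 (h1 d hd)⟩
        have h2' : (z : G ⧸ M.toSubgroup) = g := h2
        exact QuotientGroup.eq.1 h2'.symm
      · exact absurd rfl hq
      · exact absurd rfl hq
    · intro d hd q
      obtain ⟨z, rfl⟩ := QuotientGroup.mk_surjective q
      have h1 : (proj k M' u).coeff ((d : G ⧸ M'.toSubgroup) * z * (d : G ⧸ M'.toSubgroup)⁻¹) =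
          (proj k M' u).coeff z := by
        have := coef_conj_eq hu M' (inv_mem hd) z
        rw [inv_inv] at this
        exact this
      rw [h1]
      have h2 : ∀ x : G, QuotientGroup.map M'.toSubgroup M.toSubgroup (MonoidHom.id G)
        (hM'.trans_eq (Subgroup.comap_id M.toSubgroup).symm) (x : G ⧸ M'.toSubgroup) = x :=
        fun _ => rfl
      have h3 := conj_mk_eq_iff.2 (hg d hd)
      simp only [map_mul, map_inv, h2]
      congr 1
      rw [eq_iff_iff]
      constructor
      · intro h
        rw [← h3] at h
        exact mul_left_cancel (mul_right_cancel h)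
      · intro h
        rw [h, h3]
  obtain ⟨z, hz⟩ := exists_mem_forall_of_antitone
    (fun M' : OpenNormalSubgroup G => {z | g⁻¹ * z ∈ M.toSubgroup} ∩
      ⋂ d : Q, {z | z⁻¹ * (d * z * (d : G)⁻¹) ∈ M'.toSubgroup})
    (fun M' => (isClosed_setOf_mem (by fun_prop) M).inter
      (isClosed_iInter fun d => isClosed_setOf_mem (by fun_prop) M'))
    (fun M' => by
      obtain ⟨z, hz, hz'⟩ := key (M ⊓ M') (inf_le_left' M M')
      exact ⟨z, hz, Set.mem_iInter.2 fun d => (hz' d d.2).2⟩)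
    (fun M' N' h z hz => ⟨hz.1, Set.mem_iInter.2 fun d => h (Set.mem_iInter.1 hz.2 d)⟩)
  refine ⟨z, Subgroup.mem_centralizer_iff.2 fun d hd => ?_, (hz M).1⟩
  have := eq_one_of_forall_mem fun M' => Set.mem_iInter.1 (hz M').2 ⟨d, hd⟩
  rw [inv_mul_eq_one, eq_mul_inv_iff_mul_eq] at this
  exact this.symm

end ProP

/-! ### Subgroups that are open in a Sylow subgroup -/

section Sylow

variable {p : ℕ} {G : Type*} [Group G] [TopologicalSpace G]

/-- Every left coset of H in L has a representative in N. -/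
theorem relIndex_sup_of_normal {H L N : Subgroup G} [N.Normal] (hH : H ≤ L) (hL : L ≤ H ⊔ N) :
    H.relIndex L = H.relIndex (N ⊓ L) := by
  refine (Nat.card_congr (Equiv.ofBijective
    (Subgroup.quotientSubgroupOfEmbeddingOfLE H (inf_le_right (a := N) (b := L)))
    ⟨?_, ?_⟩)).symm
  · exact Function.Embedding.injective _
  · intro q
    obtain ⟨⟨l, hl⟩, rfl⟩ := QuotientGroup.mk_surjective q
    have := hL hl
    rw [sup_comm] at this
    obtain ⟨n, hn, h, hh, rfl⟩ := Subgroup.mem_sup_of_normal_left.1 this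
    refine ⟨((⟨n, hn, ?_⟩ : (N ⊓ L : Subgroup G)) : _ ⧸ _), ?_⟩
    · simpa using mul_mem hl (inv_mem (hH hh))
    · refine QuotientGroup.eq.2 ?_
      simpa [Subgroup.mem_subgroupOf] using hh

/-- An element xm of PM that lies in N has x in N ∩ P ≤ Q, so PM and QM meet N in the same subgroup.
Hence |QN : QM| = |PN : PM|, which divides |G : PM|. -/
theorem not_dvd_relIndex_sup {P Q : Subgroup G} (hP : IsSylowSubgroup p P) (hQP : Q ≤ P)
    {M N : OpenNormalSubgroup G} (hNQ : N.toSubgroup ⊓ P ≤ Q) (hMN : M.toSubgroup ≤ N.toSubgroup) :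
    ¬ p ∣ (Q ⊔ M.toSubgroup).relIndex (Q ⊔ N.toSubgroup) := by
  intro h
  apply hP.not_dvd_index M
  have h1 : (Q ⊔ M.toSubgroup).relIndex (Q ⊔ N.toSubgroup) =
      (Q ⊔ M.toSubgroup).relIndex N.toSubgroup := by
    rw [relIndex_sup_of_normal (N := N.toSubgroup) (sup_le_sup_left hMN Q)
      (sup_le_sup_right le_sup_left _), inf_eq_left.2 le_sup_right]
  have h2 : (P ⊔ M.toSubgroup).relIndex (P ⊔ N.toSubgroup) =
      (P ⊔ M.toSubgroup).relIndex N.toSubgroup := by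
    rw [relIndex_sup_of_normal (N := N.toSubgroup) (sup_le_sup_left hMN P)
      (sup_le_sup_right le_sup_left _), inf_eq_left.2 le_sup_right]
  have h3 : (P ⊔ M.toSubgroup) ⊓ N.toSubgroup = (Q ⊔ M.toSubgroup) ⊓ N.toSubgroup := by
    refine le_antisymm ?_ (inf_le_inf_right _ (sup_le_sup_right hQP _))
    rintro n ⟨hn, hnN⟩
    obtain ⟨x, hx, m, hm, rfl⟩ := Subgroup.mem_sup_of_normal_right.1 hn
    refine ⟨mul_mem (Subgroup.mem_sup_left (hNQ ⟨?_, hx⟩)) (Subgroup.mem_sup_right hm), hnN⟩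
    exact (Subgroup.mul_mem_cancel_right _ (hMN hm)).1 hnN
  rw [h1, ← Subgroup.inf_relIndex_right, ← h3, Subgroup.inf_relIndex_right, ← h2] at h
  exact h.trans (Subgroup.relIndex_dvd_index_of_le (sup_le_sup_left hMN P))

variable [Fact p.Prime] [IsTopologicalGroup G] [CompactSpace G] [TotallyDisconnectedSpace G]

/-- A variant of the Frattini argument. -/
theorem exists_mul_mem_normalizer {D : Subgroup G} (hD : IsClosed (D : Set G))
    (hpD : HasPPowerOrders p D) {N : OpenNormalSubgroup G}
    (hN : ∀ M : OpenNormalSubgroup G, M.toSubgroup ≤ N.toSubgroup →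
      ¬ p ∣ (D ⊔ M.toSubgroup).relIndex (D ⊔ N.toSubgroup))
    {g : G} (hg : ∀ d ∈ D, g⁻¹ * d * g ∈ D ⊔ N.toSubgroup) :
    ∃ n ∈ N.toSubgroup, g * n ∈ Subgroup.normalizer (D : Set G) := by
  have key : ∀ M : OpenNormalSubgroup G, M.toSubgroup ≤ N.toSubgroup →
      ∃ n ∈ N.toSubgroup, ∀ d ∈ D, (g * n)⁻¹ * d * (g * n) ∈ D ⊔ M.toSubgroup := by
    intro M hM
    let L := D ⊔ N.toSubgroup
    let X := L ⧸ (D ⊔ M.toSubgroup).subgroupOf L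
    have : Fintype X := Fintype.ofFinite _
    -- Through d ↦ g⁻¹dg the group D acts on DN/DM by left translation. The size of this set is
    -- prime to p, so there is a fixed coset; it is represented by some n in N, and gn then
    -- conjugates D into DM.
    let τ : D →* L := ((MulAut.conj g⁻¹).toMonoidHom.comp D.subtype).codRestrict L
      fun d => by simpa using hg d d.2
    have hτ : ∀ d : D, (τ d : G) = g⁻¹ * d * g := fun d => by simp [τ]
    obtain ⟨q, hq, -⟩ := exists_fixed_of_sum_ne_zero (k := ZMod p) (X := X)
      ((MulAction.toPermHom L X).comp τ) (fun d => by
        obtain ⟨n, hn⟩ := hpD M d d.2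
        refine ⟨n, ?_⟩
        ext q
        obtain ⟨l, rfl⟩ := QuotientGroup.mk_surjective q
        change ((τ (d ^ p ^ n) * l : L) : X) = (l : X)
        refine QuotientGroup.eq.2 ?_
        rw [Subgroup.mem_subgroupOf]
        refine Subgroup.mem_sup_right ?_
        change ((τ (d ^ p ^ n) : G) * l)⁻¹ * l ∈ M.toSubgroup
        rw [hτ]
        have := M.isNormal'.conj_mem _ (inv_mem hn) (l⁻¹ * g⁻¹)
        simpa [hτ, mul_assoc] using this)
      (fun _ => 1) (fun _ _ => rfl) (by
        rw [Finset.sum_const, Finset.card_univ, nsmul_eq_mul, mul_one, ← Nat.card_eq_fintype_card]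
        rw [Ne, ZMod.natCast_eq_zero_iff]
        exact hN M hM)
    obtain ⟨⟨l, hl⟩, rfl⟩ := QuotientGroup.mk_surjective q
    have hl' : l ∈ N.toSubgroup ⊔ D := by rwa [sup_comm]
    obtain ⟨n, hn, d₀, hd₀, rfl⟩ := Subgroup.mem_sup_of_normal_left.1 hl'
    refine ⟨n, hn, fun d hd => ?_⟩
    have h1 := QuotientGroup.eq.1 (hq ⟨d, hd⟩)
    have h2 : d₀⁻¹ * ((g * n)⁻¹ * d * (g * n))⁻¹ * d₀ ∈ D ⊔ M.toSubgroup := by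
      have h3 : ((τ ⟨d, hd⟩ : G) * (n * d₀))⁻¹ * (n * d₀) ∈ D ⊔ M.toSubgroup := h1
      rw [hτ] at h3
      convert h3 using 1
      simp [mul_assoc]
    have h4 := mul_mem (mul_mem (Subgroup.mem_sup_left (T := M.toSubgroup) hd₀) h2)
      (Subgroup.mem_sup_left (inv_mem hd₀))
    rw [← inv_mem_iff]
    convert h4 using 1
    group
  -- By compactness a single n works for all M. Then gn conjugates D into itself, which suffices
  -- since D is closed.
  obtain ⟨n, hn⟩ := exists_mem_forall_of_antitone
    (fun M : OpenNormalSubgroup G => {n | n ∈ N.toSubgroup} ∩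
      ⋂ d : D, {n | (g * n)⁻¹ * d * (g * n) ∈ D ⊔ M.toSubgroup})
    (fun M => (isClosed_setOf_mem continuous_id N).inter
      (isClosed_iInter fun d =>
        (Subgroup.isClosed_of_isOpen _ (isOpen_sup D M)).preimage
          (f := fun n => (g * n)⁻¹ * d * (g * n)) (by fun_prop)))
    (fun M => by
      obtain ⟨n, hn, hn'⟩ := key (N ⊓ M) (inf_le_left' N M)
      exact ⟨n, hn, Set.mem_iInter.2 fun d =>
        sup_le_sup_left (inf_le_right' N M) D (hn' d d.2)⟩)
    (fun M M' h n hn => ⟨hn.1, Set.mem_iInter.2 fun d =>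
      sup_le_sup_left h D (Set.mem_iInter.1 hn.2 d)⟩)
  exact ⟨n, (hn N).1, mem_normalizer_of_conj_mem hD fun d hd =>
    mem_of_forall_mem_sup hD fun M => Set.mem_iInter.1 (hn M).2 ⟨d, hd⟩⟩

end Sylow

/-! ### Construction of elements of the completed group algebra -/

section Construction

variable {k : Type*} [Field k] {G : Type*} [Group G] [TopologicalSpace G]

theorem transition_transition {L M N : OpenNormalSubgroup G} (h : L.toSubgroup ≤ M.toSubgroup)
    (h' : M.toSubgroup ≤ N.toSubgroup) (x : MonoidAlgebra k (G ⧸ L.toSubgroup)) :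
    transition k h' (transition k h x) = transition k (h.trans h') x := by
  induction x using MonoidAlgebra.induction_on with
  | of q =>
    obtain ⟨g, rfl⟩ := QuotientGroup.mk_surjective q
    rw [MonoidAlgebra.of_apply, transition_single, transition_single, transition_single]
  | add u v hu hv => rw [map_add, map_add, map_add, hu, hv]
  | smul r u hu => rw [map_smul, map_smul, map_smul, hu]

/-- A compatible family on a cofinal system of open normal subgroups defines an element of
`k[[G]]`. -/
theorem exists_proj_eq_of_directed {ι : Type*} (U : ι → OpenNormalSubgroup G)
    (hU : ∀ M : OpenNormalSubgroup G, ∃ i, (U i).toSubgroup ≤ M.toSubgroup)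
    (x : ∀ i, MonoidAlgebra k (G ⧸ (U i).toSubgroup))
    (hx : ∀ i j, ∃ l, ∃ (h : (U l).toSubgroup ≤ (U i).toSubgroup)
      (h' : (U l).toSubgroup ≤ (U j).toSubgroup),
      transition k h (x l) = x i ∧ transition k h' (x l) = x j) :
    ∃ y : CompletedGroupAlgebra k G, ∀ i, proj k (U i) y = x i := by
  choose f hf using hU
  have key : ∀ (M : OpenNormalSubgroup G) (i : ι) (h : (U i).toSubgroup ≤ M.toSubgroup),
      transition k (hf M) (x (f M)) = transition k h (x i) := by
    intro M i h
    obtain ⟨l, h1, h2, h3, h4⟩ := hx (f M) i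
    rw [← h3, ← h4, transition_transition, transition_transition]
  refine ⟨⟨fun M => transition k (hf M) (x (f M)), fun M N h => ?_⟩, fun i => ?_⟩
  · exact (transition_transition _ h _).trans (key N (f M) ((hf M).trans h)).symm
  · obtain ⟨l, h1, -, h3, -⟩ := hx i i
    refine (key (U i) l h1).trans h3

theorem exists_proj_eq {ι : Type*} (U : ι → OpenNormalSubgroup G)
    (hU : ∀ M : OpenNormalSubgroup G, ∃ i, (U i).toSubgroup ≤ M.toSubgroup)
    (x : ∀ i, MonoidAlgebra k (G ⧸ (U i).toSubgroup))
    (hx : ∀ i j (h : (U i).toSubgroup ≤ (U j).toSubgroup), transition k h (x i) = x j) :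
    ∃ y : CompletedGroupAlgebra k G, ∀ i, proj k (U i) y = x i :=
  exists_proj_eq_of_directed U hU x fun i j => by
    obtain ⟨l, hl⟩ := hU (U i ⊓ U j)
    exact ⟨l, hl.trans (inf_le_left' _ _), hl.trans (inf_le_right' _ _), hx _ _ _, hx _ _ _⟩

theorem proj_surjective (M : OpenNormalSubgroup G) : Function.Surjective (proj k M) := by
  intro x
  induction x using MonoidAlgebra.induction_on with
  | of q =>
    obtain ⟨g, rfl⟩ := QuotientGroup.mk_surjective q
    exact ⟨of k g, rfl⟩
  | add u v hu hv =>
    obtain ⟨u, rfl⟩ := hu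
    obtain ⟨v, rfl⟩ := hv
    exact ⟨u + v, map_add _ _ _⟩
  | smul r u hu =>
    obtain ⟨u, rfl⟩ := hu
    exact ⟨r • u, map_smul _ _ _⟩

theorem proj_mem_center {x : CompletedGroupAlgebra k G}
    (hx : x ∈ Subalgebra.center k (CompletedGroupAlgebra k G)) (M : OpenNormalSubgroup G) :
    proj k M x ∈ Subalgebra.center k (MonoidAlgebra k (G ⧸ M.toSubgroup)) := by
  refine Subalgebra.mem_center_iff.2 fun y => ?_
  obtain ⟨y, rfl⟩ := proj_surjective M y
  rw [← map_mul, ← map_mul, Subalgebra.mem_center_iff.1 hx]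

/-- The approximations modulo M form a net, indexed by the open normal subgroups, that converges to
x. -/
theorem mem_topologicalClosure_iff {S : Submodule k (CompletedGroupAlgebra k G)}
    {x : CompletedGroupAlgebra k G} :
    x ∈ S.topologicalClosure ↔ ∀ M, ∃ y ∈ S, proj k M y = proj k M x := by
  rw [← SetLike.mem_coe, Submodule.topologicalClosure_coe]
  constructor
  · intro h M
    obtain ⟨y, hy, hy'⟩ := mem_closure_iff.1 h (proj k M ⁻¹' {proj k M x})
      (isLocallyConstant_proj M _) rfl
    exact ⟨y, hy', hy⟩
  · intro h
    choose y hy hy' using h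
    have : Nonempty (OpenNormalSubgroup G) :=
      ⟨{ toOpenSubgroup := ⊤, isNormal' := by
          rw [OpenSubgroup.toSubgroup_top]; infer_instance }⟩
    refine mem_closure_of_tendsto (f := y) (b := Filter.atBot) ?_ (Filter.Eventually.of_forall hy)
    rw [nhds_iInf, Filter.tendsto_iInf]
    intro M
    rw [@nhds_induced _ _ ⊥, Filter.tendsto_comap_iff,
      @nhds_discrete _ ⊥ (@DiscreteTopology.mk _ ⊥ rfl),
      Filter.tendsto_pure]
    filter_upwards [Filter.eventually_le_atBot M] with M' hM'
    exact proj_mono hM' (hy' M')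

theorem proj_conj_of_mem_sup {Q : Subgroup G} {u : CompletedGroupAlgebra k G}
    (hu : u ∈ fixedPoints k Q) {M : OpenNormalSubgroup G} {h : G} (hh : h ∈ Q ⊔ M.toSubgroup) :
    proj k M (conj k h u) = proj k M u := by
  obtain ⟨q, hq, m, hm, rfl⟩ := Subgroup.mem_sup_of_normal_right.1 hh
  rw [← conj_conj, proj_conj_congr (proj_conj_of_mem hm u), hu q hq]

variable [IsTopologicalGroup G] [CompactSpace G]

/-- An element of `k[[G]]^Q` can be averaged over `QN` without changing its image in `k[G/N]`. -/
theorem exists_mem_fixedPoints_sup {Q : Subgroup G} {N : OpenNormalSubgroup G}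
    (hN : ∀ M : OpenNormalSubgroup G, M.toSubgroup ≤ N.toSubgroup →
      ((Q ⊔ M.toSubgroup).relIndex (Q ⊔ N.toSubgroup) : k) ≠ 0)
    {u : CompletedGroupAlgebra k G} (hu : u ∈ fixedPoints k Q) :
    ∃ v ∈ fixedPoints k (Q ⊔ N.toSubgroup), proj k N v = proj k N u := by
  -- The average of u over QN/QM is meaningful modulo M. For M' ≥ M the two averages agree modulo M'
  -- because u is fixed by QM' there, and the average at M = N is u itself modulo N.
  let w : OpenNormalSubgroup G → CompletedGroupAlgebra k G := fun M =>
    ((Q ⊔ M.toSubgroup).relIndex (Q ⊔ N.toSubgroup) : k)⁻¹ •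
      trace k (Q ⊔ M.toSubgroup) (Q ⊔ N.toSubgroup) u
  obtain ⟨v, hv⟩ := exists_proj_eq (k := k)
    (fun M : {M : OpenNormalSubgroup G // M.toSubgroup ≤ N.toSubgroup} => M.1)
    (fun M => ⟨⟨M ⊓ N, inf_le_right' M N⟩, inf_le_left' M N⟩) (fun M => proj k M.1 (w M.1)) (by
      rintro ⟨M, hM⟩ ⟨M', hM'⟩ h
      rw [transition_proj]
      change proj k M' (w M) = proj k M' (w M')
      have h1 := sup_le_sup_left h Q
      have h2 := sup_le_sup_left hM' Q
      have hne := hN M hM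
      simp only [w, map_smul]
      rw [proj_trace_eq_relIndex_smul h1 h2 fun x hx => proj_conj_of_mem_sup hu hx,
        ← Nat.cast_smul_eq_nsmul k, smul_smul]
      rw [← Subgroup.relIndex_mul_relIndex _ _ _ h1 h2, Nat.cast_mul] at hne ⊢
      rw [mul_inv, mul_comm, ← mul_assoc, mul_inv_cancel₀ (left_ne_zero_of_mul hne), one_mul])
  have hv' : ∀ M : OpenNormalSubgroup G, M.toSubgroup ≤ N.toSubgroup →
      proj k M v = proj k M (w M) := fun M hM => hv ⟨M, hM⟩
  refine ⟨v, fun h hh => ext_proj fun M => ?_, ?_⟩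
  · refine proj_mono (inf_le_left' M N) ?_
    have hM := hv' (M ⊓ N) (inf_le_right' M N)
    rw [proj_conj_congr hM, hM, map_smul, map_smul, map_smul,
      proj_conj_trace (fun x hx => proj_conj_of_mem_sup hu hx) hh]
  · have h1 : IsTransversal (fun _ : Unit => (1 : G)) (Q ⊔ N.toSubgroup) (Q ⊔ N.toSubgroup) :=
      ⟨fun _ => one_mem _, fun l hl => ⟨(), by simpa using hl, fun _ _ => rfl⟩⟩
    rw [hv' N le_rfl, map_smul, proj_trace_eq h1 fun x hx => proj_conj_of_mem_sup hu hx]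
    simp [Subgroup.relIndex_self, conj_one]

end Construction

/-! ### Idempotents of the center -/

section Idempotents

/-- The powers of x generate a stationary chain of ideals, so x^(n+1)w = x^n for some n and w, and
x^n w^(n+1) has the required properties. Such a y inverts x where x is invertible and vanishes where
x is nilpotent: xy is idempotent, and y = 0 forces x to be nilpotent. -/
theorem exists_drazin_inverse {R : Type*} [CommRing R] [IsArtinianRing R] (x : R) :
    ∃ y, y * x * y = y ∧ ∃ n : ℕ, x ^ (n + 1) * y = x ^ n := by
  obtain ⟨n, w, hw⟩ := IsArtinian.exists_pow_succ_smul_dvd (M := R) x (1 : R)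
  simp only [smul_eq_mul, mul_one] at hw
  have h : ∀ m : ℕ, x ^ (n + m) * w ^ m = x ^ n := by
    intro m
    induction m with
    | zero => simp
    | succ m ih =>
      calc x ^ (n + (m + 1)) * w ^ (m + 1) = (x ^ (n + 1) * w) * (x ^ m * w ^ m) := by ring
        _ = x ^ (n + m) * w ^ m := by rw [hw]; ring
        _ = x ^ n := ih
  refine ⟨x ^ n * w ^ (n + 1), ?_, n, ?_⟩
  · calc x ^ n * w ^ (n + 1) * x * (x ^ n * w ^ (n + 1))
        = (x ^ (n + (n + 1)) * w ^ (n + 1)) * w ^ (n + 1) := by ring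
      _ = x ^ n * w ^ (n + 1) := by rw [h]
  · calc x ^ (n + 1) * (x ^ n * w ^ (n + 1)) = x ^ (n + (n + 1)) * w ^ (n + 1) := by ring
      _ = x ^ n := h _

/-- Both elements equal yxz. Since the defining equations are preserved by homomorphisms, uniqueness
makes these inverses compatible along the projections k[G/M] → k[G/N]. -/
theorem drazin_inverse_unique {R : Type*} [CommRing R] {x y z : R} (hy : y * x * y = y)
    (hy' : ∃ n : ℕ, x ^ (n + 1) * y = x ^ n) (hz : z * x * z = z)
    (hz' : ∃ n : ℕ, x ^ (n + 1) * z = x ^ n) : y = z := by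
  have key : ∀ y z : R, y * x * y = y → z * x * z = z →
      (∃ n : ℕ, x ^ (n + 1) * z = x ^ n) → y = y * x * z := by
    rintro y z hy hz ⟨n, hn⟩
    have h : ∀ m : ℕ, y = y ^ (m + 1) * x ^ m := by
      intro m
      induction m with
      | zero => simp
      | succ m ih =>
        calc y = y ^ (m + 1) * x ^ m := ih
          _ = (y * x * y) * (y ^ m * x ^ m) := by rw [hy]; ring
          _ = y ^ (m + 1 + 1) * x ^ (m + 1) := by ring
    calc y = y ^ (n + 1) * x ^ n := h n
      _ = y ^ (n + 1) * (x ^ (n + 1) * z) := by rw [hn]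
      _ = (y ^ (n + 1) * x ^ n) * x * z := by ring
      _ = y * x * z := by rw [← h n]
  calc y = y * x * z := key y z hy hz hz'
    _ = z * x * y := by ring
    _ = z := (key z y hz hy hy').symm

variable {k : Type*} [Field k]

theorem exists_central_drazin_inverse {R : Type*} [Ring R] [Algebra k R] [FiniteDimensional k R]
    {x : R} (hx : x ∈ Subalgebra.center k R) :
    ∃ y ∈ Subalgebra.center k R, y * x * y = y ∧ ∃ n : ℕ, x ^ (n + 1) * y = x ^ n := by
  have : IsArtinianRing (Subalgebra.center k R) := IsArtinianRing.of_finite k _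
  obtain ⟨y, hy, n, hn⟩ := exists_drazin_inverse (⟨x, hx⟩ : Subalgebra.center k R)
  exact ⟨y, y.2, congrArg Subtype.val hy, n, congrArg Subtype.val hn⟩

theorem central_drazin_inverse_unique {R : Type*} [Ring R] [Algebra k R] {x y z : R}
    (hxc : x ∈ Subalgebra.center k R) (hyc : y ∈ Subalgebra.center k R)
    (hzc : z ∈ Subalgebra.center k R) (hy : y * x * y = y)
    (hy' : ∃ n : ℕ, x ^ (n + 1) * y = x ^ n) (hz : z * x * z = z)
    (hz' : ∃ n : ℕ, x ^ (n + 1) * z = x ^ n) : y = z := by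
  obtain ⟨m, hm⟩ := hy'
  obtain ⟨n, hn⟩ := hz'
  exact congrArg Subtype.val (drazin_inverse_unique (R := Subalgebra.center k R) (x := ⟨x, hxc⟩)
    (y := ⟨y, hyc⟩) (z := ⟨z, hzc⟩) (Subtype.ext hy) ⟨m, Subtype.ext hm⟩ (Subtype.ext hz)
    ⟨n, Subtype.ext hn⟩)

variable {G : Type*} [Group G] [TopologicalSpace G]

theorem transition_mem_center {M N : OpenNormalSubgroup G} (h : M.toSubgroup ≤ N.toSubgroup)
    {x : MonoidAlgebra k (G ⧸ M.toSubgroup)} (hx : x ∈ Subalgebra.center k _) :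
    transition k h x ∈ Subalgebra.center k (MonoidAlgebra k (G ⧸ N.toSubgroup)) := by
  refine Subalgebra.mem_center_iff.2 fun y => ?_
  obtain ⟨y, rfl⟩ := proj_surjective N y
  rw [← transition_proj h, ← map_mul, ← map_mul, Subalgebra.mem_center_iff.1 hx]

theorem mem_center_of_proj {x : CompletedGroupAlgebra k G}
    (hx : ∀ M, proj k M x ∈ Subalgebra.center k (MonoidAlgebra k (G ⧸ M.toSubgroup))) :
    x ∈ Subalgebra.center k (CompletedGroupAlgebra k G) :=
  Subalgebra.mem_center_iff.2 fun y => ext_proj fun M => by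
    rw [map_mul, map_mul, Subalgebra.mem_center_iff.1 (hx M)]

variable [IsTopologicalGroup G] [CompactSpace G]

/-- An element of the center of a block is topologically nilpotent or invertible. -/
theorem Block.isNilpotent_or_isUnit (B : Block k G) {a : CompletedGroupAlgebra k G}
    (ha : a ∈ Subalgebra.center k (CompletedGroupAlgebra k G)) :
    (∀ M, IsNilpotent (proj k M (B.e * a))) ∨
      ∃ b ∈ Subalgebra.center k (CompletedGroupAlgebra k G), B.e * a * b = B.e := by
  set x := B.e * a with hx
  have hxc := (Subalgebra.center k _).mul_mem B.mem_center ha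
  have hex : B.e * x = x := by rw [hx, ← mul_assoc, B.isIdempotentElem.eq]
  -- The Drazin inverses of the images of x = ea at the finite levels glue to a central z. Then xz
  -- is a central idempotent below e, and primitivity of e makes it 0 or e.
  choose y hyc hy n hn using fun M => exists_central_drazin_inverse (proj_mem_center hxc M)
  obtain ⟨z, hz⟩ := exists_proj_eq (k := k) (fun M : OpenNormalSubgroup G => M)
    (fun M => ⟨M, le_rfl⟩) y (by
      intro M N h
      have hy' := congrArg (transition k h) (hy M)
      have hn' := congrArg (transition k h) (hn M)
      simp only [map_mul, map_pow, transition_proj] at hy' hn'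
      exact central_drazin_inverse_unique (proj_mem_center hxc N)
        (transition_mem_center h (hyc M)) (hyc N) hy' ⟨n M, hn'⟩ (hy N) ⟨n N, hn N⟩)
  have hzc : z ∈ Subalgebra.center k (CompletedGroupAlgebra k G) :=
    mem_center_of_proj fun M => by rw [hz]; exact hyc M
  have hzx : z * x * z = z := ext_proj fun M => by
    rw [map_mul, map_mul, hz]
    exact hy M
  have hg : IsIdempotentElem (x * z) := by
    rw [IsIdempotentElem, mul_assoc, ← mul_assoc z, hzx]
  have hgc := (Subalgebra.center k (CompletedGroupAlgebra k G)).mul_mem hxc hzc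
  have heg : B.e * (x * z) = x * z := by rw [← mul_assoc, hex]
  have hge : x * z * B.e = x * z := by rw [Subalgebra.mem_center_iff.1 B.mem_center, heg]
  rcases B.primitive (x * z) hgc (B.e - x * z) (sub_mem B.mem_center hgc) hg
    (by rw [IsIdempotentElem, mul_sub, sub_mul, sub_mul, B.isIdempotentElem.eq, heg, hge, hg.eq,
          sub_self, sub_zero])
    (by rw [mul_sub, hge, hg.eq, sub_self]) (by abel) with h | h
  · left
    intro M
    refine ⟨n M, ?_⟩
    have hz0 : z = 0 := by rw [← hzx, mul_assoc, h, mul_zero]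
    have hy0 : y M = 0 := by rw [← hz, hz0, map_zero]
    rw [← hn M, hy0, mul_zero]
  · exact Or.inr ⟨z, hzc, (sub_eq_zero.1 h).symm⟩

/-- The infimum of a set of central idempotents that is closed under multiplication. -/
theorem exists_inf_idempotents {S : Set (CompletedGroupAlgebra k G)} (hne : S.Nonempty)
    (hc : ∀ s ∈ S, s ∈ Subalgebra.center k (CompletedGroupAlgebra k G))
    (hi : ∀ s ∈ S, IsIdempotentElem s) (hm : ∀ s ∈ S, ∀ t ∈ S, s * t ∈ S) :
    ∃ z ∈ Subalgebra.center k (CompletedGroupAlgebra k G), IsIdempotentElem z ∧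
      (∀ M, ∃ s ∈ S, proj k M s = proj k M z) ∧ ∀ s ∈ S, z * s = z := by
  have key : ∀ M : OpenNormalSubgroup G, ∃ s ∈ S, ∀ t ∈ S, proj k M (s * t) = proj k M s := by
    intro M
    -- An element of S whose image generates a right ideal of least dimension in k[G/M] is absorbed
    -- modulo M by every further multiplication with S.
    let r : CompletedGroupAlgebra k G → ℕ := fun s =>
      Module.finrank k (LinearMap.range (LinearMap.mulLeft k (proj k M s)))
    obtain ⟨_, ⟨s, hs, rfl⟩, hmin⟩ :=
      WellFounded.has_min (wellFounded_lt (α := ℕ)) (r '' S) (hne.image r)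
    refine ⟨s, hs, fun t ht => ?_⟩
    have hle : LinearMap.range (LinearMap.mulLeft k (proj k M (s * t))) ≤
        LinearMap.range (LinearMap.mulLeft k (proj k M s)) := by
      rintro _ ⟨u, rfl⟩
      exact ⟨proj k M t * u, by simp⟩
    have heq := Submodule.eq_of_le_of_finrank_le hle
      (not_lt.1 (hmin _ ⟨s * t, hm s hs t ht, rfl⟩))
    have h1 : proj k M s ∈ LinearMap.range (LinearMap.mulLeft k (proj k M (s * t))) := by
      rw [heq]
      exact ⟨1, by simp⟩
    obtain ⟨u, hu⟩ := h1
    rw [LinearMap.mulLeft_apply] at hu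
    have hst : s * t * t = s * t := by rw [mul_assoc, (hi t ht).eq]
    have hts : s * t = t * s := (Subalgebra.mem_center_iff.1 (hc s hs) t).symm
    calc proj k M (s * t) = proj k M t * proj k M s := by rw [hts, map_mul]
      _ = proj k M (t * (s * t)) * u := by rw [← hu, map_mul (proj k M) t (s * t), mul_assoc]
      _ = proj k M s := by rw [← mul_assoc, ← hts, hst, hu]
  choose s hs hst using key
  -- For M ≤ N the product of the two chosen idempotents agrees with `s M` modulo M and with `s N`
  -- modulo N, so the choices are compatible.
  obtain ⟨z, hz⟩ := exists_proj_eq (k := k) (fun M : OpenNormalSubgroup G => M)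
    (fun M => ⟨M, le_rfl⟩) (fun M => proj k M (s M)) (by
      intro M N h
      rw [transition_proj, ← hst N (s M) (hs M), ← Subalgebra.mem_center_iff.1 (hc _ (hs N))]
      exact (proj_mono h (hst M (s N) (hs N))).symm)
  refine ⟨z, mem_center_of_proj fun M => by rw [hz]; exact proj_mem_center (hc _ (hs M)) M,
    ext_proj fun M => ?_, fun M => ⟨s M, hs M, (hz M).symm⟩, fun t ht => ext_proj fun M => ?_⟩
  · rw [map_mul, hz, ← map_mul, (hi _ (hs M)).eq]
  · rw [map_mul, hz, ← map_mul, hst M t ht]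

end Idempotents

/-! ### Orbit sums -/

section OrbitSums

variable {p : ℕ} [Fact p.Prime] {k : Type*} [Field k] [CharP k p] {G : Type*} [Group G]
  [TopologicalSpace G] [IsTopologicalGroup G] [CompactSpace G]

theorem finite_quotient_of_inf_le {Q D : Subgroup G} {M : OpenNormalSubgroup G}
    (h : D ⊓ M.toSubgroup ≤ Q) : Finite (D ⧸ Q.subgroupOf D) := by
  have h1 : Finite (D ⧸ M.toSubgroup.subgroupOf D) := finite_quotient_subgroupOf M.isOpen' D
  have : (M.toSubgroup.subgroupOf D).FiniteIndex := Subgroup.finiteIndex_of_finite_quotient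
  have : (Q.subgroupOf D).FiniteIndex :=
    Subgroup.finiteIndex_of_le (H := M.toSubgroup.subgroupOf D) fun d hd => h ⟨d.2, hd⟩
  infer_instance

theorem isOpen_subgroupOf_of_inf_le {Q D : Subgroup G} {M : OpenNormalSubgroup G}
    (h : D ⊓ M.toSubgroup ≤ Q) : IsOpen (Q.subgroupOf D : Set D) :=
  Subgroup.isOpen_mono (H₁ := M.toSubgroup.subgroupOf D) (fun d hd => h ⟨d.2, hd⟩)
    (M.isOpen'.preimage continuous_subtype_val)

variable [TotallyDisconnectedSpace G]

theorem exists_inf_le_of_isOpen {Q D : Subgroup G} (h : IsOpen (Q.subgroupOf D : Set D)) :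
    ∃ M : OpenNormalSubgroup G, D ⊓ M.toSubgroup ≤ Q := by
  obtain ⟨V, hV, hVQ⟩ := isOpen_induced_iff.1 h
  have h1 : (1 : G) ∈ V := by
    have : (1 : D) ∈ Subtype.val ⁻¹' V := by
      rw [hVQ]
      exact one_mem _
    exact this
  obtain ⟨M, hM⟩ := ProfiniteGrp.exist_openNormalSubgroup_sub_open_nhds_of_one hV h1
  refine ⟨M, fun d hd => ?_⟩
  have : (⟨d, hd.1⟩ : D) ∈ Subtype.val ⁻¹' V := hM hd.2
  rw [hVQ] at this
  exact this

/-- The images in `k[G/M]` of the orbit sums `Tr_Q^D(z)`, for proper subgroups `Q ≥ D ∩ M` of `D`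
and elements `z` of the centralizer of `Q`. -/
def orbitSums (k : Type*) [Field k] (D : Subgroup G) (M : OpenNormalSubgroup G) :
    Set (MonoidAlgebra k (G ⧸ M.toSubgroup)) :=
  {t | ∃ Q : Subgroup G, Q < D ∧ D ⊓ M.toSubgroup ≤ Q ∧
    ∃ z ∈ Subgroup.centralizer (Q : Set G), proj k M (trace k Q D (of k z)) = t}

theorem of_mem_fixedPoints {Q : Subgroup G} {z : G} (hz : z ∈ Subgroup.centralizer (Q : Set G)) :
    of k z ∈ fixedPoints k Q := fun q hq => by
  rw [conj_of, Subgroup.mem_centralizer_iff.1 hz q hq, mul_inv_cancel_right]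

/-- An element of `k[[G]]^D` whose coefficients on the centralizer of `D` vanish is approximated by
linear combinations of nontrivial orbit sums. -/
theorem proj_mem_span_orbitSums {D : Subgroup G} (hD : HasPPowerOrders p D)
    {w : CompletedGroupAlgebra k G} (hw : w ∈ fixedPoints k D) {M : OpenNormalSubgroup G}
    (hwC : ∀ z ∈ Subgroup.centralizer (D : Set G), coef k M z w = 0) :
    proj k M w ∈ Submodule.span k (orbitSums k D M) := by
  classical
  -- Induction on the size of the support modulo M: subtract one orbit sum at a time, keeping the
  -- support inside that of w.
  have main : ∀ n : ℕ, ∀ x ∈ fixedPoints k D, (∀ h, coef k M h x ≠ 0 → coef k M h w ≠ 0) →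
      (proj k M x).coeff.support.card ≤ n →
      proj k M x ∈ Submodule.span k (orbitSums k D M) := by
    intro n
    induction n with
    | zero =>
      intro x _ _ hcard
      have : proj k M x = 0 := by
        rwa [Nat.le_zero, Finset.card_eq_zero, Finsupp.support_eq_empty,
          MonoidAlgebra.coeff_eq_zero] at hcard
      rw [this]
      exact zero_mem _
    | succ n ih =>
      intro x hx hxw hcard
      by_cases h0 : proj k M x = 0
      · rw [h0]
        exact zero_mem _
      have hne : (proj k M x).coeff.support.Nonempty := by
        rwa [Finsupp.support_nonempty_iff, Ne, MonoidAlgebra.coeff_eq_zero]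
      obtain ⟨q, hq⟩ := hne
      obtain ⟨g, rfl⟩ := QuotientGroup.mk_surjective q
      have hxg : coef k M g x ≠ 0 := Finsupp.mem_support_iff.1 hq
      -- The stabilizer in D of the coset gM under conjugation. The coset contains some z
      -- centralized by Q, and Q = D is excluded because w vanishes on the centralizer of D.
      let Q : Subgroup G := D ⊓ (Subgroup.centralizer {(g : G ⧸ M.toSubgroup)}).comap
        (QuotientGroup.mk' M.toSubgroup)
      have hQ : ∀ d, d ∈ Q ↔ d ∈ D ∧ g⁻¹ * (d * g * d⁻¹) ∈ M.toSubgroup := by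
        intro d
        rw [← conj_mk_eq_iff, mul_inv_eq_iff_eq_mul]
        simp only [Q, Subgroup.mem_inf, Subgroup.mem_comap, Subgroup.mem_centralizer_singleton_iff]
        rfl
      have hQD : Q ≤ D := inf_le_left
      have hMQ : D ⊓ M.toSubgroup ≤ Q := fun d hd => (hQ d).2 ⟨hd.1, by
        have := M.isNormal'.conj_mem d hd.2 g⁻¹
        rw [inv_inv] at this
        simpa [mul_assoc] using mul_mem this (inv_mem hd.2)⟩
      have := finite_quotient_of_inf_le hMQ
      have := Fintype.ofFinite (D ⧸ Q.subgroupOf D)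
      obtain ⟨z, hz, hgz⟩ := exists_mem_centralizer_of_coef_ne_zero (hD.mono hQD)
        (fixedPoints_anti k hQD hw) (fun d hd => ((hQ d).1 hd).2) (hxw g hxg)
      have hQne : Q ≠ D := by
        intro h
        rw [h] at hz
        refine hxw g hxg ?_
        rw [coef_congr hgz, hwC z hz]
      obtain ⟨o, ho⟩ : ∃ o, o = trace k Q D (of k z) := ⟨_, rfl⟩
      have hoD : o ∈ fixedPoints k D := ho ▸ trace_mem_fixedPoints (of_mem_fixedPoints hz)
      have hoM : proj k M o ∈ orbitSums k D M :=
        ⟨Q, lt_of_le_of_ne hQD hQne, hMQ, z, hz, by rw [ho]⟩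
      have hoc : ∀ h, coef k M h o = ∑ q : D ⧸ Q.subgroupOf D,
          if z⁻¹ * ((q.out : G)⁻¹ * h * q.out) ∈ M.toSubgroup then 1 else 0 := by
        intro h
        rw [ho, coef_trace (isTransversal_out Q D) (of_mem_fixedPoints hz)]
        exact Finset.sum_congr rfl fun q _ => coef_of M _ _
      have ho0 : ∀ h, coef k M h x = 0 → coef k M h o = 0 := by
        intro h hh
        rw [hoc]
        refine Finset.sum_eq_zero fun q _ => if_neg fun hq => hxg ?_
        rw [coef_congr hgz, coef_congr hq, coef_conj_eq hx M q.out.2, hh]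
      have ho1 : coef k M g o = 1 := by
        rw [hoc]
        obtain ⟨i, hi, hi'⟩ := (isTransversal_out Q D).existsUnique 1 (one_mem _)
        have hiff : ∀ q : D ⧸ Q.subgroupOf D,
            z⁻¹ * ((q.out : G)⁻¹ * g * q.out) ∈ M.toSubgroup ↔ (q.out : G)⁻¹ * 1 ∈ Q := by
          intro q
          rw [hQ, mul_one, inv_inv]
          have h1 : z⁻¹ * ((q.out : G)⁻¹ * g * q.out) =
              (g⁻¹ * z)⁻¹ * (g⁻¹ * ((q.out : G)⁻¹ * g * q.out)) := by group
          rw [h1, Subgroup.mul_mem_cancel_left _ (inv_mem hgz)]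
          exact ⟨fun h => ⟨inv_mem q.out.2, h⟩, fun h => h.2⟩
        simp only [hiff]
        rw [Finset.sum_eq_single i (fun q _ hq => if_neg fun h => hq (hi' q h)) (by simp),
          if_pos hi]
      -- Modulo M the orbit sum of z has coefficient 1 at gM and its support lies inside that of x,
      -- so the subtraction removes gM and adds nothing.
      have hsub : proj k M (x - coef k M g x • o) ∈ Submodule.span k (orbitSums k D M) := by
        refine ih _ (sub_mem hx ((fixedPoints k D).smul_mem hoD _))
          (fun h hh => hxw h fun hx0 => ?_)
          ?_
        · rw [map_sub, map_smul, hx0, ho0 h hx0, smul_zero, sub_zero] at hh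
          exact hh rfl
        · rw [← Nat.lt_succ_iff]
          refine lt_of_lt_of_le (Finset.card_lt_card ?_) hcard
          refine (Finset.ssubset_iff_of_subset fun q hq' => ?_).2 ⟨_, hq, ?_⟩
          · obtain ⟨h, rfl⟩ := QuotientGroup.mk_surjective q
            rw [Finsupp.mem_support_iff] at hq' ⊢
            intro hx0
            have hx0' : coef k M h x = 0 := hx0
            apply hq'
            rw [← coef_apply, map_sub, map_smul, hx0', ho0 h hx0', smul_zero, sub_zero]
          · rw [Finsupp.notMem_support_iff]
            rw [← coef_apply, map_sub, map_smul, ho1, smul_eq_mul, mul_one, sub_self]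
      have : proj k M x = proj k M (x - coef k M g x • o) + coef k M g x • proj k M o := by
        rw [← map_smul, ← map_add, sub_add_cancel]
      rw [this]
      exact add_mem hsub (Submodule.smul_mem _ _ (Submodule.subset_span hoM))
  exact main _ w hw (fun _ h => h) le_rfl

end OrbitSums

/-! ### The map induced by the inclusion of a subgroup -/

section Inclusion

variable {k : Type*} [Field k] {G : Type*} [Group G] [TopologicalSpace G]

theorem mapAt_eq {H : Type*} [Group H] [TopologicalSpace H] (φ : H →ₜ* G)
    (N : OpenNormalSubgroup G) (x : MonoidAlgebra k (H ⧸ (comapOpenNormal φ N).toSubgroup)) :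
    (mapAt k φ N x).coeff = Finsupp.mapDomain
      (QuotientGroup.map (comapOpenNormal φ N).toSubgroup N.toSubgroup φ.toMonoidHom
        fun _ h => h) x.coeff := rfl

theorem quotientMap_injective {H : Type*} [Group H] [TopologicalSpace H] (φ : H →ₜ* G)
    (N : OpenNormalSubgroup G) :
    Function.Injective (QuotientGroup.map (comapOpenNormal φ N).toSubgroup N.toSubgroup
      φ.toMonoidHom fun _ h => h) := by
  rw [injective_iff_map_eq_one]
  intro q hq
  obtain ⟨h, rfl⟩ := QuotientGroup.mk_surjective q
  exact (QuotientGroup.eq_one_iff h).2 ((QuotientGroup.eq_one_iff (φ h)).1 hq)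

/-- The map H/φ⁻¹(N) → G/N is injective, so coefficients are carried over without being summed. -/
theorem coef_map {H : Type*} [Group H] [TopologicalSpace H] (φ : H →ₜ* G)
    (N : OpenNormalSubgroup G) (h : H) (x : CompletedGroupAlgebra k H) :
    coef k N (φ h) (map k φ x) = coef k (comapOpenNormal φ N) h x := by
  rw [coef_apply, proj_map, mapAt_eq]
  exact Finsupp.mapDomain_apply (quotientMap_injective φ N) (proj k (comapOpenNormal φ N) x).coeff
    (h : H ⧸ (comapOpenNormal φ N).toSubgroup)

theorem coef_map_eq_zero {H : Type*} [Group H] [TopologicalSpace H] (φ : H →ₜ* G)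
    (N : OpenNormalSubgroup G) {g : G} (hg : ∀ h : H, (φ h)⁻¹ * g ∉ N.toSubgroup)
    (x : CompletedGroupAlgebra k H) : coef k N g (map k φ x) = 0 := by
  rw [coef_apply, proj_map, mapAt_eq]
  refine Finsupp.mapDomain_of_notMem_range _ _ ?_
  rintro ⟨q, hq⟩
  obtain ⟨h, rfl⟩ := QuotientGroup.mk_surjective q
  exact hg h (QuotientGroup.eq.1 hq)

variable [IsTopologicalGroup G] [CompactSpace G] [TotallyDisconnectedSpace G]

/-- The subgroups K ∩ M are cofinal among the open normal subgroups of K, so elements of k[[K]] may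
be built and compared at these levels only. -/
theorem exists_comapOpenNormal_le (K : Subgroup G) (L : OpenNormalSubgroup K) :
    ∃ M : OpenNormalSubgroup G, (comapOpenNormal (subtypeHom K) M).toSubgroup ≤ L.toSubgroup := by
  obtain ⟨V, hV, hVL⟩ := isOpen_induced_iff.1 L.isOpen'
  have h1 : (1 : K) ∈ Subtype.val ⁻¹' V := by
    rw [hVL]
    exact L.one_mem'
  obtain ⟨M, hM⟩ := ProfiniteGrp.exist_openNormalSubgroup_sub_open_nhds_of_one hV h1
  refine ⟨M, fun x hx => ?_⟩
  have : x ∈ Subtype.val ⁻¹' V := hM hx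
  rw [hVL] at this
  exact this

theorem ext_coef_comap {K : Subgroup G} {x y : CompletedGroupAlgebra k K}
    (h : ∀ (M : OpenNormalSubgroup G) (g : K),
      coef k (comapOpenNormal (subtypeHom K) M) g x =
        coef k (comapOpenNormal (subtypeHom K) M) g y) : x = y := by
  refine ext_proj fun L => ?_
  obtain ⟨M, hM⟩ := exists_comapOpenNormal_le K L
  exact proj_mono hM (proj_eq_iff_coef.2 (h M))

end Inclusion

/-! ### The Brauer homomorphism with values in the algebra of the centralizer -/

section BrauerMap

variable {p : ℕ} [Fact p.Prime] {k : Type*} [Field k] [CharP k p] {G : Type*} [Group G]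
  [TopologicalSpace G] [IsTopologicalGroup G] [CompactSpace G] [TotallyDisconnectedSpace G]

instance (D : Subgroup G) : CompactSpace (Subgroup.centralizer (D : Set G)) :=
  isCompact_iff_compactSpace.1 (Set.isClosed_centralizer (D : Set G)).isCompact

/-- The embedding `K/(K ∩ M) → G/M`, for a subgroup `K` of `G`. -/
def quotientIncl (K : Subgroup G) (M : OpenNormalSubgroup G) :
    K ⧸ (comapOpenNormal (subtypeHom K) M).toSubgroup →* G ⧸ M.toSubgroup :=
  QuotientGroup.map (comapOpenNormal (subtypeHom K) M).toSubgroup M.toSubgroup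
    (subtypeHom K).toMonoidHom fun _ h => h

theorem quotientIncl_mk (K : Subgroup G) (M : OpenNormalSubgroup G) (x : K) :
    quotientIncl K M x = ((x : G) : G ⧸ M.toSubgroup) := rfl

theorem quotientIncl_injective (K : Subgroup G) (M : OpenNormalSubgroup G) :
    Function.Injective (quotientIncl K M) := quotientMap_injective (subtypeHom K) M

/-- A sum over `G/M` of conjugation invariant terms reduces to the image of the centralizer. -/
theorem sum_eq_sum_centralizer {D : Subgroup G} (hD : HasPPowerOrders p D)
    {u : CompletedGroupAlgebra k G} (hu : u ∈ fixedPoints k D) {M : OpenNormalSubgroup G}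
    (φ : G ⧸ M.toSubgroup → k)
    (hφ : ∀ d ∈ D, ∀ q, φ ((d : G ⧸ M.toSubgroup) * q * (d : G ⧸ M.toSubgroup)⁻¹) = φ q)
    (hφu : ∀ q, (proj k M u).coeff q = 0 → φ q = 0) :
    ∑ q, φ q = ∑ c, φ (quotientIncl (Subgroup.centralizer (D : Set G)) M c) := by
  classical
  rw [sum_conj_eq_sum_fixed hD φ hφ]
  refine (Fintype.sum_of_injective _ (quotientIncl_injective _ M) _ _ (fun q hq => ?_)
    fun c => ?_).symm
  · rw [ite_eq_right_iff]
    intro hf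
    by_contra hne
    obtain ⟨g, rfl⟩ := QuotientGroup.mk_surjective q
    obtain ⟨z, hz, hgz⟩ := exists_mem_centralizer_of_coef_ne_zero hD hu
      (fun d hd => conj_mk_eq_iff.1 (hf d hd)) fun h => hne (hφu _ h)
    exact hq ⟨((⟨z, hz⟩ : Subgroup.centralizer (D : Set G)) : _ ⧸ _),
      (QuotientGroup.eq.2 hgz).symm⟩
  · obtain ⟨⟨z, hz⟩, rfl⟩ := QuotientGroup.mk_surjective c
    rw [if_pos]
    intro d hd
    refine conj_mk_eq_iff.2 ?_
    change z⁻¹ * (d * z * d⁻¹) ∈ M.toSubgroup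
    rw [Subgroup.mem_centralizer_iff.1 hz d hd, mul_inv_cancel_right, inv_mul_cancel]
    exact one_mem _

/-- The restriction of the coefficients to a subgroup, at the level of `k[G/M]`. -/
def restrictCoeff (K : Subgroup G) (M : OpenNormalSubgroup G)
    (x : MonoidAlgebra k (G ⧸ M.toSubgroup)) :
    MonoidAlgebra k (K ⧸ (comapOpenNormal (subtypeHom K) M).toSubgroup) :=
  MonoidAlgebra.comapDomain _ (quotientIncl_injective K M) x

theorem coeff_restrictCoeff (K : Subgroup G) (M : OpenNormalSubgroup G)
    (x : MonoidAlgebra k (G ⧸ M.toSubgroup)) (c : K) :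
    (restrictCoeff K M x).coeff (c : K ⧸ (comapOpenNormal (subtypeHom K) M).toSubgroup) =
      x.coeff ((c : G) : G ⧸ M.toSubgroup) := by
  rw [restrictCoeff, MonoidAlgebra.coeff_comapDomain, Finsupp.comapDomain_apply]
  rfl

/-- The coefficient of u at cM is a sum over the cosets of N inside cM. As c centralizes D,
conjugation by D permutes them, and only those that meet the centralizer contribute. -/
theorem transition_restrictCoeff {D : Subgroup G} (hD : HasPPowerOrders p D)
    {u : CompletedGroupAlgebra k G} (hu : u ∈ fixedPoints k D) {M N : OpenNormalSubgroup G}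
    (h : N.toSubgroup ≤ M.toSubgroup)
    (h' : (comapOpenNormal (subtypeHom (Subgroup.centralizer (D : Set G))) N).toSubgroup ≤
      (comapOpenNormal (subtypeHom (Subgroup.centralizer (D : Set G))) M).toSubgroup) :
    transition k h' (restrictCoeff _ N (proj k N u)) = restrictCoeff _ M (proj k M u) := by
  classical
  refine MonoidAlgebra.ext (Finsupp.ext fun q => ?_)
  obtain ⟨c, rfl⟩ := QuotientGroup.mk_surjective q
  rw [coeff_transition, coeff_restrictCoeff, ← coef_apply, coef_eq_sum h,
    sum_eq_sum_centralizer hD hu]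
  · refine Finset.sum_congr rfl fun q _ => ?_
    obtain ⟨x, rfl⟩ := QuotientGroup.mk_surjective q
    rw [coeff_restrictCoeff]
    refine if_congr ?_ rfl rfl
    rw [quotientIncl_mk, QuotientGroup.map_mk, QuotientGroup.map_mk, QuotientGroup.eq,
      QuotientGroup.eq]
    exact Iff.rfl
  · intro d hd q
    obtain ⟨z, rfl⟩ := QuotientGroup.mk_surjective q
    have h1 : (proj k N u).coeff ((d : G ⧸ N.toSubgroup) * z * (d : G ⧸ N.toSubgroup)⁻¹) =
        (proj k N u).coeff z := by
      have := coef_conj_eq hu N (inv_mem hd) z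
      rw [inv_inv] at this
      exact this
    rw [h1]
    refine if_congr ?_ rfl rfl
    have hc : ((c : G) : G ⧸ M.toSubgroup) =
        (d : G ⧸ M.toSubgroup) * (c : G) * (d : G ⧸ M.toSubgroup)⁻¹ := by
      rw [← QuotientGroup.mk_inv, ← QuotientGroup.mk_mul, ← QuotientGroup.mk_mul,
        Subgroup.mem_centralizer_iff.1 c.2 d hd, mul_inv_cancel_right]
    rw [map_mul, map_mul, map_inv, QuotientGroup.map_mk, QuotientGroup.map_mk, MonoidHom.id_apply,
      MonoidHom.id_apply]
    nth_rewrite 1 [hc]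
    rw [mul_left_inj, mul_right_inj]
  · intro q hq
    rw [hq, ite_self]

theorem exists_restriction {D : Subgroup G} (hD : HasPPowerOrders p D)
    {u : CompletedGroupAlgebra k G} (hu : u ∈ fixedPoints k D) :
    ∃ y : CompletedGroupAlgebra k (Subgroup.centralizer (D : Set G)),
      ∀ (M : OpenNormalSubgroup G) (c : Subgroup.centralizer (D : Set G)),
        coef k (comapOpenNormal (subtypeHom (Subgroup.centralizer (D : Set G))) M) c y =
          coef k M c u := by
  obtain ⟨y, hy⟩ := exists_proj_eq_of_directed (k := k)
    (fun M : OpenNormalSubgroup G =>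
      comapOpenNormal (subtypeHom (Subgroup.centralizer (D : Set G))) M)
    (exists_comapOpenNormal_le _)
    (fun M => restrictCoeff _ M (proj k M u))
    (fun M N => ⟨M ⊓ N, fun _ hx => hx.1, fun _ hx => hx.2,
      transition_restrictCoeff hD hu (inf_le_left' M N) _,
      transition_restrictCoeff hD hu (inf_le_right' M N) _⟩)
  exact ⟨y, fun M c => by rw [coef_apply, hy, coeff_restrictCoeff, coef_apply]⟩

/-- In the convolution sum for u * v at c the terms are invariant under conjugation by D, because c
is centralized by D. Hence only factors from the centralizer survive. The hypotheses concern one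
level M, so y may be a restriction of u at that level alone. -/
theorem coef_restriction_mul {D : Subgroup G} (hD : HasPPowerOrders p D)
    {u v : CompletedGroupAlgebra k G} (hu : u ∈ fixedPoints k D) (hv : v ∈ fixedPoints k D)
    {y z : CompletedGroupAlgebra k (Subgroup.centralizer (D : Set G))} {M : OpenNormalSubgroup G}
    (hy : ∀ c : Subgroup.centralizer (D : Set G),
      coef k (comapOpenNormal (subtypeHom (Subgroup.centralizer (D : Set G))) M) c y = coef k M c u)
    (hz : ∀ c : Subgroup.centralizer (D : Set G),
      coef k (comapOpenNormal (subtypeHom (Subgroup.centralizer (D : Set G))) M) c z = coef k M c v)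
    (c : Subgroup.centralizer (D : Set G)) :
    coef k (comapOpenNormal (subtypeHom (Subgroup.centralizer (D : Set G))) M) c (y * z) =
      coef k M c (u * v) := by
  rw [coef_mul, coef_mul, sum_eq_sum_centralizer hD hu]
  · refine Finset.sum_congr rfl fun q _ => ?_
    obtain ⟨x, rfl⟩ := QuotientGroup.mk_surjective q
    have h1 := hy x
    have h2 := hz (x⁻¹ * c)
    rw [coef_apply] at h1 h2
    rw [h1, ← QuotientGroup.mk_inv, ← QuotientGroup.mk_mul, h2]
    rfl
  · intro d hd q
    obtain ⟨g, rfl⟩ := QuotientGroup.mk_surjective q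
    have h1 := coef_conj_eq hu M (inv_mem hd) g
    have h2 := coef_conj_eq hv M (inv_mem hd) (g⁻¹ * c)
    rw [inv_inv] at h1 h2
    have h3 : d * (g⁻¹ * c) * d⁻¹ = (d * g * d⁻¹)⁻¹ * c := by
      rw [mul_assoc, mul_assoc, ← Subgroup.mem_centralizer_iff.1 c.2 d⁻¹ (inv_mem hd)]
      group
    rw [h3] at h2
    exact congrArg₂ (· * ·) h1 h2
  · intro q hq
    rw [hq, zero_mul]

/-- The Brauer homomorphism restricts the coefficients to the centralizer of `D`. -/
theorem exists_brauerMap (k : Type*) [Field k] [CharP k p] {D : Subgroup G}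
    (hD : HasPPowerOrders p D) :
    ∃ β : fixedPoints k D →ₐ[k] CompletedGroupAlgebra k (Subgroup.centralizer (D : Set G)),
      ∀ (u : fixedPoints k D) (M : OpenNormalSubgroup G) (c : Subgroup.centralizer (D : Set G)),
        coef k (comapOpenNormal (subtypeHom (Subgroup.centralizer (D : Set G))) M) c (β u) =
          coef k M c u := by
  classical
  choose β hβ using fun u : fixedPoints k D => exists_restriction hD u.2
  have hone : β 1 = 1 := ext_coef_comap fun M c => by
    rw [hβ, OneMemClass.coe_one, ← map_one (of k), ← map_one (of k), coef_of, coef_of]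
    rfl
  have hmul : ∀ u v, β (u * v) = β u * β v := fun u v => ext_coef_comap fun M c => by
    rw [hβ, coef_restriction_mul hD u.2 v.2 (hβ u M) (hβ v M), MulMemClass.coe_mul]
  refine ⟨AlgHom.ofLinearMap
    { toFun := β
      map_add' := fun u v => ext_coef_comap fun M c => by
        rw [hβ, map_add, hβ, hβ, Subalgebra.coe_add, map_add]
      map_smul' := fun r u => ext_coef_comap fun M c => by
        rw [hβ, RingHom.id_apply, map_smul, hβ, Subalgebra.coe_smul, map_smul] }
    hone hmul, hβ⟩

/-- The group D acts on D/Q by translation, and a fixed coset would force Q = D. -/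
theorem card_quotient_eq_zero {D Q : Subgroup G} (hD : HasPPowerOrders p D) (hQD : Q < D)
    {M : OpenNormalSubgroup G} (hM : D ⊓ M.toSubgroup ≤ Q) [Fintype (D ⧸ Q.subgroupOf D)] :
    (Fintype.card (D ⧸ Q.subgroupOf D) : k) = 0 := by
  classical
  have h := sum_eq_sum_fixed (k := k) (MulAction.toPermHom D (D ⧸ Q.subgroupOf D))
    (fun d => by
      obtain ⟨n, hn⟩ := hD M d d.2
      refine ⟨n, ?_⟩
      ext q
      obtain ⟨g, rfl⟩ := QuotientGroup.mk_surjective q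
      change ((d ^ p ^ n * g : D) : D ⧸ Q.subgroupOf D) = (g : D ⧸ Q.subgroupOf D)
      refine QuotientGroup.eq.2 (hM ⟨((d ^ p ^ n * g)⁻¹ * g).2, ?_⟩)
      have := M.isNormal'.conj_mem _ (inv_mem hn) (g : G)⁻¹
      simpa [mul_assoc] using this)
    (fun _ => 1) (fun _ _ => rfl)
  rw [Finset.sum_const, Finset.card_univ, nsmul_eq_mul, mul_one] at h
  rw [h]
  refine Finset.sum_eq_zero fun q _ => if_neg fun hq => hQD.not_ge fun d hd => ?_
  obtain ⟨g, rfl⟩ := QuotientGroup.mk_surjective q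
  have h1 := QuotientGroup.eq.1 (hq (g * ⟨d, hd⟩ * g⁻¹)).symm
  simpa [Subgroup.mem_subgroupOf] using h1

/-- At an element centralized by D all conjugates in a trace have the same coefficient, so it is
multiplied by |D : Q|, which is 0 in k. -/
theorem coef_eq_zero_of_mem_properTraces {D : Subgroup G} (hD : HasPPowerOrders p D)
    {x : CompletedGroupAlgebra k G} (hx : x ∈ properTraces k D) (M : OpenNormalSubgroup G) {c : G}
    (hc : c ∈ Subgroup.centralizer (D : Set G)) : coef k M c x = 0 := by
  have h : properTraces k D ≤ LinearMap.ker (coef k M c) := by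
    refine iSup_le fun Q => ?_
    rintro _ ⟨a, -, rfl⟩
    obtain ⟨N, hN⟩ := exists_inf_le_of_isOpen Q.2.2
    have := finite_quotient_of_inf_le hN
    have := Fintype.ofFinite (D ⧸ Q.1.subgroupOf D)
    rw [LinearMap.mem_ker, trace_apply, map_sum, Finset.sum_congr rfl (g := fun _ => coef k M c a)
      fun q _ => ?_, Finset.sum_const, Finset.card_univ, nsmul_eq_mul,
      card_quotient_eq_zero hD Q.2.1 hN, zero_mul]
    rw [coef_conj, mul_assoc, ← Subgroup.mem_centralizer_iff.1 hc _ q.out.2, inv_mul_cancel_left]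
  exact h hx

theorem orbitSums_subset (D : Subgroup G) (M : OpenNormalSubgroup G) :
    Submodule.span k (orbitSums k D M) ≤ (properTraces k D).map (proj k M).toLinearMap := by
  refine Submodule.span_le.2 ?_
  rintro _ ⟨Q, hQD, hMQ, z, hz, rfl⟩
  exact ⟨_, le_iSup (fun Q : {Q : Subgroup G // Q < D ∧ IsOpen (Q.subgroupOf D : Set D)} =>
    traceImage k Q.1 D) ⟨Q, hQD, isOpen_subgroupOf_of_inf_le hMQ⟩
    ⟨of k z, of_mem_fixedPoints hz, rfl⟩, rfl⟩

/-- The identification of the Brauer quotient with `k[[C_G(D)]]`. -/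
theorem centralizerToBrauerQuotient_eq_iff {D : Subgroup G} (hD : HasPPowerOrders p D)
    (u : fixedPoints k D) (c : CompletedGroupAlgebra k (Subgroup.centralizer (D : Set G))) :
    centralizerToBrauerQuotient k D c = brauerHom k D u ↔
      ∀ (M : OpenNormalSubgroup G) (z : Subgroup.centralizer (D : Set G)),
        coef k (comapOpenNormal (subtypeHom (Subgroup.centralizer (D : Set G))) M) z c =
          coef k M z u := by
  have hmem : centralizerToBrauerQuotient k D c = brauerHom k D u ↔
      CompletedGroupAlgebra.map k (subtypeHom (Subgroup.centralizer (D : Set G))) c - u ∈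
        (properTraces k D).topologicalClosure := Ideal.Quotient.eq
  rw [hmem, mem_topologicalClosure_iff]
  constructor
  · intro h M z
    obtain ⟨y, hy, hyM⟩ := h M
    have h1 := coef_eq_zero_of_mem_properTraces hD hy M z.2
    rw [coef_apply, hyM, ← coef_apply, map_sub, sub_eq_zero] at h1
    rw [← h1]
    exact (coef_map (subtypeHom (Subgroup.centralizer (D : Set G))) M z c).symm
  -- The difference has zero coefficients on the centralizer, hence modulo M it is a combination of
  -- orbit sums from proper subgroups.
  · intro h M
    obtain ⟨y, hy, hyM⟩ := orbitSums_subset D M (proj_mem_span_orbitSums hD (M := M)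
      (sub_mem (map_centralizer_mem_fixedPoints k D c) u.2) fun z hz => by
        rw [map_sub, sub_eq_zero, ← h M ⟨z, hz⟩]
        exact coef_map (subtypeHom (Subgroup.centralizer (D : Set G))) M ⟨z, hz⟩ c)
    exact ⟨y, hy, hyM⟩

end BrauerMap

/-! ### The Brauer homomorphism with values in the algebra of the normalizer -/

section Normalizer

variable {p : ℕ} [Fact p.Prime] {k : Type*} [Field k] [CharP k p] {G : Type*} [Group G]
  [TopologicalSpace G] [IsTopologicalGroup G] [CompactSpace G] [TotallyDisconnectedSpace G]

/-- The intersection of an open normal subgroup with a subgroup. -/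
abbrev level (K : Subgroup G) (M : OpenNormalSubgroup G) : OpenNormalSubgroup K :=
  comapOpenNormal (subtypeHom K) M

theorem coef_level_congr {K : Subgroup G} {M : OpenNormalSubgroup G} {g h : K}
    (hgh : (g : G)⁻¹ * h ∈ M.toSubgroup) (x : CompletedGroupAlgebra k K) :
    coef k (level K M) g x = coef k (level K M) h x :=
  coef_congr (M := level K M) hgh x

/-- For closed D, conjugation into D already implies normalizing, so the normalizer is an
intersection of closed conditions. -/
theorem isClosed_normalizer {D : Subgroup G} (hD : IsClosed (D : Set G)) :
    IsClosed (Subgroup.normalizer (D : Set G) : Set G) := by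
  have h : (Subgroup.normalizer (D : Set G) : Set G) =
      ⋂ d : D, {g | g⁻¹ * (d : G) * g ∈ D} := by
    ext g
    rw [Set.mem_iInter]
    exact ⟨fun hg d => (Subgroup.mem_normalizer_iff''.1 hg d).1 d.2,
      fun hg => mem_normalizer_of_conj_mem hD fun d hd => hg ⟨d, hd⟩⟩
  rw [h]
  exact isClosed_iInter fun d =>
    hD.preimage (f := fun g : G => g⁻¹ * (d : G) * g) (by fun_prop)

theorem mem_subgroupOf_sup_level {D K : Subgroup G} (hDK : D ≤ K) {N : OpenNormalSubgroup G}
    {x : K} : x ∈ D.subgroupOf K ⊔ (level K N).toSubgroup ↔ (x : G) ∈ D ⊔ N.toSubgroup := by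
  rw [Subgroup.mem_sup_of_normal_right, Subgroup.mem_sup_of_normal_right]
  constructor
  · rintro ⟨d, hd, n, hn, rfl⟩
    exact ⟨d, hd, n, hn, rfl⟩
  · rintro ⟨d, hd, n, hn, h⟩
    refine ⟨⟨d, hDK hd⟩, hd, ⟨n, ?_⟩, hn, Subtype.ext h⟩
    rw [← Subgroup.mul_mem_cancel_left K (hDK hd), h]
    exact x.2

theorem centralizer_le {D : Subgroup G} {z : G} (hz : z ∈ Subgroup.centralizer (D : Set G)) :
    z ∈ Subgroup.normalizer (D : Set G) :=
  Subgroup.centralizer_le_normalizer (D : Set G) hz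

theorem conj_mem_centralizer {D : Subgroup G} {z h : G}
    (hz : z ∈ Subgroup.centralizer (D : Set G)) (hh : h ∈ Subgroup.normalizer (D : Set G)) :
    h⁻¹ * z * h ∈ Subgroup.centralizer (D : Set G) := by
  refine Subgroup.mem_centralizer_iff.2 fun d hd => ?_
  have := Subgroup.mem_centralizer_iff.1 hz _ ((Subgroup.mem_normalizer_iff.1 hh d).1 hd)
  calc d * (h⁻¹ * z * h) = h⁻¹ * (h * d * h⁻¹ * z) * h := by group
    _ = h⁻¹ * (z * (h * d * h⁻¹)) * h := by rw [this]
    _ = h⁻¹ * z * h * d := by group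

variable (k) in
/-- A homomorphism `k[[G]]^D → k[[N_G(D)]]` that restricts the coefficients to the centralizer
of `D`. -/
structure IsNormalizerMap {D : Subgroup G}
    (σ : fixedPoints k D →ₐ[k] CompletedGroupAlgebra k (Subgroup.normalizer (D : Set G))) :
    Prop where
  coef_eq : ∀ (u : fixedPoints k D) (M : OpenNormalSubgroup G)
    (h : Subgroup.normalizer (D : Set G)), (h : G) ∈ Subgroup.centralizer (D : Set G) →
      coef k (level _ M) h (σ u) = coef k M h u
  coef_eq_zero : ∀ (u : fixedPoints k D) (M : OpenNormalSubgroup G)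
    (h : Subgroup.normalizer (D : Set G)),
      (∀ z ∈ Subgroup.centralizer (D : Set G), (h : G)⁻¹ * z ∉ M.toSubgroup) →
      coef k (level _ M) h (σ u) = 0

/-- Here σ is restriction to the centralizer followed by k[[C_G(D)]] → k[[N_G(D)]]. From this point
on, correspondence of blocks is used only as f = fσ(e), with σ known through its coefficients. -/
theorem exists_normalizerMap (k : Type*) [Field k] [CharP k p] {D : Subgroup G}
    (hD : HasPPowerOrders p D) :
    ∃ σ : fixedPoints k D →ₐ[k] CompletedGroupAlgebra k (Subgroup.normalizer (D : Set G)),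
      IsNormalizerMap k σ ∧ ∀ (b : Block k (Subgroup.normalizer (D : Set G))) (B : Block k G),
        IsBrauerCorrespondent D b B ↔ b.e = b.e * σ ⟨B.e, B.e_mem_fixedPoints D⟩ := by
  obtain ⟨β, hβ⟩ := exists_brauerMap k hD
  refine ⟨(CompletedGroupAlgebra.map k (centralizerToNormalizer D)).comp β, ⟨?_, ?_⟩, ?_⟩
  · intro u M h hh
    rw [← hβ u M ⟨h, hh⟩]
    exact coef_map (centralizerToNormalizer D) (level _ M) ⟨h, hh⟩ (β u)
  · intro u M h hh
    refine coef_map_eq_zero (centralizerToNormalizer D) (level _ M) (fun z hz => ?_) (β u)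
    refine hh z z.2 ?_
    have h1 : (z : G)⁻¹ * h ∈ M.toSubgroup := hz
    simpa using inv_mem h1
  · intro b B
    constructor
    · rintro ⟨c, hc, hb⟩
      have : c = β ⟨B.e, B.e_mem_fixedPoints D⟩ := ext_coef_comap fun M z => by
        rw [hβ, (centralizerToBrauerQuotient_eq_iff hD _ c).1 hc]
      rw [this] at hb
      exact hb
    · intro hb
      exact ⟨β ⟨B.e, B.e_mem_fixedPoints D⟩,
        (centralizerToBrauerQuotient_eq_iff hD _ _).2 fun M z => hβ _ M z, hb⟩

/-- Elements of `k[H/(H ∩ M)]`, for `H = N_G(D)`, that are supported on the image of the centralizer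
are compared there. -/
theorem proj_level_eq {D : Subgroup G} {M : OpenNormalSubgroup G}
    {x y : CompletedGroupAlgebra k (Subgroup.normalizer (D : Set G))}
    (h : ∀ (z : G) (hz : z ∈ Subgroup.centralizer (D : Set G)),
      coef k (level _ M) ⟨z, centralizer_le hz⟩ x = coef k (level _ M) ⟨z, centralizer_le hz⟩ y)
    (hx : ∀ h : Subgroup.normalizer (D : Set G),
      (∀ z ∈ Subgroup.centralizer (D : Set G), (h : G)⁻¹ * z ∉ M.toSubgroup) →
        coef k (level _ M) h x = 0)
    (hy : ∀ h : Subgroup.normalizer (D : Set G),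
      (∀ z ∈ Subgroup.centralizer (D : Set G), (h : G)⁻¹ * z ∉ M.toSubgroup) →
        coef k (level _ M) h y = 0) :
    proj k (level (Subgroup.normalizer (D : Set G)) M) x = proj k (level _ M) y := by
  refine proj_eq_iff_coef.2 fun g => ?_
  by_cases hg : ∃ z ∈ Subgroup.centralizer (D : Set G), (g : G)⁻¹ * z ∈ M.toSubgroup
  · obtain ⟨z, hz, hgz⟩ := hg
    have h1 : ∀ x : CompletedGroupAlgebra k (Subgroup.normalizer (D : Set G)),
        coef k (level _ M) g x = coef k (level _ M) ⟨z, centralizer_le hz⟩ x :=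
      fun x => coef_level_congr hgz x
    rw [h1, h1, h z hz]
  · push Not at hg
    rw [hx g hg, hy g hg]

namespace IsNormalizerMap

variable {D : Subgroup G}
  {σ : fixedPoints k D →ₐ[k] CompletedGroupAlgebra k (Subgroup.normalizer (D : Set G))}

theorem coef_eq_of_mem (hσ : IsNormalizerMap k σ) (u : fixedPoints k D) (M : OpenNormalSubgroup G)
    (h : Subgroup.normalizer (D : Set G)) {z : G} (hz : z ∈ Subgroup.centralizer (D : Set G))
    (hhz : (h : G)⁻¹ * z ∈ M.toSubgroup) : coef k (level _ M) h (σ u) = coef k M z u := by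
  rw [← hσ.coef_eq u M ⟨z, centralizer_le hz⟩ hz]
  exact coef_level_congr hhz _

/-- Thus σ descends to the finite levels, which lets congruences modulo M be carried from G to the
normalizer. -/
theorem proj_congr (hσ : IsNormalizerMap k σ) {M : OpenNormalSubgroup G} {u v : fixedPoints k D}
    (h : proj k M (u : CompletedGroupAlgebra k G) = proj k M v) :
    proj k (level (Subgroup.normalizer (D : Set G)) M) (σ u) = proj k (level _ M) (σ v) :=
  proj_level_eq (fun z hz => by
    rw [hσ.coef_eq u M _ hz, hσ.coef_eq v M _ hz, coef_apply, h, coef_apply])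
    (hσ.coef_eq_zero u M) (hσ.coef_eq_zero v M)

theorem mem_fixedPoints (hσ : IsNormalizerMap k σ) (u : fixedPoints k D)
    {L : Subgroup (Subgroup.normalizer (D : Set G))}
    (hu : ∀ l ∈ L, conj k (l : G) u = (u : CompletedGroupAlgebra k G)) :
    σ u ∈ fixedPoints k L := by
  intro l hl
  refine ext_coef_comap fun M => proj_eq_iff_coef.1 (proj_level_eq (fun z hz => ?_)
    (fun h hh => ?_) (hσ.coef_eq_zero u M))
  · have h := coef_conj M z (l : G) (u : CompletedGroupAlgebra k G)
    rw [hu l hl] at h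
    rw [coef_conj, hσ.coef_eq u M (l⁻¹ * _ * l) (conj_mem_centralizer hz l.2),
      hσ.coef_eq u M _ hz, h]
    rfl
  · rw [coef_conj]
    refine hσ.coef_eq_zero u M _ fun z hz hmem => ?_
    refine hh _ (conj_mem_centralizer (h := (l : G)⁻¹) hz (inv_mem l.2)) ?_
    have := M.isNormal'.conj_mem _ hmem l
    convert this using 1
    simp [mul_assoc]

theorem mem_center (hσ : IsNormalizerMap k σ) (u : fixedPoints k D)
    (hu : (u : CompletedGroupAlgebra k G) ∈ Subalgebra.center k (CompletedGroupAlgebra k G)) :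
    σ u ∈ Subalgebra.center k (CompletedGroupAlgebra k (Subgroup.normalizer (D : Set G))) :=
  mem_center_iff.2 (hσ.mem_fixedPoints u fun _ _ => mem_center_iff.1 hu _ (Subgroup.mem_top _))

end IsNormalizerMap

theorem coef_conj_sup {D : Subgroup G} {N : OpenNormalSubgroup G}
    {z : CompletedGroupAlgebra k G} (hz : z ∈ fixedPoints k (D ⊔ N.toSubgroup))
    (M : OpenNormalSubgroup G) (c : G) {g h : G} (hgh : g⁻¹ * h ∈ D ⊔ N.toSubgroup) :
    coef k M (g⁻¹ * c * g) z = coef k M (h⁻¹ * c * h) z := by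
  rw [← coef_conj_eq hz M hgh]
  congr 2
  group

/-- The coefficients on the centralizer of `D` of a trace from `DN` to `G`. -/
theorem coef_trace_sup {D : Subgroup G} (hDc : IsClosed (D : Set G)) (hD : HasPPowerOrders p D)
    {N : OpenNormalSubgroup G}
    (hN : ∀ M : OpenNormalSubgroup G, M.toSubgroup ≤ N.toSubgroup →
      ¬ p ∣ (D ⊔ M.toSubgroup).relIndex (D ⊔ N.toSubgroup))
    {z : CompletedGroupAlgebra k G} (hz : z ∈ fixedPoints k (D ⊔ N.toSubgroup))
    (M : OpenNormalSubgroup G) {c : G} (hc : c ∈ Subgroup.centralizer (D : Set G))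
    {ι : Type*} [Fintype ι] {t : ι → Subgroup.normalizer (D : Set G)}
    (ht : IsTransversal t (D.subgroupOf _ ⊔ (level _ N).toSubgroup) ⊤) :
    coef k M c (trace k (D ⊔ N.toSubgroup) ⊤ z) =
      ∑ i, coef k M ((t i : G)⁻¹ * c * t i) z := by
  classical
  have := Fintype.ofFinite (G ⧸ (D ⊔ N.toSubgroup))
  have hDH : D ≤ Subgroup.normalizer (D : Set G) := Subgroup.le_normalizer
  rw [coef_trace (isTransversal_out_top _) hz]
  have hout : ∀ g : G, coef k M (((g : G ⧸ (D ⊔ N.toSubgroup)).out)⁻¹ * c *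
      (g : G ⧸ (D ⊔ N.toSubgroup)).out) z = coef k M (g⁻¹ * c * g) z := fun g =>
    coef_conj_sup hz M c (QuotientGroup.eq.1 (Quotient.out_eq' (g : G ⧸ (D ⊔ N.toSubgroup))))
  -- Since c centralizes D, the summand is invariant under left translation by D. A fixed coset gDN
  -- satisfies g⁻¹Dg ≤ DN, so by the Frattini argument it contains an element of the normalizer.
  rw [sum_quotient_eq_sum_fixed hD (N := N) le_sup_right]
  · refine (Fintype.sum_of_injective (fun i => ((t i : G) : G ⧸ (D ⊔ N.toSubgroup)))
      (fun i j hij => ?_) _ _ (fun q hq => ?_) fun i => ?_).symm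
    · refine ht.eq_of_mem ((mem_subgroupOf_sup_level hDH).2 ?_)
      exact QuotientGroup.eq.1 hij
    · refine if_neg fun hf => hq ?_
      obtain ⟨g, rfl⟩ := QuotientGroup.mk_surjective q
      obtain ⟨n, hn, hgn⟩ := exists_mul_mem_normalizer hDc hD hN (g := g) fun d hd => by
        have h1 : (d * g)⁻¹ * g ∈ D ⊔ N.toSubgroup := QuotientGroup.eq.1 (hf d hd)
        have h2 := inv_mem h1
        convert h2 using 1
        group
      obtain ⟨i, hi, -⟩ := ht.existsUnique ⟨g * n, hgn⟩ (Subgroup.mem_top _)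
      refine ⟨i, QuotientGroup.eq.2 ?_⟩
      have h3 := (mem_subgroupOf_sup_level hDH).1 hi
      have h4 := mul_mem h3 (Subgroup.mem_sup_right (S := D) (inv_mem hn))
      simpa [mul_assoc] using h4
    · rw [if_pos, hout]
      intro d hd
      refine QuotientGroup.eq.2 (Subgroup.mem_sup_left ?_)
      have := (Subgroup.mem_normalizer_iff''.1 (t i).2 d⁻¹).1 (inv_mem hd)
      change (d * (t i : G))⁻¹ * t i ∈ D
      simpa [mul_assoc] using this
  · intro d hd q
    obtain ⟨g, rfl⟩ := QuotientGroup.mk_surjective q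
    change coef k M (((d * g : G) : G ⧸ (D ⊔ N.toSubgroup)).out⁻¹ * c *
      ((d * g : G) : G ⧸ (D ⊔ N.toSubgroup)).out) z = _
    rw [hout, hout]
    congr 2
    rw [mul_inv_rev, mul_assoc g⁻¹, mul_assoc g⁻¹, mul_assoc d⁻¹, ← mul_assoc c,
      ← Subgroup.mem_centralizer_iff.1 hc d hd]
    group

/-- The preimage of the trace is σ(z) itself: on the centralizer both traces have the same
coefficients by `coef_trace_sup`, and off it both vanish. -/
theorem trace_level_eq {D : Subgroup G}
    {σ : fixedPoints k D →ₐ[k] CompletedGroupAlgebra k (Subgroup.normalizer (D : Set G))}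
    (hσ : IsNormalizerMap k σ) (hDc : IsClosed (D : Set G)) (hD : HasPPowerOrders p D)
    {N : OpenNormalSubgroup G}
    (hN : ∀ M : OpenNormalSubgroup G, M.toSubgroup ≤ N.toSubgroup →
      ¬ p ∣ (D ⊔ M.toSubgroup).relIndex (D ⊔ N.toSubgroup))
    {z : CompletedGroupAlgebra k G} (hz : z ∈ fixedPoints k (D ⊔ N.toSubgroup)) :
    σ ⟨trace k (D ⊔ N.toSubgroup) ⊤ z, fixedPoints_anti k le_top (trace_mem_fixedPoints hz)⟩ ∈
      traceImage k (D.subgroupOf _ ⊔ (level (Subgroup.normalizer (D : Set G)) N).toSubgroup) ⊤ := by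
  have hcs : CompactSpace (Subgroup.normalizer (D : Set G)) :=
    isCompact_iff_compactSpace.1 (isClosed_normalizer hDc).isCompact
  have hDH : D ≤ Subgroup.normalizer (D : Set G) := Subgroup.le_normalizer
  have hzD := fixedPoints_anti k (le_sup_left (b := N.toSubgroup)) hz
  have hzH : σ ⟨z, hzD⟩ ∈ fixedPoints k
      (D.subgroupOf _ ⊔ (level (Subgroup.normalizer (D : Set G)) N).toSubgroup) :=
    hσ.mem_fixedPoints _ fun l hl => hz l ((mem_subgroupOf_sup_level hDH).1 hl)
  have := Fintype.ofFinite (Subgroup.normalizer (D : Set G) ⧸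
    (D.subgroupOf _ ⊔ (level (Subgroup.normalizer (D : Set G)) N).toSubgroup))
  have ht := isTransversal_out_top
    (D.subgroupOf _ ⊔ (level (Subgroup.normalizer (D : Set G)) N).toSubgroup)
  refine ⟨σ ⟨z, hzD⟩, hzH, ?_⟩
  refine ext_coef_comap fun M => proj_eq_iff_coef.1 (proj_level_eq (fun c hc => ?_)
    (fun h hh => ?_) (hσ.coef_eq_zero _ M))
  · rw [hσ.coef_eq _ M _ hc, coef_trace ht hzH, coef_trace_sup hDc hD hN hz M hc ht]
    refine Finset.sum_congr rfl fun q _ => ?_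
    exact hσ.coef_eq _ M _ (conj_mem_centralizer hc q.out.2)
  · rw [coef_trace ht hzH]
    refine Finset.sum_eq_zero fun q _ => hσ.coef_eq_zero _ M _ fun z hz hmem => ?_
    refine hh _ (conj_mem_centralizer (h := (q.out : G)⁻¹) hz (inv_mem q.out.2)) ?_
    have := M.isNormal'.conj_mem _ hmem (q.out : G)
    convert this using 1
    simp [mul_assoc]

/-- Elements of `Tr_D^H` that are supported on the centralizer of `D` are images under the Brauer
homomorphism, at the level of `k[H/(H ∩ M)]`. -/
theorem exists_mem_traceImage_proj_eq {D : Subgroup G}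
    {σ : fixedPoints k D →ₐ[k] CompletedGroupAlgebra k (Subgroup.normalizer (D : Set G))}
    (hσ : IsNormalizerMap k σ) (hDc : IsClosed (D : Set G)) (hD : HasPPowerOrders p D)
    {N : OpenNormalSubgroup G}
    (hN : ∀ M : OpenNormalSubgroup G, M.toSubgroup ≤ N.toSubgroup →
      ¬ p ∣ (D ⊔ M.toSubgroup).relIndex (D ⊔ N.toSubgroup))
    {f : CompletedGroupAlgebra k (Subgroup.normalizer (D : Set G))}
    (hf : f ∈ traceImage k
      (D.subgroupOf _ ⊔ (level (Subgroup.normalizer (D : Set G)) N).toSubgroup) ⊤)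
    (hfC : ∀ h : Subgroup.normalizer (D : Set G),
      (∀ z ∈ Subgroup.centralizer (D : Set G), (h : G)⁻¹ * z ∉ N.toSubgroup) →
        coef k (level _ N) h f = 0) :
    ∃ a : fixedPoints k D, (a : CompletedGroupAlgebra k G) ∈ traceImage k (D ⊔ N.toSubgroup) ⊤ ∧
      (a : CompletedGroupAlgebra k G) ∈ fixedPoints k (⊤ : Subgroup G) ∧
      proj k (level _ N) (σ a) = proj k (level _ N) f := by
  classical
  have hcs : CompactSpace (Subgroup.normalizer (D : Set G)) :=
    isCompact_iff_compactSpace.1 (isClosed_normalizer hDc).isCompact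
  obtain ⟨x, hx, rfl⟩ := hf
  have := Fintype.ofFinite (Subgroup.normalizer (D : Set G) ⧸
    (D.subgroupOf _ ⊔ (level (Subgroup.normalizer (D : Set G)) N).toSubgroup))
  have ht := isTransversal_out_top
    (D.subgroupOf _ ⊔ (level (Subgroup.normalizer (D : Set G)) N).toSubgroup)
  let r : Subgroup.centralizer (D : Set G) ⧸
      (level (Subgroup.centralizer (D : Set G)) N).toSubgroup → Subgroup.centralizer (D : Set G) :=
    fun q => q.out
  -- The coefficients of x on the centralizer modulo N, placed on representatives inside the
  -- centralizer. This makes y exactly D-fixed.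
  let y : CompletedGroupAlgebra k G := ∑ q, coef k (level (Subgroup.normalizer (D : Set G)) N)
    ⟨r q, centralizer_le (r q).2⟩ x • of k (r q : G)
  have hy : y ∈ fixedPoints k D := sum_mem fun q _ =>
    (fixedPoints k D).smul_mem (of_mem_fixedPoints (r q).2) _
  have hyc : ∀ (z : G) (hz : z ∈ Subgroup.centralizer (D : Set G)),
      coef k N z y = coef k (level _ N) ⟨z, centralizer_le hz⟩ x := by
    intro z hz
    have hr : ∀ q, (r q : G)⁻¹ * z ∈ N.toSubgroup ↔
        q = ((⟨z, hz⟩ : Subgroup.centralizer (D : Set G)) : _ ⧸ _) := by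
      intro q
      conv_rhs => rw [← Quotient.out_eq' q]
      exact (QuotientGroup.eq (s := (level (Subgroup.centralizer (D : Set G)) N).toSubgroup)
        (a := r q) (b := ⟨z, hz⟩)).symm
    simp only [y, map_sum, map_smul, coef_of, hr, smul_eq_mul, mul_ite, mul_one, mul_zero]
    rw [Finset.sum_ite_eq' Finset.univ, if_pos (Finset.mem_univ _)]
    exact coef_level_congr ((hr _).2 rfl) x
  -- Averaging makes y fixed by DN without changing it modulo N. Its trace to G then has the
  -- prescribed coefficients on the centralizer modulo N.
  obtain ⟨v, hv, hvy⟩ := exists_mem_fixedPoints_sup (fun M hM h =>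
    hN M hM ((CharP.cast_eq_zero_iff k p _).1 h)) hy
  have ha := trace_mem_fixedPoints (L := ⊤) hv
  refine ⟨⟨trace k (D ⊔ N.toSubgroup) ⊤ v, fixedPoints_anti k le_top ha⟩, ⟨v, hv, rfl⟩, ha,
    proj_level_eq (fun c hc => ?_) (hσ.coef_eq_zero _ N) hfC⟩
  rw [hσ.coef_eq _ N _ hc, coef_trace ht hx, coef_trace_sup hDc hD hN hv N hc ht]
  refine Finset.sum_congr rfl fun q _ => ?_
  rw [coef_apply, hvy, ← coef_apply, hyc _ (conj_mem_centralizer hc q.out.2)]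
  rfl

end Normalizer

/-! ### Central idempotents and normal `p`-subgroups of finite groups -/

section FiniteGroup

variable {p : ℕ} [Fact p.Prime] {k : Type*} [Field k] [CharP k p]

/-- A finite `p`-group acting on a nonzero abelian group of exponent `p` fixes a nonzero
element. -/
theorem exists_fixed_vector {Γ : Type*} [Group Γ] [Finite Γ] (hΓ : IsPGroup p Γ) {V : Type*}
    [AddCommGroup V] [Module (ZMod p) V] (ρ : Γ →* AddMonoid.End V) (W : AddSubgroup V)
    (hW : ∀ g, ∀ v ∈ W, ρ g v ∈ W) {v : V} (hv : v ∈ W) (hv0 : v ≠ 0) :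
    ∃ w ∈ W, w ≠ 0 ∧ ∀ g, ρ g w = w := by
  -- The field k may be infinite, but the span of the orbit of v over the prime field is finite. Its
  -- order is divisible by p, so 0 is not its only fixed point.
  obtain ⟨S, hS⟩ : ∃ S : Submodule (ZMod p) V,
      S = Submodule.span (ZMod p) (Set.range fun g => ρ g v) := ⟨_, rfl⟩
  have hSf : Finite ↥S := by
    have : Module.Finite (ZMod p) S :=
      hS ▸ Module.Finite.span_of_finite _ (Set.finite_range _)
    exact Module.finite_of_finite (ZMod p)
  have hSW : ∀ x ∈ S, x ∈ W := by
    have h1 : S ≤ AddSubgroup.toZModSubmodule p W := by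
      rw [hS, Submodule.span_le]
      rintro _ ⟨g, rfl⟩
      exact hW g v hv
    exact h1
  have hSρ : ∀ g, ∀ x ∈ S, ρ g x ∈ S := by
    intro g x hx
    rw [hS] at hx ⊢
    induction hx using Submodule.span_induction with
    | mem x hx =>
      obtain ⟨h, rfl⟩ := hx
      refine Submodule.subset_span ⟨g * h, ?_⟩
      simp
    | zero => rw [map_zero]; exact zero_mem _
    | add x y _ _ hx hy => rw [map_add]; exact add_mem hx hy
    | smul a x _ hx =>
      have : ρ g (a • x) = a • ρ g x := ZMod.map_smul (ρ g) a x
      rw [this]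
      exact Submodule.smul_mem _ a hx
  let _ : MulAction Γ S :=
    { smul := fun g x => ⟨ρ g x, hSρ g x x.2⟩
      one_smul := fun x => Subtype.ext (by
        change ρ 1 (x : V) = x
        simp)
      mul_smul := fun g h x => Subtype.ext (by
        change ρ (g * h) (x : V) = ρ g (ρ h (x : V))
        simp) }
  have hvS : v ∈ S := hS ▸ Submodule.subset_span ⟨1, by simp⟩
  have hcard : p ∣ Nat.card S := by
    have h1 : addOrderOf (⟨v, hvS⟩ : S) = p :=
      addOrderOf_eq_prime (Subtype.ext (ZModModule.char_nsmul_eq_zero p v))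
        fun h => hv0 (congrArg Subtype.val h)
    exact h1.symm.dvd.trans (addOrderOf_dvd_natCard _)
  obtain ⟨w, hw, hw0⟩ := hΓ.exists_fixed_point_of_prime_dvd_card_of_fixed_point S hcard
    (a := (0 : S)) fun g => Subtype.ext (map_zero (ρ g))
  exact ⟨w, hSW w w.2, fun h => hw0 (Subtype.ext h.symm), fun g => congrArg Subtype.val (hw g)⟩

variable {Γ : Type*} [Group Γ] [Fintype Γ] {D : Subgroup Γ}

open Classical in
theorem sum_eq_sum_ite_centralizer (hD : IsPGroup p D) (φ : Γ → k)
    (hφ : ∀ d ∈ D, ∀ x, φ (d * x * d⁻¹) = φ x) :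
    ∑ x, φ x = ∑ x, if x ∈ Subgroup.centralizer (D : Set Γ) then φ x else 0 := by
  rw [sum_eq_sum_fixed ((MulAut.toPerm Γ).comp (MulAut.conj.comp D.subtype)) (fun d => by
    obtain ⟨n, hn⟩ := isPGroup_iff_pow_pow_eq_one.1 hD d
    exact ⟨n, by rw [hn, map_one]⟩) φ (fun d x => hφ d d.2 x)]
  refine Finset.sum_congr rfl fun x _ => ?_
  congr 1
  refine propext ?_
  rw [Subgroup.mem_centralizer_iff]
  refine ⟨fun h d hd => ?_, fun h d => ?_⟩
  · have : d * x * d⁻¹ = x := h ⟨d, hd⟩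
    rwa [mul_inv_eq_iff_eq_mul] at this
  · change (d : Γ) * x * (d : Γ)⁻¹ = x
    rw [h d d.2, mul_inv_cancel_right]

theorem coeff_mul_eq_sum (x y : MonoidAlgebra k Γ) (g : Γ) :
    (x * y).coeff g = ∑ h, x.coeff h * y.coeff (h⁻¹ * g) := by
  classical
  rw [MonoidAlgebra.coeff_mul, Finsupp.sum_fintype _ _ (by simp)]
  refine Finset.sum_congr rfl fun q _ => ?_
  rw [Finsupp.sum_fintype _ _ (by simp), Finset.sum_eq_single (q⁻¹ * g)]
  · simp
  · intro b _ hb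
    rw [if_neg]
    rintro rfl
    exact hb (by group)
  · simp

theorem mem_center_iff_coeff {x : MonoidAlgebra k Γ} :
    x ∈ Subalgebra.center k (MonoidAlgebra k Γ) ↔
      ∀ g h, x.coeff (h * g * h⁻¹) = x.coeff g := by
  constructor
  · intro hx g h
    have := congrArg (fun y => y.coeff (h * g))
      (Subalgebra.mem_center_iff.1 hx (MonoidAlgebra.single h 1))
    simpa using this.symm
  · intro hx
    refine Subalgebra.mem_center_iff.2 fun y => ?_
    induction y using MonoidAlgebra.induction_on with
    | of h =>
      ext g
      rw [MonoidAlgebra.of_apply, MonoidAlgebra.coeff_single_mul_apply,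
        MonoidAlgebra.coeff_mul_single_apply, ← hx (h⁻¹ * g) h]
      simp
    | add u v hu hv => rw [add_mul, mul_add, hu, hv]
    | smul r u hu => rw [smul_mul_assoc, mul_smul_comm, hu]

/-- A central element whose sums over the cosets of `D` vanish annihilates the left
`D`-invariants. -/
theorem mul_eq_zero_of_sum_eq_zero [D.Normal] [Fintype D] {w t : MonoidAlgebra k Γ}
    (hw : ∀ d ∈ D, ∀ x, w.coeff (d * x) = w.coeff x)
    (ht : ∀ x, ∑ d : D, t.coeff ((d : Γ)⁻¹ * x) = 0) : w * t = 0 := by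
  ext x
  rw [coeff_mul_eq_sum]
  have := Fintype.ofFinite (Γ ⧸ D)
  have hu : IsTransversal (id : Γ → Γ) ⊥ ⊤ :=
    ⟨fun _ => Subgroup.mem_top _, fun l _ => ⟨l, by simp, fun g hg => by
      exact inv_mul_eq_one.1 (Subgroup.mem_bot.1 hg)⟩⟩
  have hs : IsTransversal (fun d : D => (d : Γ)) ⊥ D :=
    ⟨fun d => d.2, fun l hl => ⟨⟨l, hl⟩, by simp, fun g hg => by
      exact Subtype.ext (inv_mul_eq_one.1 (Subgroup.mem_bot.1 hg))⟩⟩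
  have h := hu.sum_tower (isTransversal_out_top D) hs bot_le le_top
    (φ := fun h => w.coeff h * t.coeff (h⁻¹ * x)) (by
      intro g _ h hh
      rw [Subgroup.mem_bot.1 hh, mul_one])
  refine h.trans (Finset.sum_eq_zero fun q _ => ?_)
  -- As D is normal, invariance under left translation makes w constant on qD. The sum over this
  -- coset is then a multiple of a sum of t over a coset of D.
  have h1 : ∀ d : D, w.coeff (q.out * d) = w.coeff q.out := by
    intro d
    have := hw _ (Subgroup.Normal.conj_mem inferInstance (d : Γ) d.2 q.out) q.out
    rwa [inv_mul_cancel_right] at this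
  simp only [h1, ← Finset.mul_sum, mul_inv_rev, mul_assoc]
  rw [ht, mul_zero]

/-- Central idempotents are supported on the centralizer of a normal `p`-subgroup. -/
theorem mem_centralizer_of_coeff_ne_zero [D.Normal] (hD : IsPGroup p D) {f : MonoidAlgebra k Γ}
    (hf : IsIdempotentElem f) (hfc : f ∈ Subalgebra.center k (MonoidAlgebra k Γ)) {g : Γ}
    (hg : f.coeff g ≠ 0) : g ∈ Subgroup.centralizer (D : Set Γ) := by
  classical
  have hcl := mem_center_iff_coeff.1 hfc
  -- The part of f supported on the centralizer. It is central, and it is idempotent because in f *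
  -- f, at a point of the centralizer, only factors from the centralizer survive the counting modulo
  -- p.
  obtain ⟨f', hf'⟩ : ∃ f' : MonoidAlgebra k Γ, ∀ x,
      f'.coeff x = if x ∈ Subgroup.centralizer (D : Set Γ) then f.coeff x else 0 :=
    ⟨.ofCoeff (f.coeff.filter (· ∈ Subgroup.centralizer (D : Set Γ))), fun x => by
      simp [Finsupp.filter_apply]⟩
  have hCn : ∀ x h : Γ, h * x * h⁻¹ ∈ Subgroup.centralizer (D : Set Γ) ↔
      x ∈ Subgroup.centralizer (D : Set Γ) := by
    intro x h
    have : (Subgroup.centralizer (D : Set Γ)).Normal := inferInstance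
    refine ⟨fun hx => ?_, fun hx => this.conj_mem x hx h⟩
    have := this.conj_mem _ hx h⁻¹
    simpa [mul_assoc] using this
  have hfc' : f' ∈ Subalgebra.center k (MonoidAlgebra k Γ) :=
    mem_center_iff_coeff.2 fun x h => by rw [hf', hf', hcl]; exact if_congr (hCn x h) rfl rfl
  have hfi' : f' * f' = f' := by
    ext m
    rw [coeff_mul_eq_sum]
    by_cases hm : m ∈ Subgroup.centralizer (D : Set Γ)
    · have h1 : f.coeff m = ∑ h, f.coeff h * f.coeff (h⁻¹ * m) := by
        rw [← coeff_mul_eq_sum, hf.eq]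
      rw [sum_eq_sum_ite_centralizer hD] at h1
      · rw [hf', if_pos hm, h1]
        refine Finset.sum_congr rfl fun x _ => ?_
        rw [hf', hf']
        by_cases hx : x ∈ Subgroup.centralizer (D : Set Γ)
        · rw [if_pos hx, if_pos hx, if_pos (mul_mem (inv_mem hx) hm)]
        · rw [if_neg hx, if_neg hx, zero_mul]
      · intro d hd x
        rw [hcl x d]
        have h2 : (d * x * d⁻¹)⁻¹ * m = d * (x⁻¹ * m) * d⁻¹ := by
          rw [mul_assoc d (x⁻¹ * m), mul_assoc x⁻¹,
            ← Subgroup.mem_centralizer_iff.1 hm d⁻¹ (inv_mem hd)]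
          group
        rw [h2, hcl]
    · rw [hf', if_neg hm]
      refine Finset.sum_eq_zero fun x _ => ?_
      rw [hf', hf']
      by_cases hx : x ∈ Subgroup.centralizer (D : Set Γ)
      · rw [if_neg (c := x⁻¹ * m ∈ _) fun h => hm ?_, mul_zero]
        simpa using mul_mem hx h
      · rw [if_neg hx, zero_mul]
  -- The aim is t = 0. A difference of commuting idempotents satisfies t³ = t.
  obtain ⟨t, ht⟩ : ∃ t, t = f - f' := ⟨_, rfl⟩
  have htc : t ∈ Subalgebra.center k (MonoidAlgebra k Γ) := ht ▸ sub_mem hfc hfc'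
  have ht3 : t * t * t = t := by
    have key : ∀ {Z : Type _} [CommRing Z] (F F' : Z), F * F = F → F' * F' = F' →
        (F - F') * (F - F') * (F - F') = F - F' := by
      intro Z _ F F' h h'
      linear_combination (F + 1 - 3 * F') * h + (3 * F - F' - 1) * h'
    rw [ht]
    exact congrArg Subtype.val (key (Z := Subalgebra.center k (MonoidAlgebra k Γ))
      ⟨f, hfc⟩ ⟨f', hfc'⟩ (Subtype.ext hf) (Subtype.ext hfi'))
  have ht0 : ∀ x ∈ Subgroup.centralizer (D : Set Γ), t.coeff x = 0 := by
    intro x hx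
    rw [ht, MonoidAlgebra.coeff_sub, Finsupp.sub_apply, hf', if_pos hx, sub_self]
  -- A coset Dx is stable under conjugation by D, since D is normal. So the sum of the class
  -- function t over it reduces to the centralizer, where t vanishes.
  have htsum : ∀ x, ∑ d : D, t.coeff ((d : Γ)⁻¹ * x) = 0 := by
    intro x
    rw [Fintype.sum_of_injective (fun d : D => (d : Γ)⁻¹ * x)
      (fun d e h => Subtype.ext (by simpa using h)) _
      (fun y => if y * x⁻¹ ∈ D then t.coeff y else 0) (fun y hy => ?_) (fun d => ?_),
      sum_eq_sum_ite_centralizer hD]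
    · refine Finset.sum_eq_zero fun y _ => ?_
      split_ifs with h1 h2
      · exact ht0 y h1
      · rfl
      · rfl
    · intro d hd y
      rw [mem_center_iff_coeff.1 htc]
      refine if_congr ?_ rfl rfl
      have h1 : d * y * d⁻¹ * x⁻¹ = d * (y * x⁻¹) * (x * d⁻¹ * x⁻¹) := by group
      rw [h1, Subgroup.mul_mem_cancel_right _
        (Subgroup.Normal.conj_mem inferInstance _ (inv_mem hd) x),
        Subgroup.mul_mem_cancel_left _ hd]
    · refine if_neg fun h => hy ⟨⟨_, inv_mem h⟩, ?_⟩
      simp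
    · simp
  by_contra hgC
  have htne : t ≠ 0 := by
    intro h
    apply hg
    have := congrArg (fun y => y.coeff g) (ht.symm.trans h)
    simpa [hf', hgC] using this
  let _ : Module (ZMod p) (MonoidAlgebra k Γ) := AddCommGroup.zmodModule fun x => by
    rw [← Nat.cast_smul_eq_nsmul k, CharP.cast_eq_zero, zero_smul]
  let ρ : D →* AddMonoid.End (MonoidAlgebra k Γ) :=
    (Module.toAddMonoidEnd (MonoidAlgebra k Γ) (MonoidAlgebra k Γ)).toMonoidHom.comp
      ((MonoidAlgebra.of k Γ).comp D.subtype)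
  have hρ : ∀ (d : D) (v : MonoidAlgebra k Γ), ρ d v = MonoidAlgebra.single (d : Γ) 1 * v :=
    fun _ _ => rfl
  -- If t ≠ 0, the ideal generated by t contains a nonzero D-invariant w = tu. Invariance and the
  -- vanishing coset sums give wt = 0, so tu = t³u = 0, a contradiction.
  obtain ⟨w, hw, hw0, hwD⟩ := exists_fixed_vector hD ρ
    (AddMonoidHom.mulLeft t).range (by
      rintro d _ ⟨u, rfl⟩
      refine ⟨MonoidAlgebra.single (d : Γ) 1 * u, ?_⟩
      rw [AddMonoidHom.coe_mulLeft, hρ, ← mul_assoc, ← mul_assoc,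
        Subalgebra.mem_center_iff.1 htc])
    (v := t) ⟨1, by simp⟩ htne
  have hwt : w * t = 0 := mul_eq_zero_of_sum_eq_zero (fun d hd x => by
    have h1 := congrArg (fun y => y.coeff (d * x)) (hwD ⟨d, hd⟩)
    rw [hρ] at h1
    simpa using h1.symm) htsum
  obtain ⟨u, rfl⟩ := hw
  apply hw0
  rw [AddMonoidHom.coe_mulLeft] at hwt ⊢
  have h1 : t * (t * u) = 0 := by rw [← Subalgebra.mem_center_iff.1 htc, hwt]
  rw [← ht3, mul_assoc, mul_assoc, h1, mul_zero]

end FiniteGroup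

/-! ### Supports of blocks and defect groups -/

section Support

variable {p : ℕ} [Fact p.Prime] {k : Type*} [Field k] [CharP k p] {G : Type*} [Group G]
  [TopologicalSpace G] [IsTopologicalGroup G] [CompactSpace G]

/-- A central idempotent is supported on the elements that commute with a given normal pro-`p`
subgroup. -/
theorem inv_mul_conj_mem_of_coef_ne_zero {D : Subgroup G} [D.Normal] (hD : HasPPowerOrders p D)
    {f : CompletedGroupAlgebra k G} (hf : IsIdempotentElem f)
    (hfc : f ∈ Subalgebra.center k (CompletedGroupAlgebra k G)) {M : OpenNormalSubgroup G} {g : G}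
    (hg : coef k M g f ≠ 0) : ∀ d ∈ D, g⁻¹ * (d * g * d⁻¹) ∈ M.toSubgroup := by
  have hn : (D.map (QuotientGroup.mk' M.toSubgroup)).Normal :=
    Subgroup.Normal.map inferInstance _ (QuotientGroup.mk'_surjective _)
  have hp : IsPGroup p (D.map (QuotientGroup.mk' M.toSubgroup)) := by
    rw [isPGroup_iff_pow_pow_eq_one]
    rintro ⟨_, d, hd, rfl⟩
    obtain ⟨n, hn⟩ := hD M d hd
    exact ⟨n, Subtype.ext ((QuotientGroup.eq_one_iff (d ^ p ^ n)).2 hn)⟩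
  have h := mem_centralizer_of_coeff_ne_zero hp (hf.map (proj k M)) (proj_mem_center hfc M) hg
  intro d hd
  rw [← conj_mk_eq_iff, mul_inv_eq_iff_eq_mul]
  exact Subgroup.mem_centralizer_iff.1 h _ ⟨d, hd, rfl⟩

theorem HasPPowerOrders.subgroupOf [TotallyDisconnectedSpace G] {D : Subgroup G}
    (hD : HasPPowerOrders p D) (K : Subgroup G) : HasPPowerOrders p (D.subgroupOf K) := by
  intro L d hd
  obtain ⟨M, hM⟩ := exists_comapOpenNormal_le _ L
  obtain ⟨n, hn⟩ := hD M d hd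
  exact ⟨n, hM hn⟩

/-- As D is normal in its normalizer, a coset in the support of f commutes with D modulo M. A
nonzero coefficient then yields an element of the coset that commutes with D exactly. -/
theorem exists_mem_centralizer_of_coef_level_ne_zero [TotallyDisconnectedSpace G]
    {D : Subgroup G} (hDc : IsClosed (D : Set G)) (hD : HasPPowerOrders p D)
    {f : CompletedGroupAlgebra k (Subgroup.normalizer (D : Set G))} (hf : IsIdempotentElem f)
    (hfc : f ∈ Subalgebra.center k _) {M : OpenNormalSubgroup G}
    {h : Subgroup.normalizer (D : Set G)} (hne : coef k (level _ M) h f ≠ 0) :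
    ∃ z ∈ Subgroup.centralizer (D : Set G), (h : G)⁻¹ * z ∈ M.toSubgroup := by
  have hcs : CompactSpace (Subgroup.normalizer (D : Set G)) :=
    isCompact_iff_compactSpace.1 (isClosed_normalizer hDc).isCompact
  have hDn := hD.subgroupOf (Subgroup.normalizer (D : Set G))
  obtain ⟨z, hz, hzM⟩ := exists_mem_centralizer_of_coef_ne_zero hDn
    (fixedPoints_anti k le_top (mem_center_iff.1 hfc))
    (inv_mul_conj_mem_of_coef_ne_zero hDn hf hfc hne) hne
  refine ⟨z, Subgroup.mem_centralizer_iff.2 fun d hd => ?_, hzM⟩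
  exact congrArg Subtype.val
    (Subgroup.mem_centralizer_iff.1 hz ⟨d, Subgroup.le_normalizer hd⟩ hd)

/-- A criterion for a subgroup `D` with `e ∈ oTr_D` to be minimal with this property. -/
theorem isDefectGroup_of_coef_ne_zero [TotallyDisconnectedSpace G] {B : Block k G} {D : Subgroup G}
    (hDc : IsClosed (D : Set G)) (hD : HasPPowerOrders p D) (he : B.e ∈ oTr k D)
    {M : OpenNormalSubgroup G} {c : G} (hc : ∀ d ∈ D, c⁻¹ * (d * c * d⁻¹) ∈ M.toSubgroup)
    (hne : coef k M c B.e ≠ 0) : IsDefectGroup B D := by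
  classical
  refine ⟨⟨hDc, he⟩, fun H ⟨hHc, hHe⟩ hHD d hd => mem_of_forall_mem_sup hHc fun N => ?_⟩
  -- Let e be a trace from HN with H ≤ D. The coefficient at c is a sum over G/HN invariant under D,
  -- since c commutes with D modulo M. So some fixed coset gHN exists, which means g⁻¹Dg ≤ HN.
  obtain ⟨z, hz, hzt⟩ := (Submodule.mem_iInf _).1 hHe N
  have := Fintype.ofFinite (G ⧸ (H ⊔ N.toSubgroup))
  rw [← hzt, coef_trace (isTransversal_out_top (H ⊔ N.toSubgroup)) hz,
    sum_quotient_eq_sum_fixed hD (N := N) le_sup_right] at hne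
  · obtain ⟨q, -, hq⟩ := Finset.exists_ne_zero_of_sum_ne_zero hne
    have hfix : ∀ d ∈ D, d • q = q := by
      by_contra h
      exact hq (if_neg h)
    have h1 : ∀ d ∈ D, q.out⁻¹ * d * q.out ∈ H ⊔ N.toSubgroup := by
      intro d hd
      have h := hfix d hd
      rw [← Quotient.out_eq' q] at h
      have h2 : q.out⁻¹ * (d * q.out) ∈ H ⊔ N.toSubgroup := QuotientGroup.eq.1 h.symm
      rwa [← mul_assoc] at h2
    have h2 : ∀ x ∈ D ⊔ N.toSubgroup, q.out⁻¹ * x * q.out ∈ H ⊔ N.toSubgroup := by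
      intro x hx
      obtain ⟨d, hd, n, hn, rfl⟩ := Subgroup.mem_sup_of_normal_right.1 hx
      have h3 : q.out⁻¹ * (d * n) * q.out = q.out⁻¹ * d * q.out * (q.out⁻¹ * n * q.out) := by
        group
      rw [h3]
      refine mul_mem (h1 d hd) (Subgroup.mem_sup_right ?_)
      simpa using N.isNormal'.conj_mem n hn q.out⁻¹
    -- The representative conjugates DN into HN ≤ DN, hence normalizes DN. Therefore DN itself is
    -- contained in HN.
    have h3 : q.out ∈ Subgroup.normalizer ((D ⊔ N.toSubgroup : Subgroup G) : Set G) :=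
      mem_normalizer_of_conj_mem (Subgroup.isClosed_of_isOpen _ (isOpen_sup D N))
        fun x hx => sup_le_sup_right hHD _ (h2 x hx)
    have h4 := h2 _ ((Subgroup.mem_normalizer_iff.1 h3 d).1 (Subgroup.mem_sup_left hd))
    have h5 : q.out⁻¹ * (q.out * d * q.out⁻¹) * q.out = d := by group
    rwa [h5] at h4
  · intro d hd q
    have h1 : (d • q).out⁻¹ * (d * q.out) ∈ H ⊔ N.toSubgroup := by
      refine QuotientGroup.eq.1 ((Quotient.out_eq' (d • q)).trans ?_)
      conv_lhs => rw [← Quotient.out_eq' q]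
      rfl
    rw [coef_conj_sup hz M c h1]
    refine coef_congr ?_ z
    have h2 := N.isNormal'
    have h3 := M.isNormal'.conj_mem _ (inv_mem (hc d⁻¹ (inv_mem hd))) q.out⁻¹
    have h4 : ((d * q.out)⁻¹ * c * (d * q.out))⁻¹ * (q.out⁻¹ * c * q.out) =
      q.out⁻¹ * (c⁻¹ * (d⁻¹ * c * d⁻¹⁻¹))⁻¹ * q.out⁻¹⁻¹ := by group
    rw [h4]
    exact h3

/-- A substitute for Rosenberg's lemma: if ea is not nilpotent at some level, it is invertible in
the block, and e lies in the ideal of traces together with a. -/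
theorem Block.mem_traceImage_of_not_isNilpotent (B : Block k G) {H : Subgroup G}
    {a : CompletedGroupAlgebra k G} (ha : a ∈ traceImage k H ⊤)
    (hac : a ∈ Subalgebra.center k (CompletedGroupAlgebra k G)) {M : OpenNormalSubgroup G}
    (h : ¬ IsNilpotent (proj k M (B.e * a))) : B.e ∈ traceImage k H ⊤ := by
  obtain hn | ⟨b, hb, hab⟩ := B.isNilpotent_or_isUnit hac
  · exact absurd (hn M) h
  · rw [← hab, Subalgebra.mem_center_iff.1 hb, ← mul_assoc]
    exact mul_mem_traceImage
      (mem_center_iff.1 ((Subalgebra.center k _).mul_mem hb B.mem_center)) ha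

theorem mem_of_mem_sup_of_inf_le {Q D : Subgroup G} {M : OpenNormalSubgroup G} (hQD : Q ≤ D)
    (h : D ⊓ M.toSubgroup ≤ Q) {x : G} (hx : x ∈ Q ⊔ M.toSubgroup) (hxD : x ∈ D) : x ∈ Q := by
  obtain ⟨q, hq, m, hm, rfl⟩ := Subgroup.mem_sup_of_normal_right.1 hx
  exact mul_mem hq (h ⟨(Subgroup.mul_mem_cancel_left _ (hQD hq)).1 hxD, hm⟩)

theorem IsTransversal.sup {ι : Type*} {t : ι → G} {Q D : Subgroup G} {M : OpenNormalSubgroup G}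
    (ht : IsTransversal t Q D) (hQD : Q ≤ D) (h : D ⊓ M.toSubgroup ≤ Q) :
    IsTransversal t (Q ⊔ M.toSubgroup) (D ⊔ M.toSubgroup) where
  mem i := Subgroup.mem_sup_left (ht.mem i)
  existsUnique l hl := by
    obtain ⟨d, hd, m, hm, rfl⟩ := Subgroup.mem_sup_of_normal_right.1 hl
    obtain ⟨i, hi, hi'⟩ := ht.existsUnique d hd
    refine ⟨i, ?_, fun j hj => hi' j (mem_of_mem_sup_of_inf_le hQD h ?_
      (mul_mem (inv_mem (ht.mem j)) hd))⟩
    · simp only [← mul_assoc]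
      exact mul_mem (Subgroup.mem_sup_left hi) (Subgroup.mem_sup_right hm)
    · simp only [← mul_assoc] at hj
      exact (Subgroup.mul_mem_cancel_right _ (Subgroup.mem_sup_right hm)).1 hj

/-- As D ∩ M ≤ Q, representatives of D/Q also represent DM/QM, so transitivity of the trace holds
modulo M although u is fixed only by Q. -/
theorem proj_trace_sup {Q D : Subgroup G} {M : OpenNormalSubgroup G} (hQD : Q ≤ D)
    (h : D ⊓ M.toSubgroup ≤ Q) {u : CompletedGroupAlgebra k G} (hu : u ∈ fixedPoints k Q) :
    proj k M (trace k (D ⊔ M.toSubgroup) ⊤ (trace k Q D u)) =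
      proj k M (trace k (Q ⊔ M.toSubgroup) ⊤ u) := by
  have := finite_quotient_of_inf_le h
  have := Fintype.ofFinite (D ⧸ Q.subgroupOf D)
  have ht := isTransversal_out Q D
  rw [← proj_trace_trace (sup_le_sup_right hQD M.toSubgroup) le_top fun h hh =>
    proj_conj_of_mem_sup hu hh]
  refine proj_trace_congr ?_
  rw [proj_trace_eq ht fun h hh => by rw [hu h hh],
    proj_trace_eq (ht.sup hQD h) fun h hh => proj_conj_of_mem_sup hu hh]

/-- The block idempotent of a block with defect group `D` does not vanish on the centralizer of
`D`. -/
theorem exists_coef_ne_zero_of_isDefectGroup [TotallyDisconnectedSpace G] {B : Block k G}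
    {P D : Subgroup G} (hP : IsSylowSubgroup p P) (hDP : D ≤ P) {N₀ : OpenNormalSubgroup G}
    (hN₀ : N₀.toSubgroup ⊓ P ≤ D) (hB : IsDefectGroup B D) :
    ∃ M, ∃ z ∈ Subgroup.centralizer (D : Set G), coef k M z B.e ≠ 0 := by
  by_contra! hz0
  have hD : HasPPowerOrders p D := hP.isProP.hasPPowerOrders.mono hDP
  obtain ⟨M₁, hM₁⟩ : ∃ M, proj k M B.e ≠ 0 := by
    by_contra! h
    exact B.ne_zero (ext_proj fun M => by rw [h M, map_zero])
  obtain ⟨M, hM, hMN⟩ : ∃ M : OpenNormalSubgroup G, proj k M B.e ≠ 0 ∧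
      M.toSubgroup ≤ N₀.toSubgroup :=
    ⟨M₁ ⊓ N₀, fun h => hM₁ (by
      rw [← map_zero (proj k (M₁ ⊓ N₀))] at h
      rw [proj_mono (inf_le_left' M₁ N₀) h, map_zero]), inf_le_right' M₁ N₀⟩
  have heD := B.e_mem_fixedPoints D
  obtain ⟨z, hz, hze⟩ := (Submodule.mem_iInf _).1 hB.prop.2 M
  have hzD := fixedPoints_anti k le_sup_left hz
  have hezD := (fixedPoints k D).mul_mem heD hzD
  have htr : trace k (D ⊔ M.toSubgroup) ⊤ (B.e * z) = B.e := by
    rw [← mul_trace_apply _ (B.e_mem_fixedPoints ⊤), hze, B.isIdempotentElem.eq]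
  obtain ⟨y, hy⟩ := exists_restriction hD hzD
  -- The restriction of e to the centralizer is zero by assumption, so by multiplicativity that of
  -- ez is zero at level M. Hence ez is a combination of nontrivial orbit sums there.
  have hspan := proj_mem_span_orbitSums hD hezD (M := M) fun c hc => by
    rw [← coef_restriction_mul hD heD hzD (y := 0) (z := y) (M := M)
      (fun c => by rw [map_zero, hz0 M c c.2]) (hy M) ⟨c, hc⟩, zero_mul, map_zero]
  let J : Submodule k (MonoidAlgebra k (G ⧸ M.toSubgroup)) := Submodule.span k
    {t | ∃ Q : Subgroup G, Q < D ∧ D ⊓ M.toSubgroup ≤ Q ∧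
      ∃ z ∈ Subgroup.centralizer (Q : Set G),
        proj k M (trace k (Q ⊔ M.toSubgroup) ⊤ (of k z)) = t}
  have heJ : proj k M B.e ∈ J := by
    have h1 : Submodule.span k (orbitSums k D M) ≤
        (J.comap ((proj k M).toLinearMap ∘ₗ trace k (D ⊔ M.toSubgroup) ⊤)).map
          (proj k M).toLinearMap := by
      refine Submodule.span_le.2 ?_
      rintro _ ⟨Q, hQD, hQ, z, hz, rfl⟩
      exact ⟨trace k Q D (of k z), Submodule.subset_span ⟨Q, hQD, hQ, z, hz,
        (proj_trace_sup hQD.le hQ (of_mem_fixedPoints hz)).symm⟩, rfl⟩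
    obtain ⟨x, hx, hxe⟩ := h1 hspan
    have h2 := proj_trace_congr (H := D ⊔ M.toSubgroup) (L := ⊤) hxe
    rw [htr] at h2
    exact h2 ▸ hx
  have hgen : ∀ Q : Subgroup G, Q < D → D ⊓ M.toSubgroup ≤ Q →
      ∀ z ∈ Subgroup.centralizer (Q : Set G), ∃ v ∈ fixedPoints k (Q ⊔ M.toSubgroup),
        proj k M (trace k (Q ⊔ M.toSubgroup) ⊤ v) =
          proj k M (trace k (Q ⊔ M.toSubgroup) ⊤ (of k z)) := by
    intro Q hQD hQ z hz
    obtain ⟨v, hv, hvz⟩ := exists_mem_fixedPoints_sup (N := M) (fun M' hM' h =>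
      not_dvd_relIndex_sup hP (hQD.le.trans hDP)
        (fun x hx => hQ ⟨hN₀ ⟨hMN hx.1, hx.2⟩, hx.1⟩) hM'
        ((CharP.cast_eq_zero_iff k p _).1 h)) (of_mem_fixedPoints hz)
    exact ⟨v, hv, proj_trace_congr hvz⟩
  -- Otherwise e would be a trace from QM' for every small M', hence lie in oTr_Q with Q < D closed,
  -- against the minimality of D.
  have hnil : ∀ Q : Subgroup G, Q < D → D ⊓ M.toSubgroup ≤ Q →
      ∀ v ∈ fixedPoints k (Q ⊔ M.toSubgroup),
        IsNilpotent (proj k M (B.e * trace k (Q ⊔ M.toSubgroup) ⊤ v)) := by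
    intro Q hQD hQ v hv
    by_contra hn
    have hQc : IsClosed (Q : Set G) := by
      have h1 : Q = (Q ⊔ M.toSubgroup) ⊓ D := le_antisymm (le_inf le_sup_left hQD.le)
        fun x hx => mem_of_mem_sup_of_inf_le hQD.le hQ hx.1 hx.2
      rw [h1]
      exact (Subgroup.isClosed_of_isOpen _ (isOpen_sup Q M)).inter hB.prop.1
    refine hQD.not_ge (hB.2 ⟨hQc, mem_oTr_of_forall_le M fun M' hM' => ?_⟩ hQD.le)
    have hac := mem_center_iff.2 (trace_mem_fixedPoints (L := ⊤) hv)
    refine B.mem_traceImage_of_not_isNilpotent ?_ hac hn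
    have hr : ((Q ⊔ M'.toSubgroup).relIndex (Q ⊔ M.toSubgroup) : k) ≠ 0 := fun h =>
      not_dvd_relIndex_sup hP (hQD.le.trans hDP)
        (fun x hx => hQ ⟨hN₀ ⟨hMN hx.1, hx.2⟩, hx.1⟩) hM'
        ((CharP.cast_eq_zero_iff k p _).1 h)
    have hle := sup_le_sup_left hM' Q
    -- As v is fixed by QM, its trace from the smaller QM' is the trace from QM times |QM : QM'|,
    -- which is invertible in k.
    have h1 : trace k (Q ⊔ M'.toSubgroup) ⊤ v =
        ((Q ⊔ M'.toSubgroup).relIndex (Q ⊔ M.toSubgroup) : k) •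
          trace k (Q ⊔ M.toSubgroup) ⊤ v := by
      refine ext_proj fun L => ?_
      rw [map_smul, Nat.cast_smul_eq_nsmul, proj_trace_eq_relIndex_smul hle le_top
        fun h hh => by rw [hv h hh]]
    rw [← inv_smul_smul₀ hr (trace k (Q ⊔ M.toSubgroup) ⊤ v), ← h1]
    exact Submodule.smul_mem _ _ ⟨v, fixedPoints_anti k hle hv, rfl⟩
  -- The generators of J are central and become nilpotent in the block. Sums of commuting nilpotents
  -- are nilpotent, so e itself would be nilpotent modulo M.
  have hJ : ∀ t ∈ J, t ∈ Subalgebra.center k _ ∧ IsNilpotent (proj k M B.e * t) := by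
    intro t ht
    induction ht using Submodule.span_induction with
    | mem t ht =>
      obtain ⟨Q, hQD, hQ, z, hz, rfl⟩ := ht
      obtain ⟨v, hv, hvz⟩ := hgen Q hQD hQ z hz
      rw [← hvz, ← map_mul]
      exact ⟨proj_mem_center (mem_center_iff.2 (trace_mem_fixedPoints (L := ⊤) hv)) M,
        hnil Q hQD hQ v hv⟩
    | zero => exact ⟨zero_mem _, by rw [mul_zero]; exact IsNilpotent.zero⟩
    | add x y _ _ hx hy =>
      refine ⟨add_mem hx.1 hy.1, ?_⟩
      rw [mul_add]
      refine Commute.isNilpotent_add ?_ hx.2 hy.2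
      exact (Subalgebra.mem_center_iff.1
        ((Subalgebra.center k _).mul_mem (proj_mem_center B.mem_center M) hy.1) _)
    | smul r x _ hx =>
      refine ⟨(Subalgebra.center k _).smul_mem hx.1 r, ?_⟩
      rw [mul_smul_comm]
      exact hx.2.smul r
  obtain ⟨n, hn⟩ := (hJ _ heJ).2
  have hid := B.isIdempotentElem.map (proj k M)
  rw [hid.eq] at hn
  rcases n with _ | n
  · simp at hn
  · exact hM (by rwa [hid.pow_succ_eq] at hn)

end Support

/-! ### Existence of blocks -/

section Existence

variable {k : Type*} [Field k] {G : Type*} [Group G] [TopologicalSpace G]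

theorem mem_fixedPoints_of_mem_center {x : CompletedGroupAlgebra k G}
    (hx : x ∈ Subalgebra.center k (CompletedGroupAlgebra k G)) (D : Subgroup G) :
    x ∈ fixedPoints k D :=
  fixedPoints_anti k le_top (mem_center_iff.1 hx)

theorem Block.mul_eq_zero_or_eq (B : Block k G) {z : CompletedGroupAlgebra k G}
    (hz : z ∈ Subalgebra.center k (CompletedGroupAlgebra k G)) (hzi : IsIdempotentElem z) :
    B.e * z = 0 ∨ B.e * z = B.e := by
  have hc : B.e * z = z * B.e := (Subalgebra.mem_center_iff.1 hz _)
  have hzz : B.e * z * (B.e * z) = B.e * z := by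
    rw [hc, mul_assoc, ← mul_assoc B.e, hc, mul_assoc, B.isIdempotentElem.eq, ← mul_assoc, hzi.eq]
  have h1 : B.e * (B.e * z) = B.e * z := by rw [← mul_assoc, B.isIdempotentElem.eq]
  have h2 : B.e * z * B.e = B.e * z := by rw [mul_assoc, ← hc, h1]
  obtain h | h := B.primitive (B.e * z) ((Subalgebra.center k _).mul_mem B.mem_center hz)
    (B.e - B.e * z) (sub_mem B.mem_center ((Subalgebra.center k _).mul_mem B.mem_center hz))
    hzz (by rw [IsIdempotentElem, mul_sub, sub_mul, sub_mul, B.isIdempotentElem.eq, h1, h2, hzz,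
      sub_self, sub_zero]) (by rw [mul_sub, hzz, h2, sub_self]) (by rw [add_sub_cancel])
  · exact Or.inl h
  · exact Or.inr (sub_eq_zero.1 h).symm

theorem Block.eq_of_mul_ne_zero {B B' : Block k G} (h : B.e * B'.e ≠ 0) : B = B' := by
  have h1 := (B.mul_eq_zero_or_eq B'.mem_center B'.isIdempotentElem).resolve_left h
  have hc : B.e * B'.e = B'.e * B.e := Subalgebra.mem_center_iff.1 B'.mem_center _
  have h2 := (B'.mul_eq_zero_or_eq B.mem_center B.isIdempotentElem).resolve_left (hc ▸ h)
  exact Block.ext (by rw [← h1, hc, h2])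

variable [IsTopologicalGroup G] [CompactSpace G]

/-- A multiplicatively closed set of central idempotents contains a block idempotent if it is
closed in a suitable sense and prime. -/
theorem exists_block_of_isPrime {S : Set (CompletedGroupAlgebra k G)} (hne : S.Nonempty)
    (hc : ∀ s ∈ S, s ∈ Subalgebra.center k (CompletedGroupAlgebra k G))
    (hi : ∀ s ∈ S, IsIdempotentElem s) (hm : ∀ s ∈ S, ∀ t ∈ S, s * t ∈ S)
    (hcl : ∀ z ∈ Subalgebra.center k (CompletedGroupAlgebra k G), IsIdempotentElem z →
      (∀ M, ∃ s ∈ S, proj k M s = proj k M z) → (∀ s ∈ S, z * s = z) → z ∈ S)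
    (h0 : 0 ∉ S)
    (hp : ∀ e₁ ∈ Subalgebra.center k (CompletedGroupAlgebra k G),
      ∀ e₂ ∈ Subalgebra.center k (CompletedGroupAlgebra k G),
      IsIdempotentElem e₁ → IsIdempotentElem e₂ → e₁ * e₂ = 0 → e₁ + e₂ ∈ S → e₁ ∈ S ∨ e₂ ∈ S) :
    ∃ B : Block k G, B.e ∈ S ∧ ∀ s ∈ S, B.e * s = B.e := by
  obtain ⟨z, hz, hzi, hzp, hzs⟩ := exists_inf_idempotents hne hc hi hm
  have hzS := hcl z hz hzi hzp hzs
  refine ⟨⟨z, hz, hzi, fun h => h0 (h ▸ hzS), fun e₁ h₁ e₂ h₂ hi₁ hi₂ h12 hze => ?_⟩, hzS, hzs⟩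
  have h21 : e₂ * e₁ = 0 := by rw [Subalgebra.mem_center_iff.1 h₁, h12]
  obtain h | h := hp e₁ h₁ e₂ h₂ hi₁ hi₂ h12 (hze ▸ hzS)
  · right
    have := hzs _ h
    rw [hze, add_mul, hi₁.eq, h21, add_zero] at this
    exact left_eq_add.1 this
  · left
    have := hzs _ h
    rw [hze, add_mul, hi₂.eq, h12, zero_add] at this
    exact right_eq_add.1 this

/-- Below every nonzero central idempotent there is a block idempotent. -/
theorem exists_block_mul_eq {u : CompletedGroupAlgebra k G}
    (hu : u ∈ Subalgebra.center k (CompletedGroupAlgebra k G)) (hui : IsIdempotentElem u)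
    (hu0 : u ≠ 0) : ∃ B : Block k G, B.e * u = B.e := by
  obtain ⟨L, hL⟩ : ∃ L, proj k L u ≠ 0 := by
    by_contra! h
    exact hu0 (ext_proj fun M => by rw [h M, map_zero])
  -- At a level L where u survives, take an idempotent s below u whose nonzero image generates a
  -- minimal right ideal. Any idempotent below u dividing s modulo L then agrees with 0 or s there.
  let T : Set (CompletedGroupAlgebra k G) := {s | s ∈ Subalgebra.center k _ ∧
    IsIdempotentElem s ∧ s * u = s ∧ proj k L s ≠ 0}
  let r : CompletedGroupAlgebra k G → Submodule k (MonoidAlgebra k (G ⧸ L.toSubgroup)) :=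
    fun s => LinearMap.range (LinearMap.mulLeft k (proj k L s))
  obtain ⟨_, ⟨s, ⟨hs, hsi, hsu, hs0⟩, rfl⟩, hmin⟩ :=
    (wellFounded_lt (α := Submodule k (MonoidAlgebra k (G ⧸ L.toSubgroup)))).has_min (r '' T)
      ⟨_, u, ⟨hu, hui, hui, hL⟩, rfl⟩
  have hlt : ∀ e ∈ Subalgebra.center k (CompletedGroupAlgebra k G), IsIdempotentElem e →
      proj k L (e * s) = proj k L e → e * u = e → proj k L e ≠ 0 → proj k L e = proj k L s := by
    intro e he hei hes heu he0
    by_contra hne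
    refine hmin _ ⟨e, ⟨he, hei, heu, he0⟩, rfl⟩ (lt_of_le_of_ne ?_ fun h => hne ?_)
    · rintro _ ⟨x, rfl⟩
      refine ⟨proj k L e * x, ?_⟩
      rw [LinearMap.mulLeft_apply, LinearMap.mulLeft_apply, ← mul_assoc, ← map_mul,
        Subalgebra.mem_center_iff.1 he, hes]
    · have h1 : proj k L s ∈ r e := h ▸ ⟨1, by simp⟩
      obtain ⟨x, hx⟩ := h1
      rw [LinearMap.mulLeft_apply] at hx
      rw [← hes, map_mul, ← hx, ← mul_assoc, ← map_mul, hei.eq]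
  -- The idempotents below u that agree with s modulo L. If a sum of two orthogonal ones lies in S,
  -- minimality at level L puts one of the summands in S.
  let S : Set (CompletedGroupAlgebra k G) := {t | t ∈ Subalgebra.center k _ ∧
    IsIdempotentElem t ∧ t * u = t ∧ proj k L t = proj k L s}
  suffices h : ∃ B : Block k G, B.e ∈ S ∧ ∀ s ∈ S, B.e * s = B.e by
    obtain ⟨B, hB, -⟩ := h
    exact ⟨B, hB.2.2.1⟩
  refine exists_block_of_isPrime ⟨s, hs, hsi, hsu, rfl⟩ (fun t ht => ht.1) (fun t ht => ht.2.1)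
    (fun t ht t' ht' => ⟨(Subalgebra.center k _).mul_mem ht.1 ht'.1,
      ht.2.1.mul_of_commute (Subalgebra.mem_center_iff.1 ht'.1 _) ht'.2.1,
      by rw [mul_assoc, ht'.2.2.1], by
        rw [map_mul, ht.2.2.2, ht'.2.2.2, ← map_mul, hsi.eq]⟩)
    (fun z hz hzi hzp hzs => ?_) (fun h => hs0 ?_) fun e₁ h₁ e₂ h₂ hi₁ hi₂ h12 h => ?_
  · obtain ⟨t, ht, htz⟩ := hzp L
    refine ⟨hz, hzi, ?_, htz ▸ ht.2.2.2⟩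
    have h1 := hzs s ⟨hs, hsi, hsu, rfl⟩
    rw [← h1, mul_assoc, hsu]
  · rw [← h.2.2.2, map_zero]
  · have h21 : e₂ * e₁ = 0 := by rw [Subalgebra.mem_center_iff.1 h₁, h12]
    have hu1 : e₁ * u = e₁ := by
      have h3 : e₁ * ((e₁ + e₂) * u) = e₁ * (e₁ + e₂) := by rw [h.2.2.1]
      rwa [← mul_assoc, mul_add, hi₁.eq, h12, add_zero] at h3
    have hu2 : e₂ * u = e₂ := by
      have h3 : e₂ * ((e₁ + e₂) * u) = e₂ * (e₁ + e₂) := by rw [h.2.2.1]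
      rwa [← mul_assoc, mul_add, hi₂.eq, h21, zero_add] at h3
    by_cases h0 : proj k L e₁ = 0
    · refine Or.inr ⟨h₂, hi₂, hu2, ?_⟩
      rw [← h.2.2.2, map_add, h0, zero_add]
    · refine Or.inl ⟨h₁, hi₁, hu1, hlt e₁ h₁ hi₁ ?_ hu1 h0⟩
      rw [map_mul, ← h.2.2.2, ← map_mul, mul_add, hi₁.eq, h12, add_zero]

end Existence

/-! ### The Brauer correspondence -/

section Correspondence

variable {p : ℕ} [Fact p.Prime] {k : Type*} [Field k] [CharP k p] {G : Type*} [Group G]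
  [TopologicalSpace G] [IsTopologicalGroup G] [CompactSpace G] [TotallyDisconnectedSpace G]

theorem exists_level_proj_ne_zero {K : Subgroup G} {x : CompletedGroupAlgebra k K} (hx : x ≠ 0) :
    ∃ M : OpenNormalSubgroup G, ∀ N : OpenNormalSubgroup G, N.toSubgroup ≤ M.toSubgroup →
      proj k (level K N) x ≠ 0 := by
  by_contra! h
  refine hx (ext_proj fun L => ?_)
  obtain ⟨M, hM⟩ := exists_comapOpenNormal_le K L
  obtain ⟨N, hN, hN0⟩ := h M
  rw [← map_zero (proj k (level K N))] at hN0
  exact proj_mono (fun _ hx => hM (hN hx)) hN0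

variable {D : Subgroup G}
  {σ : fixedPoints k D →ₐ[k] CompletedGroupAlgebra k (Subgroup.normalizer (D : Set G))}

/-- Since σ carries traces to traces, σ(e) is a trace from arbitrarily small overgroups of D. So is
f = fσ(e), because traces to the whole group absorb central factors. -/
theorem IsNormalizerMap.mem_oTr_subgroupOf (hσ : IsNormalizerMap k σ) (hDc : IsClosed (D : Set G))
    (hD : HasPPowerOrders p D) {N₀ : OpenNormalSubgroup G}
    (hN₀ : ∀ N M : OpenNormalSubgroup G, N.toSubgroup ≤ N₀.toSubgroup →
      M.toSubgroup ≤ N.toSubgroup → ¬ p ∣ (D ⊔ M.toSubgroup).relIndex (D ⊔ N.toSubgroup))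
    {e : fixedPoints k D} (he : (e : CompletedGroupAlgebra k G) ∈ oTr k D)
    {f : CompletedGroupAlgebra k (Subgroup.normalizer (D : Set G))}
    (hf : f ∈ Subalgebra.center k _) (hfe : f = f * σ e) :
    f ∈ oTr k (D.subgroupOf (Subgroup.normalizer (D : Set G))) := by
  have hcs : CompactSpace (Subgroup.normalizer (D : Set G)) :=
    isCompact_iff_compactSpace.1 (isClosed_normalizer hDc).isCompact
  refine (Submodule.mem_iInf _).2 fun L => ?_
  obtain ⟨M, hM⟩ := exists_comapOpenNormal_le _ L
  obtain ⟨z, hz, hze⟩ := (Submodule.mem_iInf _).1 he (M ⊓ N₀)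
  have h1 := trace_level_eq hσ hDc hD (fun M' => hN₀ (M ⊓ N₀) M' (inf_le_right' M N₀)) hz
  have h2 : (⟨trace k (D ⊔ (M ⊓ N₀).toSubgroup) ⊤ z,
      fixedPoints_anti k le_top (trace_mem_fixedPoints hz)⟩ : fixedPoints k D) = e :=
    Subtype.ext hze
  rw [h2] at h1
  have h3 := mul_mem_traceImage (mem_center_iff.1 hf) h1
  rw [← hfe] at h3
  exact traceImage_sup_mono _ (fun _ hx => hM (inf_le_left' M N₀ hx)) h3

/-- The idempotent of a block of `N_G(D)` with defect group `D` lifts modulo `N`, inside the Brauer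
correspondent, to an invertible trace. -/
theorem IsNormalizerMap.exists_trace_lift (hσ : IsNormalizerMap k σ) (hDc : IsClosed (D : Set G))
    (hD : HasPPowerOrders p D) {b : Block k (Subgroup.normalizer (D : Set G))} {B : Block k G}
    (hbB : b.e = b.e * σ ⟨B.e, B.e_mem_fixedPoints D⟩)
    (hb : b.e ∈ oTr k (D.subgroupOf (Subgroup.normalizer (D : Set G))))
    {N : OpenNormalSubgroup G}
    (hN : ∀ M : OpenNormalSubgroup G, M.toSubgroup ≤ N.toSubgroup →
      ¬ p ∣ (D ⊔ M.toSubgroup).relIndex (D ⊔ N.toSubgroup))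
    (hbN : proj k (level _ N) b.e ≠ 0) :
    B.e ∈ traceImage k (D ⊔ N.toSubgroup) ⊤ ∧ ∃ x y : fixedPoints k D,
      ⟨B.e, B.e_mem_fixedPoints D⟩ * x * y = (⟨B.e, B.e_mem_fixedPoints D⟩ : fixedPoints k D) ∧
      proj k (level _ N) (σ x) = proj k (level _ N) b.e := by
  have hcs : CompactSpace (Subgroup.normalizer (D : Set G)) :=
    isCompact_iff_compactSpace.1 (isClosed_normalizer hDc).isCompact
  obtain ⟨x, hx, hxc, hxb⟩ := exists_mem_traceImage_proj_eq hσ hDc hD hN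
    ((Submodule.mem_iInf _).1 hb (level _ N)) (fun h hh => by
      by_contra hne
      obtain ⟨z, hz, hzN⟩ := exists_mem_centralizer_of_coef_level_ne_zero hDc hD
        b.isIdempotentElem b.mem_center hne
      exact hh z hz hzN)
  have hxc' := mem_center_iff.2 hxc
  have hn : ¬ IsNilpotent (proj k N (B.e * x)) := by
    rintro ⟨n, hn⟩
    have h1 : proj k N (((⟨B.e, B.e_mem_fixedPoints D⟩ * x : fixedPoints k D) ^ n :
        fixedPoints k D) : CompletedGroupAlgebra k G) = proj k N ((0 : fixedPoints k D) :) := by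
      change proj k N ((B.e * x) ^ n) = proj k N 0
      rw [map_pow, hn, map_zero]
    have h2 := hσ.proj_congr h1
    rw [map_zero, map_zero, map_pow, map_mul] at h2
    apply hbN
    -- Modulo N, f absorbs σ(e), and σ(x) is f. Nilpotency of ex modulo N would therefore kill f at
    -- that level.
    have h3 : ∀ m : ℕ, proj k (level _ N) b.e *
        proj k (level _ N) ((σ ⟨B.e, B.e_mem_fixedPoints D⟩ * σ x) ^ m) =
          proj k (level _ N) b.e := by
      intro m
      induction m with
      | zero => rw [pow_zero, map_one, mul_one]
      | succ m ih =>
        rw [pow_succ, map_mul, ← mul_assoc, ih, map_mul, ← mul_assoc, ← map_mul, ← hbB, hxb,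
          ← map_mul, b.isIdempotentElem.eq]
    rw [← h3 n, h2, mul_zero]
  refine ⟨B.mem_traceImage_of_not_isNilpotent hx hxc' hn, ?_⟩
  obtain h | ⟨y, hy, hxy⟩ := B.isNilpotent_or_isUnit hxc'
  · exact absurd (h N) hn
  · exact ⟨x, ⟨y, mem_fixedPoints_of_mem_center hy D⟩, Subtype.ext hxy, hxb⟩

/-- Every block of `N_G(D)` lies below exactly one block of `G`. -/
theorem IsNormalizerMap.existsUnique_block (hσ : IsNormalizerMap k σ)
    (b : Block k (Subgroup.normalizer (D : Set G))) :
    ∃! B : Block k G, b.e = b.e * σ ⟨B.e, B.e_mem_fixedPoints D⟩ := by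
  -- The idempotents whose Brauer image acts as the identity on f. This condition is tested level by
  -- level, so it passes to the infimum of S, which is the wanted block idempotent.
  let S : Set (CompletedGroupAlgebra k G) := {s | s ∈ Subalgebra.center k _ ∧
    IsIdempotentElem s ∧ ∃ u : fixedPoints k D, (u : CompletedGroupAlgebra k G) = s ∧
      b.e = b.e * σ u}
  have hS : ∃ B : Block k G, B.e ∈ S ∧ ∀ s ∈ S, B.e * s = B.e := by
    refine exists_block_of_isPrime ⟨1, one_mem _, IsIdempotentElem.one, 1, rfl, by
      rw [map_one, mul_one]⟩ (fun s hs => hs.1) (fun s hs => hs.2.1)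
      (fun s ⟨hs, hsi, u, hu, hbu⟩ t ⟨ht, hti, v, hv, hbv⟩ =>
        ⟨(Subalgebra.center k _).mul_mem hs ht,
          hsi.mul_of_commute (Subalgebra.mem_center_iff.1 ht _) hti, u * v, by
            rw [← hu, ← hv]; rfl, by rw [map_mul, ← mul_assoc, ← hbu, ← hbv]⟩)
      (fun z hz hzi hzp _ => ⟨hz, hzi, ⟨z, mem_fixedPoints_of_mem_center hz D⟩, rfl,
        ext_coef_comap fun M => proj_eq_iff_coef.1 ?_⟩)
      (fun ⟨_, _, u, hu, hbu⟩ => b.ne_zero ?_) fun e₁ h₁ e₂ h₂ hi₁ hi₂ h12 h => ?_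
    · obtain ⟨_, ⟨-, -, u, rfl, hbu⟩, huz⟩ := hzp M
      have h1 := hσ.proj_congr (v := ⟨z, mem_fixedPoints_of_mem_center hz D⟩) huz
      change proj k (level _ M) b.e = proj k (level _ M) _
      rw [map_mul, ← h1, ← map_mul, ← hbu]
    · have hu0 : u = 0 := Subtype.ext hu
      rw [hbu, hu0, map_zero, mul_zero]
    -- Primality of S comes from primitivity of f: the central idempotent σ(e₁) is either killed by
    -- f or acts on f as the identity.
    · obtain ⟨-, -, u, hu, hbu⟩ := h
      have hu12 : u = ⟨e₁, mem_fixedPoints_of_mem_center h₁ D⟩ +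
        ⟨e₂, mem_fixedPoints_of_mem_center h₂ D⟩ := Subtype.ext hu
      rw [hu12, map_add, mul_add] at hbu
      obtain h | h := b.mul_eq_zero_or_eq
        (hσ.mem_center ⟨e₁, mem_fixedPoints_of_mem_center h₁ D⟩ h₁)
        (IsIdempotentElem.map (Subtype.ext hi₁ : IsIdempotentElem
          (⟨e₁, mem_fixedPoints_of_mem_center h₁ D⟩ : fixedPoints k D)) σ)
      · rw [h, zero_add] at hbu
        exact Or.inr ⟨h₂, hi₂, _, rfl, hbu⟩
      · exact Or.inl ⟨h₁, hi₁, _, rfl, h.symm⟩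
  obtain ⟨B, hB, hBS⟩ := hS
  obtain ⟨-, -, u, hu, hbu⟩ := hB
  have hu' : u = ⟨B.e, B.e_mem_fixedPoints D⟩ := Subtype.ext hu
  rw [hu'] at hbu
  refine ⟨B, hbu, fun B' hB' => Block.eq_of_mul_ne_zero ?_⟩
  have h1 : B'.e ∈ S := ⟨B'.mem_center, B'.isIdempotentElem, _, rfl, hB'⟩
  rw [← Subalgebra.mem_center_iff.1 B'.mem_center, hBS _ h1]
  exact B.ne_zero

end Correspondence

/-! ### Defect groups, injectivity and surjectivity for the Brauer correspondence. -/

section MainTheorem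

variable {p : ℕ} [Fact p.Prime] {k : Type*} [Field k] [CharP k p] {G : Type*} [Group G]
  [TopologicalSpace G] [IsTopologicalGroup G] [CompactSpace G] [TotallyDisconnectedSpace G]
  {D : Subgroup G}
  {σ : fixedPoints k D →ₐ[k] CompletedGroupAlgebra k (Subgroup.normalizer (D : Set G))}

/-- A block of `G` above a block of `N_G(D)` with defect group `D` has defect group `D`. -/
theorem IsNormalizerMap.isDefectGroup (hσ : IsNormalizerMap k σ) (hDc : IsClosed (D : Set G))
    (hD : HasPPowerOrders p D) {N₀ : OpenNormalSubgroup G}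
    (hN₀ : ∀ N M : OpenNormalSubgroup G, N.toSubgroup ≤ N₀.toSubgroup →
      M.toSubgroup ≤ N.toSubgroup → ¬ p ∣ (D ⊔ M.toSubgroup).relIndex (D ⊔ N.toSubgroup))
    {b : Block k (Subgroup.normalizer (D : Set G))} {B : Block k G}
    (hbB : b.e = b.e * σ ⟨B.e, B.e_mem_fixedPoints D⟩)
    (hb : b.e ∈ oTr k (D.subgroupOf (Subgroup.normalizer (D : Set G)))) : IsDefectGroup B D := by
  obtain ⟨M₀, hM₀⟩ := exists_level_proj_ne_zero b.ne_zero
  have he : B.e ∈ oTr k D := mem_oTr_of_forall_le (M₀ ⊓ N₀) fun N hN =>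
    (hσ.exists_trace_lift hDc hD hbB hb (fun M => hN₀ N M (hN.trans (inf_le_right' M₀ N₀)))
      (hM₀ N (hN.trans (inf_le_left' M₀ N₀)))).1
  have hσ0 : σ ⟨B.e, B.e_mem_fixedPoints D⟩ ≠ 0 := fun h => b.ne_zero (by rw [hbB, h, mul_zero])
  obtain ⟨M, h, hh⟩ : ∃ M h, coef k (level _ M) h (σ ⟨B.e, B.e_mem_fixedPoints D⟩) ≠ 0 := by
    by_contra! h
    exact hσ0 (ext_coef_comap fun M g => by rw [h M g, map_zero])
  obtain ⟨z, hz, hhz⟩ : ∃ z ∈ Subgroup.centralizer (D : Set G), (h : G)⁻¹ * z ∈ M.toSubgroup := by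
    by_contra! hn
    exact hh (hσ.coef_eq_zero _ M h hn)
  rw [hσ.coef_eq_of_mem _ M h hz hhz] at hh
  refine isDefectGroup_of_coef_ne_zero hDc hD he (fun d hd => ?_) hh
  rw [Subgroup.mem_centralizer_iff.1 hz d hd, mul_inv_cancel_right, inv_mul_cancel]
  exact one_mem _

/-- At most one block of `N_G(D)` with defect group `D` lies below a given block of `G`. -/
theorem IsNormalizerMap.block_unique (hσ : IsNormalizerMap k σ) (hDc : IsClosed (D : Set G))
    (hD : HasPPowerOrders p D) {N₀ : OpenNormalSubgroup G}
    (hN₀ : ∀ N M : OpenNormalSubgroup G, N.toSubgroup ≤ N₀.toSubgroup →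
      M.toSubgroup ≤ N.toSubgroup → ¬ p ∣ (D ⊔ M.toSubgroup).relIndex (D ⊔ N.toSubgroup))
    {b b' : Block k (Subgroup.normalizer (D : Set G))} {B : Block k G}
    (hbB : b.e = b.e * σ ⟨B.e, B.e_mem_fixedPoints D⟩)
    (hbB' : b'.e = b'.e * σ ⟨B.e, B.e_mem_fixedPoints D⟩)
    (hb : b.e ∈ oTr k (D.subgroupOf (Subgroup.normalizer (D : Set G)))) : b = b' := by
  obtain ⟨M₁, hM₁⟩ := exists_level_proj_ne_zero b.ne_zero
  obtain ⟨M₂, hM₂⟩ := exists_level_proj_ne_zero b'.ne_zero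
  obtain ⟨N, hN₁, hN₂, hN⟩ : ∃ N : OpenNormalSubgroup G, N.toSubgroup ≤ M₁.toSubgroup ∧
      N.toSubgroup ≤ M₂.toSubgroup ∧ N.toSubgroup ≤ N₀.toSubgroup :=
    ⟨M₁ ⊓ M₂ ⊓ N₀, fun _ hx => hx.1.1, fun _ hx => hx.1.2, fun _ hx => hx.2⟩
  obtain ⟨-, x, y, hxy, hxb⟩ := hσ.exists_trace_lift hDc hD hbB hb (fun M => hN₀ N M hN)
    (hM₁ N hN₁)
  refine (Block.eq_of_mul_ne_zero fun h => hM₂ N hN₂ ?_).symm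
  -- Since x is invertible in the block of e, the idempotent of b' is a multiple of σ(x), which
  -- modulo N is the idempotent of b. If the two were orthogonal, that of b' would vanish modulo N.
  have hxy' : b'.e = b'.e * σ x * σ y := by
    conv_lhs => rw [hbB', ← hxy, map_mul, map_mul, ← mul_assoc, ← mul_assoc, ← hbB']
  rw [hxy', map_mul, map_mul, hxb, ← map_mul, h, map_zero, zero_mul]

/-- Every block of `G` with defect group `D` lies above a block of `N_G(D)` with defect
group `D`. -/
theorem IsNormalizerMap.exists_block (hσ : IsNormalizerMap k σ) (hDc : IsClosed (D : Set G))
    {P : Subgroup G} (hP : IsSylowSubgroup p P) (hDP : D ≤ P) {N₀ : OpenNormalSubgroup G}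
    (hN₀ : N₀.toSubgroup ⊓ P ≤ D) {B : Block k G} (hB : IsDefectGroup B D) :
    ∃ b : Block k (Subgroup.normalizer (D : Set G)),
      IsDefectGroup b (D.subgroupOf (Subgroup.normalizer (D : Set G))) ∧
        b.e = b.e * σ ⟨B.e, B.e_mem_fixedPoints D⟩ := by
  have hcs : CompactSpace (Subgroup.normalizer (D : Set G)) :=
    isCompact_iff_compactSpace.1 (isClosed_normalizer hDc).isCompact
  have hD : HasPPowerOrders p D := hP.isProP.hasPPowerOrders.mono hDP
  -- The defect group condition makes σ(e) nonzero, so there is a block idempotent of the normalizer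
  -- below it.
  obtain ⟨M, z, hz, hne⟩ := exists_coef_ne_zero_of_isDefectGroup hP hDP hN₀ hB
  have hσ0 : σ ⟨B.e, B.e_mem_fixedPoints D⟩ ≠ 0 := fun h => hne (by
    rw [← hσ.coef_eq ⟨B.e, B.e_mem_fixedPoints D⟩ M ⟨z, centralizer_le hz⟩ hz, h, map_zero])
  obtain ⟨b, hb⟩ := exists_block_mul_eq (hσ.mem_center ⟨B.e, B.e_mem_fixedPoints D⟩ B.mem_center)
    (IsIdempotentElem.map (Subtype.ext B.isIdempotentElem : IsIdempotentElem
      (⟨B.e, B.e_mem_fixedPoints D⟩ : fixedPoints k D)) σ) hσ0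
  refine ⟨b, ?_, hb.symm⟩
  have hDn := hD.subgroupOf (Subgroup.normalizer (D : Set G))
  obtain ⟨L, h, hh⟩ : ∃ L h, coef k L h b.e ≠ 0 := by
    by_contra! h
    exact b.ne_zero (ext_coef fun M g => by rw [h M g, map_zero])
  exact isDefectGroup_of_coef_ne_zero (hDc.preimage continuous_subtype_val) hDn
    (hσ.mem_oTr_subgroupOf hDc hD (fun N M hN hMN => not_dvd_relIndex_sup hP hDP
      (le_trans (inf_le_inf_right P hN) hN₀) hMN) hB.prop.2 b.mem_center hb.symm)
    (inv_mul_conj_mem_of_coef_ne_zero hDn b.isIdempotentElem b.mem_center hh) hh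

end MainTheorem

end ProfiniteBlocks

end

/-- The final equivalence quantifies over all blocks of G, so uniqueness of the correspondent is not
limited to blocks with defect group D. -/
theorem mainTheorem1 {p : ℕ} [Fact p.Prime] {k : Type*} [Field k] [CharP k p]
    {G : Type*} [Group G] [TopologicalSpace G] [IsTopologicalGroup G] [CompactSpace G]
    [TotallyDisconnectedSpace G] (P D : Subgroup G) (hP : ProfiniteBlocks.IsSylowSubgroup p P)
    (hDP : D ≤ P) (hD : IsOpen (D.subgroupOf P : Set P)) :
    ∃ Φ : ProfiniteBlocks.BlocksWithDefectGroup k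
          (D.subgroupOf (Subgroup.normalizer (D : Set G))) →
        ProfiniteBlocks.BlocksWithDefectGroup k D,
      Function.Bijective Φ ∧
        ∀ (b : ProfiniteBlocks.BlocksWithDefectGroup k
            (D.subgroupOf (Subgroup.normalizer (D : Set G)))) (B : ProfiniteBlocks.Block k G),
          ProfiniteBlocks.IsBrauerCorrespondent D b.1 B ↔ B = (Φ b).1 := by
  have hDc : IsClosed (D : Set G) := by
    have h : IsClosed (D.subgroupOf P : Set P) := Subgroup.isClosed_of_isOpen _ hD
    convert hP.isClosed.isClosedEmbedding_subtypeVal.isClosedMap _ h using 1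
    ext x
    exact ⟨fun hx => ⟨⟨x, hDP hx⟩, hx, rfl⟩, by rintro ⟨y, hy, rfl⟩; exact hy⟩
  -- Openness of D in P provides the level below which all indices |DN : DM| are prime to p.
  obtain ⟨N₀, hPN⟩ := ProfiniteBlocks.exists_inf_le_of_isOpen hD
  have hN₀ : N₀.toSubgroup ⊓ P ≤ D := inf_comm P N₀.toSubgroup ▸ hPN
  have hDp : ProfiniteBlocks.HasPPowerOrders p D := hP.isProP.hasPPowerOrders.mono hDP
  have hN : ∀ N M : OpenNormalSubgroup G, N.toSubgroup ≤ N₀.toSubgroup →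
      M.toSubgroup ≤ N.toSubgroup → ¬ p ∣ (D ⊔ M.toSubgroup).relIndex (D ⊔ N.toSubgroup) :=
    fun N M hN hMN => ProfiniteBlocks.not_dvd_relIndex_sup hP hDP
      (le_trans (inf_le_inf_right P hN) hN₀) hMN
  obtain ⟨σ, hσ, hσB⟩ := ProfiniteBlocks.exists_normalizerMap k hDp
  choose Φ hΦ hΦu using hσ.existsUnique_block
  refine ⟨fun b => ⟨Φ b.1, hσ.isDefectGroup hDc hDp hN (hΦ b.1) b.2.prop.2⟩,
    ⟨fun b b' h => ?_, fun B => ?_⟩, fun b B => ?_⟩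
  · have h1 : Φ b.1 = Φ b'.1 := congrArg Subtype.val h
    have h2 := hΦ b'.1
    rw [← h1] at h2
    exact Subtype.ext (hσ.block_unique hDc hDp hN (hΦ b.1) h2 b.2.prop.2)
  · obtain ⟨b, hb, hbB⟩ := hσ.exists_block hDc hP hDP hN₀ B.2
    exact ⟨⟨b, hb⟩, Subtype.ext (hΦu b B.1 hbB).symm⟩
  · rw [hσB]
    refine ⟨hΦu b.1 B, ?_⟩
    rintro rfl
    exact hΦ b.1
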